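/- Let $B^2$ be the unit disk in $\mathbb R^2$, and let $L=\{p+tv : t\in\mathbb R\}$, $|v|=1$, be a line (the detector line) that does not meet the closed unit disk, so that the disk lies on one side of and away from $L$. Let $f\in H_0^{1/2}(B^2)$, that is, $f\in L^2(\mathbb R^2)$ (complex valued) belongs to $H^{1/2}(\mathbb R^2)$ and vanishes almost everywhere outside $B^2$. For an angle $\beta$ put $\boldsymbol\beta=(\cos\beta,\sin\beta)$; "almost every $\boldsymbol\beta\in S^1$" refers to arc length. Let $$Rf(\boldsymbol\beta,s)=\int_{\mathbb R} f(s\boldsymbol\beta+r\boldsymbol\beta^\perp)\,dr,\qquad \mathcal D f(x,\alpha)=\int_0^\infty f\big(x+r(\cos\alpha,\sin\alpha)\big)\,dr,$$ $$\mathcal C f(x,\boldsymbol\beta,\psi)=\mathcal D f(x,\beta-\psi)+\mathcal D f(x,\beta+\psi),\qquad x\in L,\ \psi\in[0,\pi],$$ be the Radon, divergent beam and cone transforms of $f$, let $HRf(\boldsymbol\beta,s)=\frac1\pi\,\mathrm{p.v.}\!\int_{\mathbb R}\frac{Rf(\boldsymbol\beta,r)}{s-r}\,dr$, and let $R^\#g(y)=\int_{S^1}g(\boldsymbol\beta,y\cdot\boldsymbol\beta)\,d\boldsymbol\beta$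 be the backprojection. Then the following holds. 1. For every $x\in L$ and almost every $\boldsymbol\beta\in S^1$, both of the following principal value integrals converge (with singularities at $t=x\cdot\boldsymbol\beta$ and $\psi=\pi/2$, respectively), and $$HRf(\boldsymbol\beta,x\cdot\boldsymbol\beta)=\frac1\pi\,\mathrm{p.v.}\!\int_{-\infty}^\infty\frac{Rf(\boldsymbol\beta,t)}{x\cdot\boldsymbol\beta-t}\,dt=-\frac1\pi\,\mathrm{p.v.}\!\int_0^\pi\frac{\mathcal Cf(x,\boldsymbol\beta,\psi)}{\cos\psi}\,d\psi .$$ 2. For $\boldsymbol\beta$ not perpendicular to $L$ and $s\in\mathbb R$, let $x(\boldsymbol\beta,s)$ be the unique point of $L$ with $x(\boldsymbol\beta,s)\cdot\boldsymbol\beta=s$, and define from the cone data on $L$ $$G(\boldsymbol\beta,s)=-\frac1\pi\,\mathrm{p.v.}\!\int_0^\pi\frac{\mathcal Cf(x(\boldsymbol\beta,s),\boldsymbol\beta,\psi)}{\cos\psi}\,d\psi .$$ For almost every $\boldsymbol\beta\in S^1$ and almost every $s\in\mathbb R$, the principal values defining $G(\boldsymbol\beta,s)$ and $HRf(\boldsymbol\beta,s)$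 converge and $G(\boldsymbol\beta,s)=HRf(\boldsymbol\beta,s)$. 3. (Inversion formula.) $G$ has a jointly measurable function $\partial_sG$ on $S^1\times\mathbb R$ such that for almost every $\boldsymbol\beta$ the function $\partial_sG(\boldsymbol\beta,\cdot)$ is the weak derivative of $G(\boldsymbol\beta,\cdot)$ on $\mathbb R$ (both being locally integrable). For every such function $\partial_s G$ and almost every $y\in\mathbb R^2$, the function $\boldsymbol\beta\mapsto\partial_sG(\boldsymbol\beta,y\cdot\boldsymbol\beta)$ is integrable over $S^1$ and $$f(y)=\frac1{4\pi}\,R^\#\big(\partial_sG\big)(y)=\frac1{4\pi}\int_{S^1}\partial_sG(\boldsymbol\beta,y\cdot\boldsymbol\beta)\,d\boldsymbol\beta .$$ -/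

import Mathlib

open MeasureTheory Set Filter Topology
open scoped ContDiff InnerProductSpace

namespace ConeInversion

noncomputable section

/-- The Euclidean plane. -/
abbrev Plane : Type := EuclideanSpace ℝ (Fin 2)

/-- The unit vector `(cos θ, sin θ)`. -/
def dir (θ : ℝ) : Plane := !₂[Real.cos θ, Real.sin θ]

/-- Arc length on the unit circle, read in the angular variable `θ ∈ (0, 2π]`. -/
def circleMeasure : Measure ℝ := volume.restrict (Ioc 0 (2 * Real.pi))

/-- `f ∈ H₀^{1/2}(B²)`: `f`, defined on the whole plane, is a square integrable function in
`H^{1/2}(ℝ²)` that vanishes (almost everywhere) outside the unit disk `B²`. -/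
def MemH0Half (f : Plane → ℂ) : Prop :=
  ∃ hf : MemLp f 2 volume,
    TemperedDistribution.MemSobolev (1 / 2 : ℝ) 2
      (Lp.toTemperedDistribution (hf.toLp f) : TemperedDistribution Plane ℂ) ∧
    ∀ᵐ y : Plane, 1 ≤ ‖y‖ → f y = 0

/-- Divergent beam transform: integral over the ray from `x` in the direction of angle `α`. -/
def divergentBeam (f : Plane → ℂ) (x : Plane) (α : ℝ) : ℂ :=
  ∫ r in Ioi (0 : ℝ), f (x + r • dir α)

/-- Two-dimensional cone transform with vertex `x`, central axis `(cos β, sin β)` and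
half-angle `ψ`. -/
def coneTransform (f : Plane → ℂ) (x : Plane) (β ψ : ℝ) : ℂ :=
  divergentBeam f x (β - ψ) + divergentBeam f x (β + ψ)

/-- Two-dimensional Radon transform: the integral of `f` over the line
`{y | y · (cos θ, sin θ) = s}`. -/
def radon (f : Plane → ℂ) (θ s : ℝ) : ℂ :=
  ∫ r : ℝ, f (s • dir θ + r • dir (θ + Real.pi / 2))

/-- The integral of `F` over `S` converges in the principal value sense at the point `c`. -/
def PVConverges (F : ℝ → ℂ) (S : Set ℝ) (c : ℝ) : Prop :=
  (∀ ε : ℝ, 0 < ε → IntegrableOn F (S \ Icc (c - ε) (c + ε)) volume) ∧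
    ∃ I : ℂ, Tendsto (fun ε : ℝ => ∫ r in S \ Icc (c - ε) (c + ε), F r) (𝓝[>] 0) (𝓝 I)

/-- Principal value at `c` of the integral of `F` over `S` (meaningful under `PVConverges`). -/
def pvIntegral (F : ℝ → ℂ) (S : Set ℝ) (c : ℝ) : ℂ :=
  limUnder (𝓝[>] (0 : ℝ)) (fun ε : ℝ => ∫ r in S \ Icc (c - ε) (c + ε), F r)

/-- The integrand `g(r) h(s - r)`, `h(t) = 1 / t`, of the Hilbert transform. -/
def hilbertIntegrand (g : ℝ → ℂ) (s r : ℝ) : ℂ := g r * ((1 / (s - r) : ℝ) : ℂ)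

/-- Hilbert transform `(1 / π) p.v. ∫ g(r) / (s - r) dr`. -/
def hilbert (g : ℝ → ℂ) (s : ℝ) : ℂ :=
  ((1 / Real.pi : ℝ) : ℂ) * pvIntegral (hilbertIntegrand g s) univ s

/-- The integrand `c(ψ) h(cos ψ)`, `h(t) = 1 / t`, where `c` is a function of the half-angle. -/
def coneIntegrand (c : ℝ → ℂ) (ψ : ℝ) : ℂ := c ψ * ((1 / Real.cos ψ : ℝ) : ℂ)

/-- `-(1 / π) p.v. ∫₀^π c(ψ) h(cos ψ) dψ`. -/
def coneIntegral (c : ℝ → ℂ) : ℂ :=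
  -((1 / Real.pi : ℝ) : ℂ) * pvIntegral (coneIntegrand c) (Icc 0 Real.pi) (Real.pi / 2)

/-- The data measured along the detector line `{p + t v}`: the cone transform as a function of
the vertex parameter `t`, the axis angle `β` and the half-angle `ψ`. -/
def coneData (f : Plane → ℂ) (p v : Plane) (t β ψ : ℝ) : ℂ := coneTransform f (p + t • v) β ψ

/-- The parameter `t` of the point `x = p + t v` of the detector line with
`x · (cos β, sin β) = s`; it exists and is unique unless `(cos β, sin β)` is perpendicular to the
line, which happens for two axes only. -/
def detectorParam (p v : Plane) (β s : ℝ) : ℝ := (s - ⟪p, dir β⟫_ℝ) / ⟪v, dir β⟫_ℝ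

/-- The right-hand side of the cone-to-Radon relation, computed from data `d` on the detector
line, as a function of the axis angle `β` and the linear variable `s = x · (cos β, sin β)`. -/
def filteredData (p v : Plane) (d : ℝ → ℝ → ℝ → ℂ) (β s : ℝ) : ℂ :=
  coneIntegral (d (detectorParam p v β s) β)

/-- `g` is a weak derivative of `G` on the real line. -/
def IsWeakDeriv (G g : ℝ → ℂ) : Prop :=
  LocallyIntegrable G volume ∧ LocallyIntegrable g volume ∧
    ∀ φ : ℝ → ℝ, ContDiff ℝ ∞ φ → HasCompactSupport φ →
      ∫ s, ((deriv φ s : ℝ) : ℂ) * G s = -∫ s, ((φ s : ℝ) : ℂ) * g s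

/-- `g = ∂G/∂s`: `g` is jointly measurable, and for almost every direction it is the weak
derivative of `G` in the linear variable. -/
def IsLinearDeriv (G g : ℝ → ℝ → ℂ) : Prop :=
  AEStronglyMeasurable (Function.uncurry g) (circleMeasure.prod volume) ∧
    ∀ᵐ θ ∂circleMeasure, IsWeakDeriv (G θ) (g θ)

/-- Backprojection `R^# g(y) = ∫_{|ω| = 1} g(ω, y · ω) dω`. -/
def backprojection (g : ℝ → ℝ → ℂ) (y : Plane) : ℂ :=
  ∫ θ, g θ ⟪y, dir θ⟫_ℝ ∂circleMeasure

end

end ConeInversion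

open ConeInversion

/-!
The proof rests on two consequences of `f ∈ H^{1/2}` with support in the unit disk; throughout, `f`
is replaced by a measurable representative `k` that vanishes outside the open disk (`IsAdmissible`).

**Pointwise relation.** By Plancherel's identity `‖k (· + h) - k‖` is `O(√|h|)` in `L²`, hence in
`L¹` because the support is compact (`exists_lintegral_enorm_comp_add_sub_le`). Averaging over small
translations gives the same bound for `k ∘ T - k` whenever `T` preserves area and moves points
little (`lintegral_enorm_comp_sub_le`). The reflection in the line through `x` perpendicular to
`dir β` acts on a point `y` as a rotation about `x` by an angle that depends only on the angle `γ`
between `dir β` and `y - x`, and it moves `y` by `2 |cos γ| ‖y - x‖` (`reflect_eq_spin`). Here `x`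
lies outside the disk, so the kernel `1 / ((y - x) · dir β)` is of size `1 / |cos γ|` on the
support, and the modulus `√|cos γ|` makes it integrable in `γ`. Integrating over `β` therefore
shows: for almost every `β`, the part of `k` that is odd under the reflection is absolutely
integrable against `1 / ((y - x) · dir β)` (`ae_isTame`). Truncating the kernel by a strip (the
Hilbert transform of the Radon transform), by a double sector (the cone integral), or smoothly by
the conjugate Poisson kernel are then three symmetric cut-offs of one absolutely convergent
integral, and by dominated convergence they have the same limit (`tendsto_integral_mul_weight`). The
first two cut-offs give the cone-to-Radon relation (`hilbert_of_isTame`, `cone_of_isTame`), and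
Fubini's theorem along the detector line turns "every detector, almost every direction" into "almost
every direction, almost every `s`". The third identifies the Hilbert transform with the Fourier
multiplier `-i sgn σ` applied to the slice `σ ↦ 𝓕 k (σ dir β)` (`hilbert_eq_filteredSlice`).

**Inversion.** In polar coordinates the `H^{1/2}` energy `∫ |ξ| |𝓕 k ξ|² dξ` is, up to a constant,
the integral over `β` of `∫ σ² |𝓕 k (σ dir β)|² dσ`. So the filtered slices, cut off at frequency
`N` and differentiated, converge in `L²` of the cylinder (`IsAdmissible.exists_limit_ramp`), and the
limit is the weak derivative of the filtered data in almost every direction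
(`IsAdmissible.ae_isWeakDeriv`). Weak derivatives are unique up to null sets (`IsWeakDeriv.ae_eq`)
and backprojection respects null sets, so this one derivative suffices. The backprojection of the
cut-off data is exactly `4 π` times the Fourier inversion integral of `k` over the disk of radius
`N` (`backprojection_ramp`). Backprojection is continuous from `L²` of the cylinder to `L¹` of every
bounded set (`sq_lintegral_lintegral_backprojection_le`) and the Fourier inversion integrals
converge to `k` in `L²`, so the identity passes to the limit (`IsAdmissible.ae_eq_backprojection`).
-/

namespace ConeInversion

open scoped FourierTransform SchwartzMap ENNReal

/-! ### Fourier integrals and the translation modulus -/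

section Fourier

variable {E : Type*} [NormedAddCommGroup E] [InnerProductSpace ℝ E] [FiniteDimensional ℝ E]
  [MeasurableSpace E] [BorelSpace E]

theorem continuous_fourier {k : E → ℂ} (hk : Integrable k) : Continuous (𝓕 k) :=
  VectorFourier.fourierIntegral_continuous Real.continuous_fourierChar
    (by exact continuous_inner) hk

theorem norm_fourier_le (k : E → ℂ) (ξ : E) : ‖𝓕 k ξ‖ ≤ ∫ y, ‖k y‖ :=
  VectorFourier.norm_fourierIntegral_le_integral_norm _ _ _ _ _

/-- Locally integrable functions that agree as distributions against Schwartz functions agree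
almost everywhere. -/
theorem ae_eq_of_integral_schwartz_smul_eq {k l : E → ℂ} (hk : LocallyIntegrable k)
    (hl : LocallyIntegrable l) (h : ∀ u : 𝓢(E, ℂ), ∫ x, u x • k x = ∫ x, u x • l x) :
    k =ᵐ[volume] l := by
  refine ae_eq_of_integral_contDiff_smul_eq hk hl fun g hg hgc => ?_
  have h1 : HasCompactSupport (Complex.ofRealCLM ∘ g) := hgc.comp_left rfl
  have h2 : ContDiff ℝ ∞ (Complex.ofRealCLM ∘ g) := by fun_prop
  simpa using h (h1.toSchwartzMap h2)

/-- On `L¹ ∩ L²` the Fourier transform of `L²` is given by the Fourier integral. -/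
theorem coeFn_fourier_toLp {k : E → ℂ} (hk : Integrable k) (hk2 : MemLp k 2 volume) :
    ((𝓕 (hk2.toLp k) : Lp ℂ 2 (volume : Measure E)) : E → ℂ) =ᵐ[volume] 𝓕 k := by
  refine ae_eq_of_integral_schwartz_smul_eq ((Lp.memLp _).locallyIntegrable (by norm_num))
    (continuous_fourier hk).locallyIntegrable fun u => ?_
  have h1 := DFunLike.congr_fun (Lp.fourier_toTemperedDistribution_eq (hk2.toLp k)) u
  rw [TemperedDistribution.fourier_apply, Lp.toTemperedDistribution_apply,
    Lp.toTemperedDistribution_apply] at h1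
  rw [← h1]
  have h2 : ∫ x, 𝓕 (u : E → ℂ) x • k x = ∫ x, u x • 𝓕 k x :=
    VectorFourier.integral_fourierIntegral_smul_eq_flip (L := innerₗ E)
      Real.continuous_fourierChar continuous_inner u.integrable hk |>.trans (by
        simp only [flip_innerₗ]; rfl)
  rw [← h2]
  refine integral_congr_ae ?_
  filter_upwards [hk2.coeFn_toLp] with x hx
  rw [hx, SchwartzMap.fourier_coe]

/-- Plancherel's identity for the Fourier integral of a function in `L¹ ∩ L²`. -/
theorem eLpNorm_fourier {k : E → ℂ} (hk : Integrable k) (hk2 : MemLp k 2 volume) :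
    eLpNorm (𝓕 k) 2 volume = eLpNorm k 2 volume := by
  rw [← eLpNorm_congr_ae (coeFn_fourier_toLp hk hk2), ← Lp.enorm_def, ← ofReal_norm,
    Lp.norm_fourier_eq, ofReal_norm, Lp.enorm_toLp]

theorem memLp_fourier {k : E → ℂ} (hk : Integrable k) (hk2 : MemLp k 2 volume) :
    MemLp (𝓕 k) 2 volume :=
  ⟨(continuous_fourier hk).aestronglyMeasurable, by
    rw [eLpNorm_fourier hk hk2]; exact hk2.2⟩

theorem eLpNorm_two_sq {α : Type*} [MeasurableSpace α] (μ : Measure α) (k : α → ℂ) :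
    eLpNorm k 2 μ ^ 2 = ∫⁻ x, ‖k x‖ₑ ^ 2 ∂μ := by
  have := eLpNorm_nnreal_pow_eq_lintegral (μ := μ) (f := k) (p := 2) (by norm_num)
  simpa using this

theorem memLp_two_of_lintegral_lt_top {α : Type*} [MeasurableSpace α] {μ : Measure α} {u : α → ℂ}
    (hu : AEStronglyMeasurable u μ) (h : ∫⁻ x, ‖u x‖ₑ ^ 2 ∂μ < ⊤) : MemLp u 2 μ := by
  refine ⟨hu, ?_⟩
  rw [← eLpNorm_two_sq] at h
  exact (ENNReal.pow_lt_top_iff).1 h |>.resolve_right two_ne_zero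

theorem lintegral_enorm_fourier_sq {k : E → ℂ} (hk : Integrable k) (hk2 : MemLp k 2 volume) :
    ∫⁻ ξ, ‖𝓕 k ξ‖ₑ ^ 2 = ∫⁻ x, ‖k x‖ₑ ^ 2 := by
  rw [← eLpNorm_two_sq, ← eLpNorm_two_sq, eLpNorm_fourier hk hk2]

/-- A function in `L¹ ∩ H^{1/2}` has finite energy `∫ |ξ| |𝓕 k ξ|² dξ`. -/
theorem lintegral_enorm_mul_fourier_sq_lt_top {k : E → ℂ} (hk : Integrable k)
    (hk2 : MemLp k 2 volume)
    (hs : TemperedDistribution.MemSobolev (1 / 2 : ℝ) 2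
      (Lp.toTemperedDistribution (hk2.toLp k) : TemperedDistribution E ℂ)) :
    ∫⁻ ξ, ‖ξ‖ₑ * ‖𝓕 k ξ‖ₑ ^ 2 < ⊤ := by
  rw [TemperedDistribution.memSobolev_iff_exists_smulLeftCLM_fourier] at hs
  obtain ⟨l, hl⟩ := hs
  rw [Lp.fourier_toTemperedDistribution_eq] at hl
  have hw := Function.hasTemperateGrowth_one_add_norm_sq_rpow E ((1 / 2 : ℝ) / 2)
  have hw' : (fun x : E ↦ (((1 + ‖x‖ ^ 2) ^ ((1 / 2 : ℝ) / 2) : ℝ) : ℂ)).HasTemperateGrowth := by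
    fun_prop
  have hwc : Continuous fun x : E ↦ (((1 + ‖x‖ ^ 2) ^ ((1 / 2 : ℝ) / 2) : ℝ) : ℂ) :=
    hw'.1.continuous
  have hae : (fun x : E ↦ (((1 + ‖x‖ ^ 2) ^ ((1 / 2 : ℝ) / 2) : ℝ) : ℂ) • 𝓕 k x)
      =ᵐ[volume] l := by
    refine ae_eq_of_integral_schwartz_smul_eq
      ((hwc.smul (continuous_fourier hk)).locallyIntegrable)
      ((Lp.memLp _).locallyIntegrable (by norm_num)) fun u => ?_
    have h1 := DFunLike.congr_fun hl u
    rw [TemperedDistribution.smulLeftCLM_apply_apply, Lp.toTemperedDistribution_apply,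
      Lp.toTemperedDistribution_apply] at h1
    rw [← h1]
    refine integral_congr_ae ?_
    filter_upwards [coeFn_fourier_toLp hk hk2] with x hx
    rw [hx, SchwartzMap.smulLeftCLM_apply_apply hw']
    simp only [smul_eq_mul]
    ring
  calc ∫⁻ ξ, ‖ξ‖ₑ * ‖𝓕 k ξ‖ₑ ^ 2 ≤ ∫⁻ ξ, ‖l ξ‖ₑ ^ 2 := by
        refine lintegral_mono_ae ?_
        filter_upwards [hae] with x hx
        rw [← hx, enorm_smul, mul_pow]
        gcongr
        rw [← enorm_pow, enorm_le_iff_norm_le, norm_pow, Complex.norm_real, Real.norm_eq_abs,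
          sq_abs, ← Real.rpow_natCast, ← Real.rpow_mul (by positivity)]
        norm_num
        rw [← Real.sqrt_eq_rpow]
        exact Real.le_sqrt_of_sq_le (by linarith)
    _ = eLpNorm l 2 volume ^ 2 := (eLpNorm_two_sq _ _).symm
    _ < ⊤ := ENNReal.pow_lt_top (Lp.memLp l).2

theorem fourier_comp_add_sub {k : E → ℂ} (hk : Integrable k) (h ξ : E) :
    𝓕 (fun y => k (y + h) - k y) ξ =
      (Complex.exp (((2 * Real.pi * ⟪h, ξ⟫_ℝ : ℝ) : ℂ) * Complex.I) - 1) * 𝓕 k ξ := by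
  have h1 : 𝓕 (fun y => k (y + h)) ξ = (𝐞 ⟪h, ξ⟫_ℝ : ℂ) * 𝓕 k ξ := by
    have := congrFun (VectorFourier.fourierIntegral_comp_add_right (L := innerₗ E) 𝐞
      (volume : Measure E) k h) ξ
    exact this
  have h2 : 𝓕 (fun y => k (y + h) - k y) ξ = 𝓕 (fun y => k (y + h)) ξ - 𝓕 k ξ := by
    simp only [Real.fourier_eq]
    rw [← integral_sub]
    · simp only [smul_sub]
    · exact (Real.fourierIntegral_convergent_iff ξ).2 (hk.comp_add_right h)
    · exact (Real.fourierIntegral_convergent_iff ξ).2 hk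
  rw [h2, h1, Real.fourierChar_apply]
  ring

theorem norm_exp_mul_I_sub_one_sq_le (t : ℝ) : ‖Complex.exp (t * Complex.I) - 1‖ ^ 2 ≤ 2 * |t| := by
  have h1 : ‖Complex.exp (t * Complex.I) - 1‖ ≤ |t| := by
    have := Real.norm_exp_I_mul_ofReal_sub_one_le (x := t)
    rwa [mul_comm, Real.norm_eq_abs] at this
  have h2 : ‖Complex.exp (t * Complex.I) - 1‖ ≤ 2 := by
    refine (norm_sub_le _ _).trans ?_
    rw [Complex.norm_exp_ofReal_mul_I]
    norm_num
  nlinarith [norm_nonneg (Complex.exp (t * Complex.I) - 1), abs_nonneg t]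

/-- The `L²` modulus of continuity of a function of finite energy is of order `1 / 2`. -/
theorem lintegral_enorm_comp_add_sub_sq_le {k : E → ℂ} (hk : Integrable k)
    (hk2 : MemLp k 2 volume) (h : E) :
    ∫⁻ y, ‖k (y + h) - k y‖ₑ ^ 2 ≤
      ENNReal.ofReal (4 * Real.pi * ‖h‖) * ∫⁻ ξ, ‖ξ‖ₑ * ‖𝓕 k ξ‖ₑ ^ 2 := by
  have hmp : MeasurePreserving (fun y : E => y + h) volume volume :=
    measurePreserving_add_right _ _
  have hpl := lintegral_enorm_fourier_sq (k := fun y => k (y + h) - k y)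
    ((hk.comp_add_right h).sub hk) ((hk2.comp_measurePreserving hmp).sub hk2)
  rw [← hpl, ← lintegral_const_mul' _ _ ENNReal.ofReal_ne_top]
  refine lintegral_mono fun ξ => ?_
  rw [fourier_comp_add_sub hk, enorm_mul, mul_pow, ← mul_assoc]
  gcongr
  rw [← enorm_pow, ← ofReal_norm, ← ofReal_norm, norm_pow, ← ENNReal.ofReal_mul (by positivity)]
  refine ENNReal.ofReal_le_ofReal ((norm_exp_mul_I_sub_one_sq_le _).trans ?_)
  rw [abs_mul, abs_of_pos (by positivity : 0 < 2 * Real.pi)]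
  nlinarith [abs_real_inner_le_norm h ξ, Real.pi_pos]

theorem sq_lintegral_enorm_le {α : Type*} [MeasurableSpace α] {μ : Measure α} {k : α → ℂ}
    (hk : AEStronglyMeasurable k μ) :
    (∫⁻ x, ‖k x‖ₑ ∂μ) ^ 2 ≤ (∫⁻ x, ‖k x‖ₑ ^ 2 ∂μ) * μ univ := by
  have h := eLpNorm_le_eLpNorm_mul_rpow_measure_univ (p := 1) (q := 2) (by norm_num) hk
  rw [eLpNorm_one_eq_lintegral_enorm] at h
  calc (∫⁻ x, ‖k x‖ₑ ∂μ) ^ 2 ≤ (eLpNorm k 2 μ * μ univ ^ (1 / (1 : ℝ≥0∞).toReal -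
        1 / (2 : ℝ≥0∞).toReal)) ^ 2 := by gcongr
    _ = _ := by
      rw [mul_pow, eLpNorm_two_sq, ← ENNReal.rpow_natCast (μ univ ^ _), ← ENNReal.rpow_mul]
      norm_num

/-- The `L¹` modulus of continuity of a compactly supported function of finite energy is of order
`1 / 2`: near the origin by the Cauchy-Schwarz inequality on a fixed ball, and trivially
elsewhere. -/
theorem exists_lintegral_enorm_comp_add_sub_le {k : E → ℂ} (hk : Integrable k)
    (hk2 : MemLp k 2 volume) (hsupp : ∀ y, 1 ≤ ‖y‖ → k y = 0)
    (hs : ∫⁻ ξ, ‖ξ‖ₑ * ‖𝓕 k ξ‖ₑ ^ 2 < ⊤) :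
    ∃ C : ℝ≥0∞, C ≠ ⊤ ∧
      ∀ h : E, ∫⁻ y, ‖k (y + h) - k y‖ₑ ≤ C * ENNReal.ofReal √‖h‖ := by
  set A := ∫⁻ ξ, ‖ξ‖ₑ * ‖𝓕 k ξ‖ₑ ^ 2 with hA
  set V := volume (Metric.ball (0 : E) 2) with hV
  have hVt : V ≠ ⊤ := measure_ball_lt_top.ne
  set B := (ENNReal.ofReal (4 * Real.pi) * A * V).toReal with hB
  have hB' : ENNReal.ofReal B = ENNReal.ofReal (4 * Real.pi) * A * V :=
    ENNReal.ofReal_toReal (ENNReal.mul_ne_top (ENNReal.mul_ne_top ENNReal.ofReal_ne_top hs.ne) hVt)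
  have hk1 : ∫⁻ y, ‖k y‖ₑ ≠ ⊤ := hk.2.ne
  refine ⟨ENNReal.ofReal √B + 2 * ∫⁻ y, ‖k y‖ₑ, by finiteness, fun h => ?_⟩
  rcases le_total ‖h‖ 1 with hh | hh
  · have hz : ∀ y ∉ Metric.ball (0 : E) 2, ‖k (y + h) - k y‖ₑ = 0 := by
      intro y hy
      have hy2 : 2 ≤ ‖y‖ := by simpa using hy
      have h1 : ‖y‖ ≤ ‖y + h‖ + ‖h‖ := by
        simpa using norm_sub_le (y + h) h
      rw [hsupp y (by linarith), hsupp (y + h) (by linarith)]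
      simp
    have h1 : ∫⁻ y, ‖k (y + h) - k y‖ₑ = ∫⁻ y in Metric.ball (0 : E) 2, ‖k (y + h) - k y‖ₑ := by
      rw [← lintegral_indicator measurableSet_ball]
      refine lintegral_congr fun y => ?_
      by_cases hy : y ∈ Metric.ball (0 : E) 2
      · rw [indicator_of_mem hy]
      · rw [indicator_of_notMem hy, hz y hy]
    have hmeas : AEStronglyMeasurable (fun y => k (y + h) - k y) volume :=
      ((hk.comp_add_right h).sub hk).1
    have h2 : (∫⁻ y, ‖k (y + h) - k y‖ₑ) ^ 2 ≤ (ENNReal.ofReal √B * ENNReal.ofReal √‖h‖) ^ 2 := by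
      calc (∫⁻ y, ‖k (y + h) - k y‖ₑ) ^ 2
          ≤ (∫⁻ y in Metric.ball (0 : E) 2, ‖k (y + h) - k y‖ₑ ^ 2) * V := by
            rw [h1]
            simpa using sq_lintegral_enorm_le hmeas.restrict
        _ ≤ ENNReal.ofReal (4 * Real.pi * ‖h‖) * A * V := by
            gcongr
            exact (setLIntegral_le_lintegral _ _).trans
              (lintegral_enorm_comp_add_sub_sq_le hk hk2 h)
        _ = ENNReal.ofReal B * ENNReal.ofReal ‖h‖ := by
            rw [hB', ENNReal.ofReal_mul (by positivity)]
            ring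
        _ = _ := by
            rw [mul_pow, ← ENNReal.ofReal_pow (Real.sqrt_nonneg _),
              ← ENNReal.ofReal_pow (Real.sqrt_nonneg _), Real.sq_sqrt ENNReal.toReal_nonneg,
              Real.sq_sqrt (norm_nonneg _)]
    refine ((ENNReal.pow_le_pow_left_iff two_ne_zero).1 h2).trans ?_
    gcongr
    exact le_self_add
  · have h1 : (1 : ℝ≥0∞) ≤ ENNReal.ofReal √‖h‖ := by
      rw [← ENNReal.ofReal_one]
      exact ENNReal.ofReal_le_ofReal (Real.one_le_sqrt.2 hh)
    calc ∫⁻ y, ‖k (y + h) - k y‖ₑ ≤ ∫⁻ y, (‖k (y + h)‖ₑ + ‖k y‖ₑ) :=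
          lintegral_mono fun y => enorm_sub_le
      _ = (∫⁻ y, ‖k (y + h)‖ₑ) + ∫⁻ y, ‖k y‖ₑ := lintegral_add_right' _ hk.1.enorm
      _ = 2 * ∫⁻ y, ‖k y‖ₑ := by
          rw [lintegral_add_right_eq_self (fun y => ‖k y‖ₑ) h, two_mul]
      _ ≤ (ENNReal.ofReal √B + 2 * ∫⁻ y, ‖k y‖ₑ) * 1 := by rw [mul_one]; exact le_add_self
      _ ≤ _ := by gcongr

/-- A bound on the translation modulus controls `k ∘ T - k` for every measure preserving map `T`
that moves the support of `k` by at most `η`: average the triangle inequality over the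
intermediate points `T y + h`, `|h| < η`, all of which lie within `2 η` of `y`. -/
theorem lintegral_enorm_comp_sub_le {k : E → ℂ} (hk : Measurable k) {C : ℝ≥0∞}
    (hC : ∀ h : E, ∫⁻ y, ‖k (y + h) - k y‖ₑ ≤ C * ENNReal.ofReal √‖h‖) {T : E → E}
    (hT : MeasurePreserving T volume volume) {η : ℝ} (hη : 0 < η)
    (hTη : ∀ y, (k y = 0 ∧ k (T y) = 0) ∨ ‖T y - y‖ ≤ η) :
    ∫⁻ y, ‖k (T y) - k y‖ₑ ≤
      (1 + 2 ^ (Module.finrank ℝ E + 1)) * C * ENNReal.ofReal √η := by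
  set B := Metric.ball (0 : E) η with hB
  set B2 := Metric.ball (0 : E) (2 * η) with hB2
  have hV0 : volume B ≠ 0 := (Metric.measure_ball_pos _ _ hη).ne'
  have hVt : volume B ≠ ⊤ := measure_ball_lt_top.ne
  have hV2 : volume B2 = 2 ^ Module.finrank ℝ E * volume B := by
    rw [hB2, Measure.addHaar_ball_mul_of_pos _ _ two_pos, ENNReal.ofReal_pow (by norm_num)]
    norm_num
    rfl
  -- `T y + h` with `|h| < η` is `y + h'` with `|h'| < 2 η`
  have hpt : ∀ y, ∫⁻ _ in B, ‖k (T y) - k y‖ₑ ≤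
      (∫⁻ h in B, ‖k (T y + h) - k (T y)‖ₑ) + ∫⁻ h in B2, ‖k (y + h) - k y‖ₑ := by
    intro y
    rcases hTη y with h0 | hy
    · simp [h0.1, h0.2]
    · calc ∫⁻ _ in B, ‖k (T y) - k y‖ₑ
          ≤ ∫⁻ h in B, (‖k (T y + h) - k (T y)‖ₑ + ‖k (T y + h) - k y‖ₑ) := by
            refine lintegral_mono fun h => ?_
            have : k (T y) - k y = (k (T y + h) - k y) - (k (T y + h) - k (T y)) := by ring
            rw [this, add_comm ‖k (T y + h) - k (T y)‖ₑ]
            exact enorm_sub_le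
        _ = (∫⁻ h in B, ‖k (T y + h) - k (T y)‖ₑ) + ∫⁻ h in B, ‖k (T y + h) - k y‖ₑ :=
            lintegral_add_left (by fun_prop) _
        _ ≤ _ := by
            refine add_le_add_right ?_ _
            rw [← lintegral_indicator measurableSet_ball,
              ← lintegral_add_right_eq_self _ (y - T y), ← lintegral_indicator measurableSet_ball]
            refine lintegral_mono fun h => ?_
            by_cases hh : h + (y - T y) ∈ B
            · have hmem : h ∈ B2 := by
                rw [hB, mem_ball_zero_iff] at hh
                rw [hB2, mem_ball_zero_iff]
                have h1 : h = (h + (y - T y)) + (T y - y) := by abel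
                rw [h1]
                refine (norm_add_le _ _).trans_lt (by linarith)
              rw [indicator_of_mem hh, indicator_of_mem hmem]
              have : T y + (h + (y - T y)) = y + h := by abel
              rw [this]
            · rw [indicator_of_notMem hh]
              exact zero_le
  have hm1 : Measurable fun q : E × E => ‖k (T q.1 + q.2) - k (T q.1)‖ₑ := by
    have := hT.measurable
    fun_prop
  have hm2 : Measurable fun q : E × E => ‖k (q.1 + q.2) - k q.1‖ₑ := by fun_prop
  have hsqrt : √(2 * η) ≤ 2 * √η := by
    rw [Real.sqrt_mul (by norm_num)]
    gcongr
    rw [Real.sqrt_le_left (by norm_num)]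
    norm_num
  have hmain : volume B * ∫⁻ y, ‖k (T y) - k y‖ₑ ≤
      volume B * ((1 + 2 ^ (Module.finrank ℝ E + 1)) * C * ENNReal.ofReal √η) := by
    calc volume B * ∫⁻ y, ‖k (T y) - k y‖ₑ = ∫⁻ y, ∫⁻ _ in B, ‖k (T y) - k y‖ₑ := by
          rw [← lintegral_const_mul' _ _ hVt]
          simp [mul_comm]
      _ ≤ ∫⁻ y, ((∫⁻ h in B, ‖k (T y + h) - k (T y)‖ₑ) + ∫⁻ h in B2, ‖k (y + h) - k y‖ₑ) :=
          lintegral_mono hpt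
      _ = (∫⁻ y, ∫⁻ h in B, ‖k (T y + h) - k (T y)‖ₑ) +
            ∫⁻ y, ∫⁻ h in B2, ‖k (y + h) - k y‖ₑ :=
          lintegral_add_left hm1.lintegral_prod_right' _
      _ = (∫⁻ h in B, ∫⁻ y, ‖k (T y + h) - k (T y)‖ₑ) +
            ∫⁻ h in B2, ∫⁻ y, ‖k (y + h) - k y‖ₑ := by
          congr 1
          · exact lintegral_lintegral_swap hm1.aemeasurable
          · exact lintegral_lintegral_swap hm2.aemeasurable
      _ = (∫⁻ h in B, ∫⁻ y, ‖k (y + h) - k y‖ₑ) +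
            ∫⁻ h in B2, ∫⁻ y, ‖k (y + h) - k y‖ₑ := by
          congr 1
          refine lintegral_congr fun h => ?_
          exact hT.lintegral_comp (f := fun y => ‖k (y + h) - k y‖ₑ) (by fun_prop)
      _ ≤ (∫⁻ _ in B, C * ENNReal.ofReal √η) + ∫⁻ _ in B2, C * ENNReal.ofReal √(2 * η) := by
          gcongr ?_ + ?_
          · refine setLIntegral_mono' measurableSet_ball fun h hh => (hC h).trans ?_
            gcongr
            exact (mem_ball_zero_iff.1 hh).le
          · refine setLIntegral_mono' measurableSet_ball fun h hh => (hC h).trans ?_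
            gcongr
            exact (mem_ball_zero_iff.1 hh).le
      _ = C * ENNReal.ofReal √η * volume B +
            C * ENNReal.ofReal √(2 * η) * (2 ^ Module.finrank ℝ E * volume B) := by
          rw [setLIntegral_const, setLIntegral_const, hV2]
      _ ≤ C * ENNReal.ofReal √η * volume B +
            C * ENNReal.ofReal (2 * √η) * (2 ^ Module.finrank ℝ E * volume B) := by gcongr
      _ = _ := by
          rw [ENNReal.ofReal_mul (by norm_num), ENNReal.ofReal_ofNat]
          ring
  exact (ENNReal.mul_le_mul_iff_right hV0 hVt).1 hmain

end Fourier

/-! ### Frames and rotations of the plane -/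

section Plane

@[simp] theorem dir_apply_zero (θ : ℝ) : dir θ 0 = Real.cos θ := rfl

@[simp] theorem dir_apply_one (θ : ℝ) : dir θ 1 = Real.sin θ := rfl

@[fun_prop]
theorem continuous_dir : Continuous dir := by
  unfold dir
  fun_prop

theorem inner_plane (y z : Plane) : ⟪y, z⟫_ℝ = y 0 * z 0 + y 1 * z 1 := by
  simp [PiLp.inner_apply, Fin.sum_univ_two, mul_comm]

theorem inner_dir_dir (α β : ℝ) : ⟪dir α, dir β⟫_ℝ = Real.cos (α - β) := by
  rw [inner_plane, Real.cos_sub]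
  rfl

@[simp] theorem inner_dir_self (θ : ℝ) : ⟪dir θ, dir θ⟫_ℝ = 1 := by
  rw [inner_dir_dir, sub_self, Real.cos_zero]

@[simp] theorem inner_dir_perp (θ : ℝ) : ⟪dir (θ + Real.pi / 2), dir θ⟫_ℝ = 0 := by
  simp [inner_dir_dir]

@[simp] theorem inner_perp_dir (θ : ℝ) : ⟪dir θ, dir (θ + Real.pi / 2)⟫_ℝ = 0 := by
  rw [real_inner_comm, inner_dir_perp]

@[simp] theorem norm_dir (θ : ℝ) : ‖dir θ‖ = 1 := by
  have h : ‖dir θ‖ ^ 2 = 1 := by rw [← real_inner_self_eq_norm_sq, inner_dir_self]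
  nlinarith [norm_nonneg (dir θ)]

theorem dir_add_pi (θ : ℝ) : dir (θ + Real.pi) = -dir θ := by
  ext i
  fin_cases i <;> simp [dir]

theorem dir_periodic : Function.Periodic dir (2 * Real.pi) := fun θ => by
  simp [dir]

theorem cos_smul_dir_add_sin_smul_dir (β ψ : ℝ) :
    Real.cos ψ • dir β + Real.sin ψ • dir (β + Real.pi / 2) = dir (β + ψ) := by
  ext i
  fin_cases i
  · simp [Real.cos_add]; ring
  · simp [Real.sin_add]; ring

theorem exists_eq_norm_smul_dir (z : Plane) :
    ∃ α ∈ Ioc (-Real.pi) Real.pi, z = ‖z‖ • dir α := by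
  have hn : ‖(⟨z 0, z 1⟩ : ℂ)‖ = ‖z‖ := by
    rw [EuclideanSpace.norm_eq, Fin.sum_univ_two, Complex.norm_eq_sqrt_sq_add_sq]
    simp
  refine ⟨Complex.arg ⟨z 0, z 1⟩, ⟨Complex.neg_pi_lt_arg _, Complex.arg_le_pi _⟩, ?_⟩
  ext i
  fin_cases i
  · have := Complex.norm_mul_cos_arg ⟨z 0, z 1⟩
    rw [hn] at this
    simp [this]
  · have := Complex.norm_mul_sin_arg ⟨z 0, z 1⟩
    rw [hn] at this
    simp [this]

/-- The orthonormal frame `(dir θ, dir (θ + π / 2))`. -/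
noncomputable def frame (θ : ℝ) : OrthonormalBasis (Fin 2) ℝ Plane :=
  OrthonormalBasis.mk (v := ![dir θ, dir (θ + Real.pi / 2)])
    (by
      rw [orthonormal_iff_ite]
      intro i j
      fin_cases i <;> fin_cases j <;> simp)
    (by
      intro z _
      have : z = (Real.cos θ * z 0 + Real.sin θ * z 1) • dir θ +
          (Real.cos θ * z 1 - Real.sin θ * z 0) • dir (θ + Real.pi / 2) := by
        ext i
        fin_cases i
        · simp [Real.cos_add_pi_div_two]
          linear_combination (-z 0) * Real.sin_sq_add_cos_sq θ
        · simp [Real.sin_add_pi_div_two]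
          linear_combination (-z 1) * Real.sin_sq_add_cos_sq θ
      rw [this]
      refine add_mem (Submodule.smul_mem _ _ (Submodule.subset_span ⟨0, rfl⟩))
        (Submodule.smul_mem _ _ (Submodule.subset_span ⟨1, rfl⟩)))

@[simp] theorem frame_zero (θ : ℝ) : frame θ 0 = dir θ := by simp [frame]

@[simp] theorem frame_one (θ : ℝ) : frame θ 1 = dir (θ + Real.pi / 2) := by simp [frame]

theorem eq_inner_smul_dir_add (θ : ℝ) (z : Plane) :
    z = ⟪z, dir θ⟫_ℝ • dir θ + ⟪z, dir (θ + Real.pi / 2)⟫_ℝ • dir (θ + Real.pi / 2) := by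
  have := (frame θ).sum_repr z
  rw [Fin.sum_univ_two, frame_zero, frame_one, OrthonormalBasis.repr_apply_apply,
    OrthonormalBasis.repr_apply_apply, frame_zero, frame_one, real_inner_comm,
    real_inner_comm z] at this
  exact this.symm

/-- Cartesian coordinates centred at `x` with axes `dir θ` and `dir (θ + π / 2)`. -/
noncomputable def planeCoord (x : Plane) (θ : ℝ) : ℝ × ℝ ≃ᵐ Plane :=
  ((MeasurableEquiv.finTwoArrow.symm.trans (MeasurableEquiv.toLp 2 (Fin 2 → ℝ))).trans
    (frame θ).repr.symm.toMeasurableEquiv).trans (MeasurableEquiv.addLeft x)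

theorem planeCoord_apply (x : Plane) (θ : ℝ) (q : ℝ × ℝ) :
    planeCoord x θ q = x + (q.1 • dir θ + q.2 • dir (θ + Real.pi / 2)) := by
  change x + (frame θ).repr.symm (WithLp.toLp 2 (MeasurableEquiv.finTwoArrow.symm q)) = _
  rw [← OrthonormalBasis.sum_repr_symm]
  simp [Fin.sum_univ_two, MeasurableEquiv.finTwoArrow]

theorem measurePreserving_planeCoord (x : Plane) (θ : ℝ) :
    MeasurePreserving (planeCoord x θ) volume volume := by
  refine MeasurePreserving.trans (MeasurePreserving.trans (MeasurePreserving.trans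
    (volume_preserving_finTwoArrow ℝ).symm (PiLp.volume_preserving_toLp (Fin 2)))
    (frame θ).repr.symm.measurePreserving) (measurePreserving_add_left volume x)

@[simp] theorem inner_planeCoord_sub (x : Plane) (θ : ℝ) (q : ℝ × ℝ) :
    ⟪planeCoord x θ q - x, dir θ⟫_ℝ = q.1 := by
  rw [planeCoord_apply, add_sub_cancel_left, inner_add_left, inner_smul_left, inner_smul_left]
  simp

theorem norm_planeCoord_sub_sq (x : Plane) (θ : ℝ) (q : ℝ × ℝ) :
    ‖planeCoord x θ q - x‖ ^ 2 = q.1 ^ 2 + q.2 ^ 2 := by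
  rw [planeCoord_apply, add_sub_cancel_left, ← real_inner_self_eq_norm_sq]
  simp only [inner_add_left, inner_add_right, inner_smul_left, inner_smul_right]
  simp
  ring

/-- The rotation of the plane by the angle `θ`. -/
noncomputable def rotation (θ : ℝ) : Plane ≃ₗᵢ[ℝ] Plane :=
  (frame 0).repr.trans (frame θ).repr.symm

theorem rotation_apply (θ : ℝ) (z : Plane) :
    rotation θ z = ⟪z, dir 0⟫_ℝ • dir θ + ⟪z, dir (Real.pi / 2)⟫_ℝ • dir (θ + Real.pi / 2) := by
  change (frame θ).repr.symm ((frame 0).repr z) = _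
  rw [← OrthonormalBasis.sum_repr_symm, Fin.sum_univ_two,
    OrthonormalBasis.repr_apply_apply, OrthonormalBasis.repr_apply_apply]
  simp only [frame_zero, frame_one, zero_add]
  rw [real_inner_comm, real_inner_comm z]

theorem rotation_dir (θ α : ℝ) : rotation θ (dir α) = dir (θ + α) := by
  rw [rotation_apply, inner_dir_dir, inner_dir_dir, sub_zero, Real.cos_sub_pi_div_two,
    cos_smul_dir_add_sin_smul_dir]

end Plane

/-! ### Principal values of tame functions -/

section PrincipalValue

/-- The function `f` read in the Cartesian coordinates centred at `x` with first axis `dir β`. -/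
noncomputable def sheet (f : Plane → ℂ) (x : Plane) (β : ℝ) (q : ℝ × ℝ) : ℂ := f (planeCoord x β q)

/-- The difference quotient `(F (a, b) - F (-a, b)) / a` of the odd part of `F` in its first
variable. -/
noncomputable def oddQuotient (F : ℝ × ℝ → ℂ) (q : ℝ × ℝ) : ℂ :=
  (F q - F (-q.1, q.2)) * ((1 / q.1 : ℝ) : ℂ)

/-- The part of `f` that is odd with respect to the line through `x` perpendicular to `dir β`
is absolutely integrable against the kernel `1 / ((y - x) · dir β)`. -/
def IsTame (f : Plane → ℂ) (x : Plane) (β : ℝ) : Prop :=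
  Integrable (oddQuotient (sheet f x β))

theorem measurePreserving_negFst :
    MeasurePreserving (fun q : ℝ × ℝ => (-q.1, q.2)) volume volume :=
  (Measure.measurePreserving_neg (volume : Measure ℝ)).prod (MeasurePreserving.id _)

theorem measurableEmbedding_negFst : MeasurableEmbedding (fun q : ℝ × ℝ => (-q.1, q.2)) :=
  ((MeasurableEquiv.neg ℝ).prodCongr (MeasurableEquiv.refl ℝ)).measurableEmbedding

theorem integrable_sheet {f : Plane → ℂ} (hf : Integrable f) (x : Plane) (β : ℝ) :
    Integrable (sheet f x β) :=
  (measurePreserving_planeCoord x β).integrable_comp_emb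
    (planeCoord x β).measurableEmbedding |>.2 hf

theorem sheet_eq_zero_of_ae {f : Plane → ℂ} {x : Plane} {d : ℝ}
    (hfd : ∀ᵐ y, ‖y - x‖ < d → f y = 0) (β : ℝ) :
    ∀ᵐ q : ℝ × ℝ, √(q.1 ^ 2 + q.2 ^ 2) < d → sheet f x β q = 0 := by
  filter_upwards [(measurePreserving_planeCoord x β).quasiMeasurePreserving.ae hfd] with q hq h
  refine hq ?_
  rwa [← norm_planeCoord_sub_sq x β, Real.sqrt_sq (norm_nonneg _)] at h

/-- Every regularization of the kernel `1 / a` by even weights that increase to `1` produces the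
same limit, half of the absolutely convergent integral of the odd quotient. -/
theorem tendsto_integral_mul_weight {F : ℝ × ℝ → ℂ} (hF : Integrable (oddQuotient F))
    {w : ℝ → ℝ × ℝ → ℝ} (hw0 : ∀ ε q, |w ε q| ≤ 1) (hwm : ∀ ε, Measurable (w ε))
    (hwe : ∀ ε q, w ε (-q.1, q.2) = w ε q)
    (hwt : ∀ q : ℝ × ℝ, q.1 ≠ 0 → Tendsto (fun ε => w ε q) (𝓝[>] 0) (𝓝 1))
    (hwi : ∀ᶠ ε in 𝓝[>] 0, Integrable fun q => F q * ((w ε q / q.1 : ℝ) : ℂ)) :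
    Tendsto (fun ε => ∫ q, F q * ((w ε q / q.1 : ℝ) : ℂ)) (𝓝[>] 0)
      (𝓝 ((1 / 2 : ℂ) * ∫ q, oddQuotient F q)) := by
  have h1 : ∀ᶠ ε in 𝓝[>] 0, (1 / 2 : ℂ) * ∫ q, oddQuotient F q * ((w ε q : ℝ) : ℂ) =
      ∫ q, F q * ((w ε q / q.1 : ℝ) : ℂ) := by
    filter_upwards [hwi] with ε hi
    have hi' : Integrable fun q : ℝ × ℝ => F (-q.1, q.2) * ((w ε q / (-q.1) : ℝ) : ℂ) := by
      have := (measurePreserving_negFst.integrable_comp_emb measurableEmbedding_negFst).2 hi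
      refine this.congr (Eventually.of_forall fun q => ?_)
      simp only [Function.comp, hwe]
    have h2 : ∫ q : ℝ × ℝ, F (-q.1, q.2) * ((w ε q / (-q.1) : ℝ) : ℂ) =
        ∫ q, F q * ((w ε q / q.1 : ℝ) : ℂ) := by
      have := measurePreserving_negFst.integral_comp measurableEmbedding_negFst
        fun q => F q * ((w ε q / q.1 : ℝ) : ℂ)
      simpa only [hwe] using this
    have h3 : ∫ q, oddQuotient F q * ((w ε q : ℝ) : ℂ) =
        (∫ q, F q * ((w ε q / q.1 : ℝ) : ℂ)) +
          ∫ q : ℝ × ℝ, F (-q.1, q.2) * ((w ε q / (-q.1) : ℝ) : ℂ) := by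
      rw [← integral_add hi hi']
      refine integral_congr_ae (Eventually.of_forall fun q => ?_)
      simp only [oddQuotient]
      push_cast
      rw [div_neg]
      ring
    rw [h3, h2]
    ring
  refine Tendsto.congr' h1 (Tendsto.const_mul _ ?_)
  refine tendsto_integral_filter_of_dominated_convergence (fun q => ‖oddQuotient F q‖) ?_ ?_
    hF.norm ?_
  · refine Eventually.of_forall fun ε => hF.1.mul ?_
    exact (Complex.measurable_ofReal.comp (hwm ε)).aestronglyMeasurable
  · refine Eventually.of_forall fun ε => Eventually.of_forall fun q => ?_
    rw [norm_mul, Complex.norm_real, Real.norm_eq_abs]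
    exact mul_le_of_le_one_right (norm_nonneg _) (hw0 ε q)
  · refine Eventually.of_forall fun q => ?_
    by_cases hq : q.1 = 0
    · have : oddQuotient F q = 0 := by simp [oddQuotient, hq]
      simp [this]
    · have h := ((Complex.continuous_ofReal.tendsto _).comp (hwt q hq)).const_mul (oddQuotient F q)
      simpa using h

/-- The even weight cutting out the strip `|a| ≤ ε`. -/
noncomputable def stripWeight (ε : ℝ) (q : ℝ × ℝ) : ℝ := {p : ℝ × ℝ | ε < |p.1|}.indicator 1 q

/-- The even weight cutting out the double sector of half-angle `ε` around the second axis. -/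
noncomputable def sectorWeight (ε : ℝ) (q : ℝ × ℝ) : ℝ :=
  {p : ℝ × ℝ | Real.sin ε * √(p.1 ^ 2 + p.2 ^ 2) < |p.1|}.indicator 1 q

theorem measurable_stripWeight (ε : ℝ) : Measurable (stripWeight ε) := by
  refine measurable_one.indicator ?_
  exact measurableSet_lt (by fun_prop) (by fun_prop)

theorem measurable_sectorWeight (ε : ℝ) : Measurable (sectorWeight ε) := by
  refine measurable_one.indicator ?_
  exact measurableSet_lt (by fun_prop) (by fun_prop)

theorem abs_indicator_one_le {α : Type*} (S : Set α) (q : α) :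
    |S.indicator (1 : α → ℝ) q| ≤ 1 := by
  by_cases h : q ∈ S <;> simp [h]

theorem integrable_mul_stripWeight {F : ℝ × ℝ → ℂ} (hF : Integrable F) {ε : ℝ} (hε : 0 < ε) :
    Integrable fun q => F q * ((stripWeight ε q / q.1 : ℝ) : ℂ) := by
  refine (hF.mul_const ((1 / ε : ℝ) : ℂ)).mono ?_ (Eventually.of_forall fun q => ?_)
  · exact hF.1.mul (Complex.measurable_ofReal.comp
      ((measurable_stripWeight ε).div measurable_fst)).aestronglyMeasurable
  · rw [norm_mul, norm_mul]
    gcongr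
    rw [Complex.norm_real, Complex.norm_real, Real.norm_eq_abs, Real.norm_eq_abs, stripWeight]
    by_cases h : ε < |q.1|
    · rw [indicator_of_mem (by exact h), abs_div, abs_of_pos (by positivity : 0 < 1 / ε)]
      simp only [Pi.one_apply, abs_one]
      gcongr
    · rw [indicator_of_notMem (by exact h)]
      simp

theorem integrable_mul_sectorWeight {F : ℝ × ℝ → ℂ} (hF : Integrable F) {d : ℝ} (hd : 0 < d)
    (hFd : ∀ᵐ q : ℝ × ℝ, √(q.1 ^ 2 + q.2 ^ 2) < d → F q = 0) {ε : ℝ} (hε : 0 < ε)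
    (hε' : ε < Real.pi / 2) :
    Integrable fun q => F q * ((sectorWeight ε q / q.1 : ℝ) : ℂ) := by
  have hsin : 0 < Real.sin ε := Real.sin_pos_of_pos_of_lt_pi hε (by linarith [Real.pi_pos])
  refine (hF.mul_const ((1 / (Real.sin ε * d) : ℝ) : ℂ)).mono ?_ ?_
  · exact hF.1.mul (Complex.measurable_ofReal.comp
      ((measurable_sectorWeight ε).div measurable_fst)).aestronglyMeasurable
  · filter_upwards [hFd] with q hq
    by_cases hqd : √(q.1 ^ 2 + q.2 ^ 2) < d
    · simp [hq hqd]
    rw [norm_mul, norm_mul]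
    gcongr
    rw [Complex.norm_real, Complex.norm_real, Real.norm_eq_abs, Real.norm_eq_abs, sectorWeight]
    by_cases h : Real.sin ε * √(q.1 ^ 2 + q.2 ^ 2) < |q.1|
    · rw [indicator_of_mem (by exact h), abs_div,
        abs_of_pos (by positivity : 0 < 1 / (Real.sin ε * d))]
      simp only [Pi.one_apply, abs_one]
      refine one_div_le_one_div_of_le (by positivity) (le_trans ?_ h.le)
      gcongr
      exact not_lt.1 hqd
    · rw [indicator_of_notMem (by exact h), zero_div, abs_zero]
      positivity

theorem tendsto_indicator_of_eventually {S : ℝ → Set (ℝ × ℝ)} {q : ℝ × ℝ} {l : Filter ℝ}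
    (h : ∀ᶠ ε in l, q ∈ S ε) :
    Tendsto (fun ε => (S ε).indicator (1 : ℝ × ℝ → ℝ) q) l (𝓝 1) := by
  refine tendsto_const_nhds.congr' ?_
  filter_upwards [h] with ε hε
  rw [indicator_of_mem hε, Pi.one_apply]

theorem tendsto_integral_stripWeight {F : ℝ × ℝ → ℂ} (hF : Integrable F)
    (hFo : Integrable (oddQuotient F)) :
    Tendsto (fun ε => ∫ q, F q * ((stripWeight ε q / q.1 : ℝ) : ℂ)) (𝓝[>] 0)
      (𝓝 ((1 / 2 : ℂ) * ∫ q, oddQuotient F q)) := by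
  refine tendsto_integral_mul_weight hFo (fun ε q => abs_indicator_one_le _ _)
    measurable_stripWeight (fun ε q => ?_) (fun q hq => ?_) ?_
  · simp [stripWeight, indicator]
  · refine tendsto_indicator_of_eventually ?_
    filter_upwards [Ioo_mem_nhdsGT (abs_pos.2 hq)] with ε hε using hε.2
  · filter_upwards [self_mem_nhdsWithin] with ε hε using integrable_mul_stripWeight hF hε

theorem tendsto_integral_sectorWeight {F : ℝ × ℝ → ℂ} (hF : Integrable F)
    (hFo : Integrable (oddQuotient F)) {d : ℝ} (hd : 0 < d)
    (hFd : ∀ᵐ q : ℝ × ℝ, √(q.1 ^ 2 + q.2 ^ 2) < d → F q = 0) :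
    Tendsto (fun ε => ∫ q, F q * ((sectorWeight ε q / q.1 : ℝ) : ℂ)) (𝓝[>] 0)
      (𝓝 ((1 / 2 : ℂ) * ∫ q, oddQuotient F q)) := by
  refine tendsto_integral_mul_weight hFo (fun ε q => abs_indicator_one_le _ _)
    measurable_sectorWeight (fun ε q => ?_) (fun q hq => ?_) ?_
  · simp [sectorWeight, indicator]
  · refine tendsto_indicator_of_eventually ?_
    have h : Tendsto (fun ε => Real.sin ε * √(q.1 ^ 2 + q.2 ^ 2)) (𝓝 0) (𝓝 0) := by
      have : Continuous fun ε => Real.sin ε * √(q.1 ^ 2 + q.2 ^ 2) := by fun_prop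
      simpa using this.tendsto 0
    exact nhdsWithin_le_nhds (h.eventually_lt_const (abs_pos.2 hq))
  · filter_upwards [Ioo_mem_nhdsGT Real.pi_div_two_pos] with ε hε using
      integrable_mul_sectorWeight hF hd hFd hε.1 hε.2

theorem radon_add_eq_integral_sheet (f : Plane → ℂ) (x : Plane) (β a : ℝ) :
    radon f β (⟪x, dir β⟫_ℝ + a) = ∫ b, sheet f x β (a, b) := by
  unfold radon
  rw [← integral_add_left_eq_self _ ⟪x, dir (β + Real.pi / 2)⟫_ℝ]
  refine integral_congr_ae (Eventually.of_forall fun b => ?_)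
  simp only [sheet, planeCoord_apply]
  congr 1
  conv_rhs => rw [eq_inner_smul_dir_add β x]
  module

/-- The truncated Hilbert transform of the Radon transform is a plane integral outside a strip. -/
theorem integrableOn_and_setIntegral_hilbertIntegrand {f : Plane → ℂ} (hf : Integrable f)
    (x : Plane) (β : ℝ) {ε : ℝ} (hε : 0 < ε) :
    IntegrableOn (hilbertIntegrand (radon f β) ⟪x, dir β⟫_ℝ)
        (univ \ Icc (⟪x, dir β⟫_ℝ - ε) (⟪x, dir β⟫_ℝ + ε)) ∧
      ∫ r in univ \ Icc (⟪x, dir β⟫_ℝ - ε) (⟪x, dir β⟫_ℝ + ε),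
          hilbertIntegrand (radon f β) ⟪x, dir β⟫_ℝ r =
        -∫ q, sheet f x β q * ((stripWeight ε q / q.1 : ℝ) : ℂ) := by
  set s := ⟪x, dir β⟫_ℝ with hs
  set S := univ \ Icc (s - ε) (s + ε) with hS
  have hSm : MeasurableSet S := MeasurableSet.univ.diff measurableSet_Icc
  have hK := integrable_mul_stripWeight (integrable_sheet hf x β) hε
  have hmarg : ∀ a, ∫ b, sheet f x β (a, b) * ((stripWeight ε (a, b) / a : ℝ) : ℂ) =
      -(S.indicator (hilbertIntegrand (radon f β) s) (s + a)) := by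
    intro a
    have hw : ∀ b, stripWeight ε (a, b) = stripWeight ε (a, 0) := by
      intro b
      simp [stripWeight, indicator]
    simp_rw [hw]
    rw [integral_mul_const, ← radon_add_eq_integral_sheet]
    have hmem : s + a ∈ S ↔ ε < |a| := by
      simp only [hS, Set.mem_sdiff, mem_univ, true_and, mem_Icc, lt_abs]
      constructor
      · intro h
        by_contra! h'
        exact h ⟨by linarith, by linarith⟩
      · rintro (h | h) h' <;> linarith [h'.1, h'.2]
    by_cases ha : ε < |a|
    · rw [indicator_of_mem (hmem.2 ha), stripWeight, indicator_of_mem (by exact ha)]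
      simp only [hilbertIntegrand, Pi.one_apply]
      rw [sub_add_cancel_left, one_div_neg_eq_neg_one_div]
      push_cast
      ring
    · rw [indicator_of_notMem (mt hmem.1 ha), stripWeight, indicator_of_notMem (by exact ha)]
      simp
  have hint : Integrable fun a => S.indicator (hilbertIntegrand (radon f β) s) (s + a) := by
    have := hK.integral_prod_left
    simp only [hmarg] at this
    simpa using this.neg
  constructor
  · rw [← integrable_indicator_iff hSm]
    have := hint.comp_add_left (-s)
    simpa using this
  · rw [← integral_indicator hSm, Measure.volume_eq_prod, integral_prod _ hK]
    simp only [hmarg]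
    rw [integral_neg, neg_neg, integral_add_left_eq_self]

/-- At a tame vertex the Hilbert transform of the Radon transform is given by the absolutely
convergent integral of the odd quotient. -/
theorem hilbert_of_isTame {f : Plane → ℂ} (hf : Integrable f) {x : Plane} {β : ℝ}
    (h : IsTame f x β) :
    PVConverges (hilbertIntegrand (radon f β) ⟪x, dir β⟫_ℝ) univ ⟪x, dir β⟫_ℝ ∧
      hilbert (radon f β) ⟪x, dir β⟫_ℝ =
        -((1 / Real.pi : ℝ) : ℂ) * ((1 / 2 : ℂ) * ∫ q, oddQuotient (sheet f x β) q) := by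
  have ht : Tendsto (fun ε : ℝ => ∫ r in univ \ Icc (⟪x, dir β⟫_ℝ - ε) (⟪x, dir β⟫_ℝ + ε),
      hilbertIntegrand (radon f β) ⟪x, dir β⟫_ℝ r) (𝓝[>] 0)
      (𝓝 (-((1 / 2 : ℂ) * ∫ q, oddQuotient (sheet f x β) q))) := by
    refine (tendsto_integral_stripWeight (integrable_sheet hf x β) h).neg.congr' ?_
    filter_upwards [self_mem_nhdsWithin] with ε hε
    exact (integrableOn_and_setIntegral_hilbertIntegrand hf x β hε).2.symm
  refine ⟨⟨fun ε hε => (integrableOn_and_setIntegral_hilbertIntegrand hf x β hε).1, _, ht⟩, ?_⟩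
  rw [hilbert, pvIntegral, ht.limUnder_eq]
  ring

theorem integrableOn_comp_polarCoord_symm {K : ℝ × ℝ → ℂ} (hK : Integrable K) :
    IntegrableOn (fun p : ℝ × ℝ => p.1 • K (polarCoord.symm p)) polarCoord.target := by
  have h := (integrableOn_image_iff_integrableOn_abs_det_fderiv_smul volume
    polarCoord.open_target.measurableSet
    (fun p _ => (hasFDerivAt_polarCoord_symm p).hasFDerivWithinAt) polarCoord.symm.injOn K).1
    hK.integrableOn
  refine h.congr_fun (fun p hp => ?_) polarCoord.open_target.measurableSet
  have hp' : 0 < p.1 := hp.1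
  simp only [det_fderivPolarCoordSymm, abs_of_pos hp']

theorem sin_lt_abs_cos_iff {ε ψ : ℝ} (hε : 0 < ε) (hε' : ε < Real.pi / 2)
    (hψ : ψ ∈ Icc 0 Real.pi) :
    Real.sin ε < |Real.cos ψ| ↔ ψ ∉ Icc (Real.pi / 2 - ε) (Real.pi / 2 + ε) := by
  have h1 : |Real.cos ψ| = Real.sin |Real.pi / 2 - ψ| := by
    rw [← Real.sin_pi_div_two_sub]
    refine Real.abs_sin_eq_sin_abs_of_abs_le_pi ?_
    rw [abs_le]
    constructor <;> linarith [hψ.1, hψ.2, Real.pi_pos]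
  have h2 : |Real.pi / 2 - ψ| ≤ Real.pi / 2 := by
    rw [abs_le]
    constructor <;> linarith [hψ.1, hψ.2]
  rw [h1, Real.strictMonoOn_sin.lt_iff_lt ⟨by linarith, by linarith⟩
    ⟨by linarith [abs_nonneg (Real.pi / 2 - ψ)], h2⟩, ← not_le, abs_le, mem_Icc, not_iff_not]
  constructor <;> rintro ⟨h3, h4⟩ <;> constructor <;> linarith

/-- The truncated integral of the cone transform is a plane integral outside a double sector. -/
theorem integrableOn_and_setIntegral_coneIntegrand {f : Plane → ℂ} (hf : Integrable f)
    {x : Plane} (β : ℝ) {d : ℝ} (hd : 0 < d) (hfd : ∀ᵐ y, ‖y - x‖ < d → f y = 0) {ε : ℝ}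
    (hε : 0 < ε) (hε' : ε < Real.pi / 2) :
    IntegrableOn (coneIntegrand (coneTransform f x β))
        (Icc 0 Real.pi \ Icc (Real.pi / 2 - ε) (Real.pi / 2 + ε)) ∧
      ∫ ψ in Icc 0 Real.pi \ Icc (Real.pi / 2 - ε) (Real.pi / 2 + ε),
          coneIntegrand (coneTransform f x β) ψ =
        ∫ q, sheet f x β q * ((sectorWeight ε q / q.1 : ℝ) : ℂ) := by
  have hFd := sheet_eq_zero_of_ae hfd β
  have hK := integrable_mul_sectorWeight (integrable_sheet hf x β) hd hFd hε hε'
  -- in polar coordinates centred at `x` the weight and the kernel depend on the angle only, and the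
  -- factor `1 / r` of the kernel cancels the Jacobian
  set c : ℝ → ℂ := fun ψ =>
    (({ψ | Real.sin ε < |Real.cos ψ|}.indicator 1 ψ / Real.cos ψ : ℝ) : ℂ) with hc
  have hceven : ∀ ψ, c (-ψ) = c ψ := by
    intro ψ
    simp [hc, indicator]
  have hpol : ∀ p ∈ Ioi (0 : ℝ) ×ˢ Ioo (-Real.pi) Real.pi,
      p.1 • (sheet f x β (polarCoord.symm p) *
        ((sectorWeight ε (polarCoord.symm p) / (polarCoord.symm p).1 : ℝ) : ℂ)) =
      f (x + p.1 • dir (β + p.2)) * c p.2 := by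
    rintro ⟨r, ψ⟩ ⟨hr, -⟩
    replace hr : 0 < r := hr
    have h1 : planeCoord x β (r * Real.cos ψ, r * Real.sin ψ) = x + r • dir (β + ψ) := by
      rw [planeCoord_apply, ← cos_smul_dir_add_sin_smul_dir β ψ, smul_add, smul_smul, smul_smul]
    have h2 : √((r * Real.cos ψ) ^ 2 + (r * Real.sin ψ) ^ 2) = r := by
      rw [mul_pow, mul_pow, ← mul_add, Real.cos_sq_add_sin_sq, mul_one, Real.sqrt_sq hr.le]
    have h3 : sectorWeight ε (r * Real.cos ψ, r * Real.sin ψ) =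
        {ψ | Real.sin ε < |Real.cos ψ|}.indicator 1 ψ := by
      have : Real.sin ε * r < |r * Real.cos ψ| ↔ Real.sin ε < |Real.cos ψ| := by
        rw [abs_mul, abs_of_pos hr, mul_comm, mul_lt_mul_iff_right₀ hr]
      simp only [sectorWeight, indicator, mem_ofPred_eq, h2, this]
      rfl
    simp only [polarCoord_symm_apply, sheet, h1, h3, hc]
    rw [Complex.real_smul]
    have hr' : (r : ℂ) ≠ 0 := Complex.ofReal_ne_zero.2 hr.ne'
    push_cast
    field_simp
  have htm : MeasurableSet (Ioi (0 : ℝ) ×ˢ Ioo (-Real.pi) Real.pi) :=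
    measurableSet_Ioi.prod measurableSet_Ioo
  have hI : Integrable (fun p : ℝ × ℝ => f (x + p.1 • dir (β + p.2)) * c p.2)
      ((volume.restrict (Ioi (0 : ℝ))).prod (volume.restrict (Ioo (-Real.pi) Real.pi))) := by
    rw [Measure.prod_restrict, ← Measure.volume_eq_prod]
    exact (integrableOn_comp_polarCoord_symm hK).congr_fun hpol htm
  have hval : ∫ q, sheet f x β q * ((sectorWeight ε q / q.1 : ℝ) : ℂ) =
      ∫ ψ in Ioo (-Real.pi) Real.pi, divergentBeam f x (β + ψ) * c ψ := by
    rw [← integral_comp_polarCoord_symm, polarCoord_target, setIntegral_congr_fun htm hpol,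
      Measure.volume_eq_prod, ← Measure.prod_restrict, integral_prod_symm _ hI]
    simp only [integral_mul_const, divergentBeam]
  set g : ℝ → ℂ := fun ψ => divergentBeam f x (β + ψ) * c ψ with hg
  have hgi : IntegrableOn g (Ioo (-Real.pi) Real.pi) := by
    have := hI.integral_prod_right
    simp only [integral_mul_const] at this
    exact this
  have hgI : IntervalIntegrable g volume (-Real.pi) Real.pi := by
    rw [intervalIntegrable_iff_integrableOn_Ioo_of_le (by linarith [Real.pi_pos])]
    exact hgi
  have hg1 : IntervalIntegrable g volume (-Real.pi) 0 := hgI.mono_set (by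
    rw [uIcc_of_le (by linarith [Real.pi_pos]), uIcc_of_le (by linarith [Real.pi_pos])]
    exact Icc_subset_Icc_right Real.pi_pos.le)
  have hg2 : IntervalIntegrable g volume 0 Real.pi := hgI.mono_set (by
    rw [uIcc_of_le Real.pi_pos.le, uIcc_of_le (by linarith [Real.pi_pos])]
    exact Icc_subset_Icc_left (by linarith [Real.pi_pos]))
  have hg3 : IntervalIntegrable (fun ψ => g (-ψ)) volume 0 Real.pi := by
    have := (IntervalIntegrable.iff_comp_neg).1 hg1
    simpa using this.symm
  -- folding the angles `-ψ` and `ψ` produces the cone transform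
  have hsum : ∀ ψ, g ψ + g (-ψ) = coneTransform f x β ψ * c ψ := by
    intro ψ
    simp only [hg, hceven, coneTransform, ← sub_eq_add_neg]
    ring
  have hSm : MeasurableSet (Icc (Real.pi / 2 - ε) (Real.pi / 2 + ε))ᶜ := measurableSet_Icc.compl
  have hind : EqOn (fun ψ => coneTransform f x β ψ * c ψ)
      ((Icc (Real.pi / 2 - ε) (Real.pi / 2 + ε))ᶜ.indicator
        (coneIntegrand (coneTransform f x β))) (Icc 0 Real.pi) := by
    intro ψ hψ
    simp only [hc]
    by_cases h : Real.sin ε < |Real.cos ψ|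
    · rw [indicator_of_mem (by exact h), indicator_of_mem ((sin_lt_abs_cos_iff hε hε' hψ).1 h)]
      rfl
    · rw [indicator_of_notMem (by exact h),
        indicator_of_notMem (fun h' => h ((sin_lt_abs_cos_iff hε hε' hψ).2 h'))]
      simp
  have hadd : IntegrableOn (fun ψ => coneTransform f x β ψ * c ψ) (Icc 0 Real.pi) := by
    rw [← intervalIntegrable_iff_integrableOn_Icc_of_le Real.pi_pos.le]
    refine (hg2.add hg3).congr ?_
    exact fun ψ _ => hsum ψ
  rw [Set.sdiff_eq]
  constructor
  · have := hadd.congr_fun hind measurableSet_Icc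
    rwa [IntegrableOn, integrable_indicator_iff hSm, IntegrableOn, Measure.restrict_restrict hSm,
      inter_comm] at this
  · rw [← setIntegral_indicator hSm, ← setIntegral_congr_fun measurableSet_Icc hind, hval,
      ← integral_Ioc_eq_integral_Ioo,
      ← intervalIntegral.integral_of_le (by linarith [Real.pi_pos]),
      ← intervalIntegral.integral_add_adjacent_intervals hg1 hg2, integral_Icc_eq_integral_Ioc,
      ← intervalIntegral.integral_of_le Real.pi_pos.le]
    have hneg : ∫ ψ in (-Real.pi)..0, g ψ = ∫ ψ in (0 : ℝ)..Real.pi, g (-ψ) := by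
      rw [intervalIntegral.integral_comp_neg, neg_zero]
    rw [hneg, add_comm, ← intervalIntegral.integral_add hg2 hg3]
    simp only [hsum]

/-- At a tame vertex at a positive distance from the support, the cone integral is given by the same
absolutely convergent integral as the Hilbert transform in `hilbert_of_isTame`. -/
theorem cone_of_isTame {f : Plane → ℂ} (hf : Integrable f) {x : Plane} {β : ℝ} {d : ℝ}
    (hd : 0 < d) (hfd : ∀ᵐ y, ‖y - x‖ < d → f y = 0) (h : IsTame f x β) :
    PVConverges (coneIntegrand (coneTransform f x β)) (Icc 0 Real.pi) (Real.pi / 2) ∧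
      coneIntegral (coneTransform f x β) =
        -((1 / Real.pi : ℝ) : ℂ) * ((1 / 2 : ℂ) * ∫ q, oddQuotient (sheet f x β) q) := by
  have ht : Tendsto (fun ε : ℝ =>
      ∫ ψ in Icc 0 Real.pi \ Icc (Real.pi / 2 - ε) (Real.pi / 2 + ε),
        coneIntegrand (coneTransform f x β) ψ) (𝓝[>] 0)
      (𝓝 ((1 / 2 : ℂ) * ∫ q, oddQuotient (sheet f x β) q)) := by
    refine (tendsto_integral_sectorWeight (integrable_sheet hf x β) h hd
      (sheet_eq_zero_of_ae hfd β)).congr' ?_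
    filter_upwards [Ioo_mem_nhdsGT Real.pi_div_two_pos] with ε hε
    exact (integrableOn_and_setIntegral_coneIntegrand hf β hd hfd hε.1 hε.2).2.symm
  refine ⟨⟨fun ε hε => ?_, _, ht⟩, ?_⟩
  · -- for large `ε` the truncated domain only shrinks
    have hδ : 0 < min ε (Real.pi / 4) := lt_min hε (by linarith [Real.pi_pos])
    refine (integrableOn_and_setIntegral_coneIntegrand hf β hd hfd hδ
      ((min_le_right _ _).trans_lt (by linarith [Real.pi_pos]))).1.mono_set ?_
    have := min_le_left ε (Real.pi / 4)
    exact sdiff_subset_sdiff_right (Icc_subset_Icc (by linarith) (by linarith))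
  · rw [coneIntegral, pvIntegral, ht.limUnder_eq]

end PrincipalValue

/-! ### Tameness in almost every direction -/

section Tame

/-- The kernel `1 / |cos γ|` times the modulus `√|cos γ|` is integrable: the zeros of the cosine are
simple. -/
theorem intervalIntegrable_inv_sqrt_abs_cos (a b : ℝ) :
    IntervalIntegrable (fun γ => (√|Real.cos γ|)⁻¹) volume a b := by
  have hper : Function.Periodic (fun γ => (√|Real.cos γ|)⁻¹) Real.pi := fun γ => by
    simp [Real.cos_add_pi]
  have hmeas : Measurable fun γ => (√|Real.cos γ|)⁻¹ := by fun_prop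
  have h1 : IntervalIntegrable (fun γ => (√|Real.cos γ|)⁻¹) volume 0 (Real.pi / 2) := by
    have h2 : IntervalIntegrable (fun γ : ℝ => √(Real.pi / 2) * (Real.pi / 2 - γ) ^ (-(1 / 2) : ℝ))
        volume 0 (Real.pi / 2) := by
      have h3 : IntervalIntegrable (fun t : ℝ => t ^ (-(1 / 2) : ℝ)) volume 0 (Real.pi / 2) :=
        intervalIntegral.intervalIntegrable_rpow' (by norm_num)
      have h4 := h3.comp_sub_left (Real.pi / 2)
      simp only [sub_self, sub_zero] at h4
      exact h4.symm.const_mul _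
    refine h2.mono_fun hmeas.aestronglyMeasurable ?_
    refine (ae_restrict_iff' measurableSet_uIoc).2 (Eventually.of_forall fun γ hγ => ?_)
    rw [uIoc_of_le Real.pi_div_two_pos.le] at hγ
    have ht : 0 ≤ Real.pi / 2 - γ := by linarith [hγ.2]
    have hcos : (Real.pi / 2 - γ) / (Real.pi / 2) ≤ Real.cos γ := by
      have := Real.one_sub_mul_le_cos hγ.1.le hγ.2
      refine le_trans (le_of_eq ?_) this
      field_simp
    have hcos0 : 0 ≤ Real.cos γ := le_trans (by positivity) hcos
    change ‖(√|Real.cos γ|)⁻¹‖ ≤ ‖√(Real.pi / 2) * (Real.pi / 2 - γ) ^ (-(1 / 2) : ℝ)‖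
    rw [Real.norm_of_nonneg (by positivity), Real.norm_of_nonneg (by positivity),
      abs_of_nonneg hcos0, Real.rpow_neg ht, ← Real.sqrt_eq_rpow]
    rcases eq_or_lt_of_le ht with h0 | h0
    · have : γ = Real.pi / 2 := by linarith
      simp [this]
    · rw [← div_eq_mul_inv, ← Real.sqrt_div (by positivity), ← Real.sqrt_inv]
      refine Real.sqrt_le_sqrt ?_
      rw [← inv_div]
      exact inv_anti₀ (by positivity) hcos
  have h2 : IntervalIntegrable (fun γ => (√|Real.cos γ|)⁻¹) volume (Real.pi / 2) Real.pi := by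
    have := h1.comp_sub_left Real.pi
    simp only [Real.cos_pi_sub, abs_neg, sub_zero] at this
    have h3 : Real.pi - Real.pi / 2 = Real.pi / 2 := by ring
    rw [h3] at this
    exact this.symm
  exact hper.intervalIntegrable Real.pi_pos.ne' (t := 0) (by simpa using h1.trans h2) a b

theorem dir_add_add_dir_sub (α γ : ℝ) : dir (α + γ) + dir (α - γ) = (2 * Real.cos γ) • dir α := by
  ext i
  fin_cases i
  · simp [Real.cos_add, Real.cos_sub]; ring
  · simp [Real.sin_add, Real.sin_sub]; ring

/-- The reflection of the plane in the line through `x` perpendicular to `dir β`. -/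
noncomputable def reflect (x : Plane) (β : ℝ) (y : Plane) : Plane :=
  y - (2 * ⟪y - x, dir β⟫_ℝ) • dir β

theorem planeCoord_neg_fst (x : Plane) (β : ℝ) (q : ℝ × ℝ) :
    planeCoord x β (-q.1, q.2) = reflect x β (planeCoord x β q) := by
  rw [reflect, inner_planeCoord_sub, planeCoord_apply, planeCoord_apply]
  module

theorem lintegral_enorm_oddQuotient_sheet {k : Plane → ℂ} (hk : Measurable k) (x : Plane) (β : ℝ) :
    ∫⁻ q, ‖oddQuotient (sheet k x β) q‖ₑ =
      ∫⁻ y, ‖k y - k (reflect x β y)‖ₑ * ‖1 / ⟪y - x, dir β⟫_ℝ‖ₑ := by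
  have hm : Measurable fun y => ‖k y - k (reflect x β y)‖ₑ * ‖1 / ⟪y - x, dir β⟫_ℝ‖ₑ := by
    unfold reflect
    fun_prop
  rw [← (measurePreserving_planeCoord x β).lintegral_comp hm]
  refine lintegral_congr fun q => ?_
  rw [inner_planeCoord_sub, ← planeCoord_neg_fst, oddQuotient, enorm_mul]
  congr 1
  rw [← ofReal_norm, ← ofReal_norm, Complex.norm_real]

/-- The point reflection at `x` composed with the rotation about `x` by the angle `2 γ`. -/
noncomputable def spin (x : Plane) (γ : ℝ) (y : Plane) : Plane := x - rotation (2 * γ) (y - x)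

theorem measurePreserving_spin (x : Plane) (γ : ℝ) :
    MeasurePreserving (spin x γ) volume volume :=
  (Measure.measurePreserving_sub_left volume x).comp
    ((rotation (2 * γ)).measurePreserving.comp (measurePreserving_sub_right volume x))

theorem measurable_spin (x : Plane) : Measurable fun q : ℝ × Plane => spin x q.1 q.2 := by
  unfold spin
  simp only [rotation_apply]
  refine Continuous.measurable ?_
  fun_prop

theorem norm_spin_sub (x : Plane) (γ : ℝ) (y : Plane) : ‖spin x γ y - x‖ = ‖y - x‖ := by
  rw [spin, sub_sub_cancel_left, norm_neg, LinearIsometryEquiv.norm_map]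

/-- The reflection in the axis of angle `α + γ`, seen from a point at polar angle `α`, is a rotation
that depends on `γ` only. -/
theorem reflect_eq_spin {x y : Plane} {α : ℝ} (h : y - x = ‖y - x‖ • dir α) (γ : ℝ) :
    reflect x (α + γ) y = spin x γ y ∧ ⟪y - x, dir (α + γ)⟫_ℝ = ‖y - x‖ * Real.cos γ := by
  have h2 : ⟪y - x, dir (α + γ)⟫_ℝ = ‖y - x‖ * Real.cos γ := by
    conv_lhs => rw [h]
    rw [inner_smul_left, inner_dir_dir, sub_add_cancel_left, Real.cos_neg]
    rfl
  refine ⟨?_, h2⟩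
  have h3 : dir (2 * γ + α) + dir α = (2 * Real.cos γ) • dir (α + γ) := by
    rw [← dir_add_add_dir_sub, add_sub_cancel_right]
    congr 2
    ring
  have h4 : rotation (2 * γ) (y - x) = ‖y - x‖ • dir (2 * γ + α) := by
    conv_lhs => rw [h]
    rw [map_smul, rotation_dir]
  have h5 : y = x + ‖y - x‖ • dir α := by rw [← h]; abel
  rw [reflect, spin, h2, h4, eq_sub_of_add_eq h3]
  conv_lhs => enter [1]; rw [h5]
  module

theorem norm_spin_sub_self (x : Plane) (γ : ℝ) (y : Plane) :
    ‖spin x γ y - y‖ = 2 * |Real.cos γ| * ‖y - x‖ := by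
  obtain ⟨α, -, h⟩ := exists_eq_norm_smul_dir (y - x)
  obtain ⟨h1, h2⟩ := reflect_eq_spin h γ
  rw [← h1, reflect, h2, sub_sub_cancel_left, norm_neg, norm_smul, norm_dir, mul_one,
    Real.norm_eq_abs, abs_mul, abs_mul, abs_of_pos (two_pos : (0 : ℝ) < 2), abs_norm]
  ring

/-- The integral of the odd quotients over all axes through an exterior point `x` is finite.
For fixed `y` the axis is measured from the polar angle of `y - x`; then the reflections become
rotations about `x`, whose effect on `k` is controlled by the translation modulus. -/
theorem lintegral_lintegral_enorm_oddQuotient_lt_top {k : Plane → ℂ} (hk : Measurable k)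
    (hsupp : ∀ y, 1 ≤ ‖y‖ → k y = 0) {C : ℝ≥0∞} (hCt : C ≠ ⊤)
    (hC : ∀ h : Plane, ∫⁻ y, ‖k (y + h) - k y‖ₑ ≤ C * ENNReal.ofReal √‖h‖)
    {x : Plane} (hx : 1 < ‖x‖) :
    ∫⁻ β in Ioc 0 (2 * Real.pi), ∫⁻ q, ‖oddQuotient (sheet k x β) q‖ₑ < ⊤ := by
  set m := ‖x‖ - 1 with hm
  have hm0 : 0 < m := by linarith
  set D := ‖x‖ + 1 with hD
  have hD0 : 0 < D := by positivity
  have hnear : ∀ y, ‖y - x‖ < m → k y = 0 := by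
    intro y hy
    refine hsupp y ?_
    have := norm_sub_norm_le x (x - y)
    rw [sub_sub_cancel, norm_sub_rev] at this
    linarith
  have hfar : ∀ y, D < ‖y - x‖ → k y = 0 := by
    intro y hy
    refine hsupp y ?_
    have := norm_sub_le y x
    linarith
  set A : ℝ≥0∞ := (1 + 2 ^ (Module.finrank ℝ Plane + 1)) * C with hA
  have hAt : A ≠ ⊤ := by finiteness
  -- the rotation modulus
  have hmod : ∀ γ, Real.cos γ ≠ 0 → ∫⁻ y, ‖k (spin x γ y) - k y‖ₑ ≤
      A * ENNReal.ofReal √(2 * D * |Real.cos γ|) := by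
    intro γ hγ
    have hη : 0 < 2 * D * |Real.cos γ| := mul_pos (by positivity) (abs_pos.2 hγ)
    refine lintegral_enorm_comp_sub_le hk hC (measurePreserving_spin x γ) hη fun y => ?_
    rcases lt_or_ge D ‖y - x‖ with hy | hy
    · exact Or.inl ⟨hfar y hy, hfar _ (by rwa [norm_spin_sub])⟩
    · right
      rw [norm_spin_sub_self]
      have := abs_nonneg (Real.cos γ)
      nlinarith
  set w : ℝ → ℝ≥0∞ := fun γ => ENNReal.ofReal m⁻¹ * ‖1 / Real.cos γ‖ₑ with hw
  have hwm : Measurable w := by fun_prop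
  have hmeas1 : Measurable fun q : ℝ × Plane =>
      ‖k q.2 - k (reflect x q.1 q.2)‖ₑ * ‖1 / ⟪q.2 - x, dir q.1⟫_ℝ‖ₑ := by
    unfold reflect
    fun_prop
  have hmeas2 : Measurable fun q : ℝ × Plane => w q.1 * ‖k (spin x q.1 q.2) - k q.2‖ₑ := by
    have := measurable_spin x
    fun_prop
  -- substituting `β = α + γ`, with `α ∈ (-π, π]` the polar angle of `y - x`, keeps `γ` in a fixed
  -- interval
  have hpt : ∀ y, ∫⁻ β in Ioc 0 (2 * Real.pi),
      ‖k y - k (reflect x β y)‖ₑ * ‖1 / ⟪y - x, dir β⟫_ℝ‖ₑ ≤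
      ∫⁻ γ in Ioc (-Real.pi) (3 * Real.pi), w γ * ‖k (spin x γ y) - k y‖ₑ := by
    intro y
    obtain ⟨α, hα, h⟩ := exists_eq_norm_smul_dir (y - x)
    rw [← lintegral_indicator measurableSet_Ioc, ← lintegral_indicator measurableSet_Ioc,
      ← lintegral_add_left_eq_self _ α]
    refine lintegral_mono fun γ => ?_
    by_cases hγ : α + γ ∈ Ioc 0 (2 * Real.pi)
    · have hγ' : γ ∈ Ioc (-Real.pi) (3 * Real.pi) :=
        ⟨by linarith [hγ.1, hα.2], by linarith [hγ.2, hα.1]⟩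
      rw [indicator_of_mem hγ, indicator_of_mem hγ', (reflect_eq_spin h γ).1,
        (reflect_eq_spin h γ).2]
      rcases lt_or_ge ‖y - x‖ m with hy | hy
      · rw [hnear y hy, hnear (spin x γ y) (by rwa [norm_spin_sub])]
        simp
      · have hpos : 0 < ‖y - x‖ := hm0.trans_le hy
        rw [← enorm_neg (k y - _), neg_sub, mul_comm]
        refine mul_le_mul_left ?_ _
        simp only [hw]
        rw [← one_div_mul_one_div, enorm_mul]
        refine mul_le_mul_left ?_ _
        rw [← ofReal_norm, Real.norm_of_nonneg (by positivity)]
        refine ENNReal.ofReal_le_ofReal ?_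
        rw [one_div]
        exact inv_anti₀ hm0 hy
    · rw [indicator_of_notMem hγ]
      exact zero_le
  calc ∫⁻ β in Ioc 0 (2 * Real.pi), ∫⁻ q, ‖oddQuotient (sheet k x β) q‖ₑ
      = ∫⁻ β in Ioc 0 (2 * Real.pi), ∫⁻ y,
          ‖k y - k (reflect x β y)‖ₑ * ‖1 / ⟪y - x, dir β⟫_ℝ‖ₑ := by
        simp only [lintegral_enorm_oddQuotient_sheet hk]
    _ = ∫⁻ y, ∫⁻ β in Ioc 0 (2 * Real.pi),
          ‖k y - k (reflect x β y)‖ₑ * ‖1 / ⟪y - x, dir β⟫_ℝ‖ₑ :=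
        lintegral_lintegral_swap hmeas1.aemeasurable
    _ ≤ ∫⁻ y, ∫⁻ γ in Ioc (-Real.pi) (3 * Real.pi), w γ * ‖k (spin x γ y) - k y‖ₑ :=
        lintegral_mono hpt
    _ = ∫⁻ γ in Ioc (-Real.pi) (3 * Real.pi), ∫⁻ y, w γ * ‖k (spin x γ y) - k y‖ₑ :=
        (lintegral_lintegral_swap hmeas2.aemeasurable).symm
    _ ≤ ∫⁻ γ in Ioc (-Real.pi) (3 * Real.pi),
          ENNReal.ofReal m⁻¹ * A * ENNReal.ofReal √(2 * D) *
            ‖(√|Real.cos γ|)⁻¹‖ₑ := by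
        refine lintegral_mono fun γ => ?_
        have hsm : Measurable fun y => ‖k (spin x γ y) - k y‖ₑ := by
          have := (measurePreserving_spin x γ).measurable
          fun_prop
        rw [lintegral_const_mul _ hsm]
        by_cases hγ : Real.cos γ = 0
        · simp [hw, hγ]
        have hsq : 0 < √|Real.cos γ| := Real.sqrt_pos.2 (abs_pos.2 hγ)
        calc w γ * ∫⁻ y, ‖k (spin x γ y) - k y‖ₑ
            ≤ w γ * (A * ENNReal.ofReal √(2 * D * |Real.cos γ|)) := by gcongr; exact hmod γ hγ
          _ = ENNReal.ofReal m⁻¹ * A * (ENNReal.ofReal √(2 * D) *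
                (‖1 / Real.cos γ‖ₑ * ENNReal.ofReal √|Real.cos γ|)) := by
              rw [hw, Real.sqrt_mul (by positivity), ENNReal.ofReal_mul (by positivity)]
              ring
          _ = _ := by
              rw [← mul_assoc]
              congr 1
              rw [← ofReal_norm, ← ofReal_norm, ← ENNReal.ofReal_mul (norm_nonneg _),
                Real.norm_of_nonneg (inv_nonneg.2 hsq.le), norm_div, norm_one, Real.norm_eq_abs]
              congr 1
              have h3 : |Real.cos γ| = √|Real.cos γ| * √|Real.cos γ| :=
                (Real.mul_self_sqrt (abs_nonneg _)).symm
              rw [div_mul_eq_mul_div, one_mul, div_eq_iff (abs_pos.2 hγ).ne']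
              conv_rhs => enter [2]; rw [h3]
              field_simp
    _ < ⊤ := by
        rw [lintegral_const_mul' _ _ (by finiteness)]
        refine ENNReal.mul_lt_top (by finiteness) ?_
        have := (intervalIntegrable_inv_sqrt_abs_cos (-Real.pi) (3 * Real.pi)).1
        exact this.2

theorem measurable_lintegral_oddQuotient {k : Plane → ℂ} (hk : Measurable k) :
    Measurable fun z : Plane × ℝ => ∫⁻ q, ‖oddQuotient (sheet k z.1 z.2) q‖ₑ := by
  simp only [lintegral_enorm_oddQuotient_sheet hk]
  refine Measurable.lintegral_prod_right' (f := fun r : (Plane × ℝ) × Plane =>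
    ‖k r.2 - k (reflect r.1.1 r.1.2 r.2)‖ₑ * ‖1 / ⟪r.2 - r.1.1, dir r.1.2⟫_ℝ‖ₑ) ?_
  unfold reflect
  fun_prop

theorem isTame_iff_lintegral_lt_top {k : Plane → ℂ} (hk : Measurable k) (x : Plane) (β : ℝ) :
    IsTame k x β ↔ ∫⁻ q, ‖oddQuotient (sheet k x β) q‖ₑ < ⊤ := by
  have hm : AEStronglyMeasurable (oddQuotient (sheet k x β)) volume := by
    unfold oddQuotient sheet
    have : Measurable fun q : ℝ × ℝ => k (planeCoord x β q) :=
      hk.comp (planeCoord x β).measurable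
    have h2 : Measurable fun q : ℝ × ℝ => k (planeCoord x β (-q.1, q.2)) :=
      this.comp measurePreserving_negFst.measurable
    fun_prop
  exact ⟨fun h => h.2, fun h => ⟨hm, h⟩⟩

theorem IsTame.congr {f k : Plane → ℂ} (h : f =ᵐ[volume] k) {x : Plane} {β : ℝ}
    (hf : IsTame f x β) : IsTame k x β := by
  have h1 : sheet f x β =ᵐ[volume] sheet k x β :=
    (measurePreserving_planeCoord x β).quasiMeasurePreserving.ae_eq_comp h
  have h2 := measurePreserving_negFst.quasiMeasurePreserving.ae_eq_comp h1
  refine Integrable.congr hf ?_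
  filter_upwards [h1, h2] with q hq hq'
  simp only [Function.comp] at hq'
  simp only [oddQuotient, hq, hq']

instance : IsFiniteMeasure circleMeasure := by
  unfold circleMeasure
  infer_instance

/-- A function of finite energy supported in the disk is tame at every exterior point, for almost
every axis. -/
theorem ae_isTame {k : Plane → ℂ} (hk : Measurable k) (hki : Integrable k)
    (hk2 : MemLp k 2 volume) (hsupp : ∀ y, 1 ≤ ‖y‖ → k y = 0)
    (hs : ∫⁻ ξ, ‖ξ‖ₑ * ‖𝓕 k ξ‖ₑ ^ 2 < ⊤) {x : Plane} (hx : 1 < ‖x‖) :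
    ∀ᵐ β ∂circleMeasure, IsTame k x β := by
  obtain ⟨C, hCt, hC⟩ := exists_lintegral_enorm_comp_add_sub_le hki hk2 hsupp hs
  have hm : Measurable fun β : ℝ => ∫⁻ q, ‖oddQuotient (sheet k x β) q‖ₑ := by
    have h := (measurable_lintegral_oddQuotient hk).comp (measurable_prodMk_left (x := x))
    simpa only [Function.comp_def] using h
  have hlt : ∫⁻ β, (∫⁻ q, ‖oddQuotient (sheet k x β) q‖ₑ) ∂circleMeasure < ⊤ :=
    lintegral_lintegral_enorm_oddQuotient_lt_top hk hsupp hCt hC hx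
  have hae := ae_lt_top hm hlt.ne
  filter_upwards [hae] with β hβ
  exact (isTame_iff_lintegral_lt_top hk x β).2 hβ

end Tame

/-! ### The Hilbert transform as a Fourier multiplier -/

section HilbertFourier

/-- The symbol `-i sgn σ` of the Hilbert transform; its value at `0` is immaterial, and the choice
made here gives it modulus `1` everywhere. -/
noncomputable def hilbertSymbol (σ : ℝ) : ℂ := if 0 < σ then -Complex.I else Complex.I

@[fun_prop]
theorem measurable_hilbertSymbol : Measurable hilbertSymbol :=
  Measurable.ite measurableSet_Ioi measurable_const measurable_const

@[simp] theorem norm_hilbertSymbol (σ : ℝ) : ‖hilbertSymbol σ‖ = 1 := by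
  unfold hilbertSymbol
  split_ifs <;> simp

/-- The character `σ ↦ e^{2 π i σ s}`. -/
noncomputable def character (s σ : ℝ) : ℂ :=
  Complex.exp (((2 * Real.pi * σ * s : ℝ) : ℂ) * Complex.I)

theorem continuous_character : Continuous fun q : ℝ × ℝ => character q.1 q.2 := by
  unfold character
  fun_prop

@[fun_prop]
theorem continuous_character_right (s : ℝ) : Continuous (character s) := by
  unfold character
  fun_prop

@[simp] theorem norm_character (s σ : ℝ) : ‖character s σ‖ = 1 :=
  Complex.norm_exp_ofReal_mul_I _

/-- The Fourier transform of `k` along the line in direction `dir β`. By the Fourier slice theorem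
this is the Fourier transform of the Radon transform of `k`. -/
noncomputable def fourierSlice (k : Plane → ℂ) (β σ : ℝ) : ℂ := 𝓕 k (σ • dir β)

theorem continuous_fourierSlice {k : Plane → ℂ} (hk : Integrable k) :
    Continuous fun q : ℝ × ℝ => fourierSlice k q.1 q.2 := by
  have := continuous_fourier hk
  unfold fourierSlice
  fun_prop

theorem fourierSlice_eq_integral (k : Plane → ℂ) (β σ : ℝ) :
    fourierSlice k β σ = ∫ y, k y * character (-⟪y, dir β⟫_ℝ) σ := by
  rw [fourierSlice, Real.fourier_eq']
  refine integral_congr_ae (Eventually.of_forall fun y => ?_)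
  simp only [character, smul_eq_mul, inner_smul_right]
  rw [mul_comm]
  congr 4
  ring

/-- The Hilbert transform of the Radon transform, by its Fourier representation. -/
noncomputable def filteredSlice (k : Plane → ℂ) (β s : ℝ) : ℂ :=
  ∫ σ, hilbertSymbol σ * fourierSlice k β σ * character s σ

/-- The symbol of the conjugate Poisson kernel. -/
noncomputable def poissonSymbol (ε σ : ℝ) : ℂ :=
  hilbertSymbol σ * (Real.exp (-(2 * Real.pi * ε * |σ|)) : ℝ)

@[fun_prop]
theorem measurable_poissonSymbol (ε : ℝ) : Measurable (poissonSymbol ε) := by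
  unfold poissonSymbol
  fun_prop

theorem norm_poissonSymbol (ε σ : ℝ) :
    ‖poissonSymbol ε σ‖ = Real.exp (-(2 * Real.pi * ε * |σ|)) := by
  rw [poissonSymbol, norm_mul, norm_hilbertSymbol, one_mul, Complex.norm_real,
    Real.norm_of_nonneg (Real.exp_pos _).le]

theorem poissonSymbol_mul_character_of_pos {ε σ : ℝ} (hσ : 0 < σ) (t : ℝ) :
    poissonSymbol ε σ * character t σ =
      -Complex.I * Complex.exp ((2 * Real.pi * (-ε + t * Complex.I) : ℂ) * σ) := by
  rw [poissonSymbol, hilbertSymbol, if_pos hσ, character, abs_of_pos hσ, Complex.ofReal_exp,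
    mul_assoc, ← Complex.exp_add]
  congr 2
  push_cast
  ring

theorem poissonSymbol_mul_character_of_nonpos {ε σ : ℝ} (hσ : σ ≤ 0) (t : ℝ) :
    poissonSymbol ε σ * character t σ =
      Complex.I * Complex.exp ((2 * Real.pi * (ε + t * Complex.I) : ℂ) * σ) := by
  rw [poissonSymbol, hilbertSymbol, if_neg hσ.not_gt, character, abs_of_nonpos hσ,
    Complex.ofReal_exp, mul_assoc, ← Complex.exp_add]
  congr 2
  push_cast
  ring

theorem re_two_pi_mul (a b : ℝ) :
    (2 * Real.pi * (a + b * Complex.I) : ℂ).re = 2 * Real.pi * a := by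
  simp

/-- The conjugate Poisson kernel `π⁻¹ t / (t² + ε²)` is the inverse Fourier transform of its
symbol. -/
theorem integrable_and_integral_poissonSymbol_mul_character {ε : ℝ} (hε : 0 < ε) (t : ℝ) :
    Integrable (fun σ => poissonSymbol ε σ * character t σ) ∧
      ∫ σ, poissonSymbol ε σ * character t σ =
        ((1 / Real.pi * (t / (t ^ 2 + ε ^ 2)) : ℝ) : ℂ) := by
  have ha : (2 * Real.pi * (-ε + t * Complex.I) : ℂ).re < 0 := by
    have := re_two_pi_mul (-ε) t
    rw [Complex.ofReal_neg] at this
    rw [this]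
    nlinarith [Real.pi_pos]
  have hb : 0 < (2 * Real.pi * (ε + t * Complex.I) : ℂ).re := by
    rw [re_two_pi_mul]
    positivity
  have h1 : IntegrableOn (fun σ => poissonSymbol ε σ * character t σ) (Ioi 0) :=
    IntegrableOn.congr_fun ((integrableOn_exp_mul_complex_Ioi ha 0).const_mul (-Complex.I))
      (fun σ hσ => (poissonSymbol_mul_character_of_pos hσ t).symm) measurableSet_Ioi
  have h2 : IntegrableOn (fun σ => poissonSymbol ε σ * character t σ) (Iic 0) :=
    IntegrableOn.congr_fun ((integrableOn_exp_mul_complex_Iic hb 0).const_mul Complex.I)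
      (fun σ hσ => (poissonSymbol_mul_character_of_nonpos hσ t).symm) measurableSet_Iic
  constructor
  · rw [← integrableOn_univ, ← Iic_union_Ioi (a := (0 : ℝ))]
    exact h2.union h1
  · rw [← intervalIntegral.integral_Iic_add_Ioi h2 h1,
      setIntegral_congr_fun measurableSet_Iic
        (fun σ hσ => poissonSymbol_mul_character_of_nonpos hσ t),
      setIntegral_congr_fun measurableSet_Ioi
        (fun σ hσ => poissonSymbol_mul_character_of_pos hσ t),
      integral_const_mul, integral_const_mul, integral_exp_mul_complex_Ioi ha,
      integral_exp_mul_complex_Iic hb]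
    have ha0 : (-ε + t * Complex.I : ℂ) ≠ 0 := by
      intro h
      rw [h] at ha
      simp at ha
    have hb0 : (ε + t * Complex.I : ℂ) ≠ 0 := by
      intro h
      rw [h] at hb
      simp at hb
    have hpi : (Real.pi : ℂ) ≠ 0 := Complex.ofReal_ne_zero.2 Real.pi_ne_zero
    have hprod : ((t : ℂ) ^ 2 + (ε : ℂ) ^ 2) =
        -((-ε + t * Complex.I) * (ε + t * Complex.I)) := by
      linear_combination (t : ℂ) ^ 2 * Complex.I_sq
    have hsum : (-ε + t * Complex.I : ℂ) + (ε + t * Complex.I) = 2 * t * Complex.I := by ring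
    simp only [Complex.ofReal_zero, mul_zero, Complex.exp_zero]
    push_cast
    rw [hprod]
    generalize (-ε + t * Complex.I : ℂ) = A at ha0 hsum
    generalize (ε + t * Complex.I : ℂ) = B at hb0 hsum
    field_simp
    linear_combination Complex.I * hsum + 2 * (t : ℂ) * Complex.I_sq

theorem integrable_poissonSymbol {ε : ℝ} (hε : 0 < ε) : Integrable (poissonSymbol ε) := by
  have h := (integrable_and_integral_poissonSymbol_mul_character hε 0).1
  simpa [character] using h

/-- The regularization by the conjugate Poisson kernel, in the plane and on the Fourier side. -/
theorem integral_mul_poisson_eq {k : Plane → ℂ} (hk : Integrable k) (x : Plane) (β : ℝ) {ε : ℝ}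
    (hε : 0 < ε) :
    -((1 / Real.pi : ℝ) : ℂ) *
        ∫ q, sheet k x β q * ((q.1 ^ 2 / (q.1 ^ 2 + ε ^ 2) / q.1 : ℝ) : ℂ) =
      ∫ σ, poissonSymbol ε σ * fourierSlice k β σ * character ⟪x, dir β⟫_ℝ σ := by
  have hmp := measurePreserving_planeCoord x β
  have hprod : Integrable (fun z : Plane × ℝ =>
      k z.1 * poissonSymbol ε z.2 * character ⟪x - z.1, dir β⟫_ℝ z.2)
      ((volume : Measure Plane).prod (volume : Measure ℝ)) := by
    refine (hk.mul_prod (integrable_poissonSymbol hε)).mul_bdd (c := 1) ?_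
      (Eventually.of_forall fun z => (norm_character _ _).le)
    have : Continuous fun z : Plane × ℝ => character ⟪x - z.1, dir β⟫_ℝ z.2 := by
      unfold character
      fun_prop
    exact this.aestronglyMeasurable
  calc -((1 / Real.pi : ℝ) : ℂ) *
        ∫ q, sheet k x β q * ((q.1 ^ 2 / (q.1 ^ 2 + ε ^ 2) / q.1 : ℝ) : ℂ)
      = ∫ q, (fun y => k y * ((1 / Real.pi * (⟪x - y, dir β⟫_ℝ /
          (⟪x - y, dir β⟫_ℝ ^ 2 + ε ^ 2)) : ℝ) : ℂ)) (planeCoord x β q) := by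
        rw [← integral_const_mul]
        refine integral_congr_ae (Eventually.of_forall fun q => ?_)
        have h1 : ⟪x - planeCoord x β q, dir β⟫_ℝ = -q.1 := by
          rw [← inner_planeCoord_sub x β q, ← inner_neg_left, neg_sub]
        have h2 : q.1 ^ 2 / (q.1 ^ 2 + ε ^ 2) / q.1 = q.1 / (q.1 ^ 2 + ε ^ 2) := by
          by_cases hq : q.1 = 0
          · simp [hq]
          · field_simp
        simp only [h1, sheet]
        rw [h2, neg_sq, neg_div]
        push_cast
        ring
    _ = ∫ y, k y * ((1 / Real.pi * (⟪x - y, dir β⟫_ℝ /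
          (⟪x - y, dir β⟫_ℝ ^ 2 + ε ^ 2)) : ℝ) : ℂ) :=
        hmp.integral_comp (planeCoord x β).measurableEmbedding fun y =>
          k y * ((1 / Real.pi * (⟪x - y, dir β⟫_ℝ / (⟪x - y, dir β⟫_ℝ ^ 2 + ε ^ 2)) : ℝ) : ℂ)
    _ = ∫ y, ∫ σ, k y * poissonSymbol ε σ * character ⟪x - y, dir β⟫_ℝ σ := by
        refine integral_congr_ae (Eventually.of_forall fun y => ?_)
        simp only [mul_assoc]
        rw [integral_const_mul,
          (integrable_and_integral_poissonSymbol_mul_character hε _).2]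
    _ = ∫ σ, ∫ y, k y * poissonSymbol ε σ * character ⟪x - y, dir β⟫_ℝ σ :=
        integral_integral_swap hprod
    _ = _ := by
        refine integral_congr_ae (Eventually.of_forall fun σ => ?_)
        simp only [fourierSlice_eq_integral]
        rw [mul_right_comm, ← integral_const_mul]
        refine integral_congr_ae (Eventually.of_forall fun y => ?_)
        have : character ⟪x - y, dir β⟫_ℝ σ =
            character ⟪x, dir β⟫_ℝ σ * character (-⟪y, dir β⟫_ℝ) σ := by
          rw [character, character, character, ← Complex.exp_add, inner_sub_left]
          congr 1
          push_cast
          ring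
        simp only [this]
        ring

/-- The principal value defining the Hilbert transform of the Radon transform is given by the
Fourier multiplier `-i sgn σ`: both are limits of the regularization by the conjugate Poisson
kernel. -/
theorem hilbert_eq_filteredSlice {k : Plane → ℂ} (hk : Integrable k) {x : Plane} {β : ℝ}
    (h : IsTame k x β) (hs : Integrable (fourierSlice k β)) :
    hilbert (radon k β) ⟪x, dir β⟫_ℝ = filteredSlice k β ⟪x, dir β⟫_ℝ := by
  rw [(hilbert_of_isTame hk h).2]
  have hpos : ∀ᶠ ε : ℝ in 𝓝[>] 0, 0 < ε := self_mem_nhdsWithin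
  have hden : ∀ (ε : ℝ) (q : ℝ × ℝ), 0 ≤ q.1 ^ 2 + ε ^ 2 := fun ε q => by positivity
  have h1 : Tendsto (fun ε : ℝ =>
      ∫ q, sheet k x β q * ((q.1 ^ 2 / (q.1 ^ 2 + ε ^ 2) / q.1 : ℝ) : ℂ)) (𝓝[>] 0)
      (𝓝 ((1 / 2 : ℂ) * ∫ q, oddQuotient (sheet k x β) q)) := by
    refine tendsto_integral_mul_weight (w := fun ε q => q.1 ^ 2 / (q.1 ^ 2 + ε ^ 2)) h
      (fun ε q => ?_) (fun ε => by fun_prop) (fun ε q => by simp) (fun q hq => ?_) ?_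
    · rw [abs_of_nonneg (div_nonneg (sq_nonneg _) (hden ε q))]
      exact div_le_one_of_le₀ (by nlinarith [sq_nonneg ε]) (hden ε q)
    · have hc : ContinuousAt (fun ε : ℝ => q.1 ^ 2 / (q.1 ^ 2 + ε ^ 2)) 0 := by
        refine ContinuousAt.div (by fun_prop) (by fun_prop) ?_
        positivity
      have := hc.tendsto.mono_left (nhdsWithin_le_nhds (s := Ioi 0))
      simpa [hq] using this
    · filter_upwards [hpos] with ε hε
      refine (integrable_sheet hk x β).mul_bdd (c := 1 / ε) ?_ (Eventually.of_forall fun q => ?_)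
      · have : Measurable fun q : ℝ × ℝ => q.1 ^ 2 / (q.1 ^ 2 + ε ^ 2) / q.1 := by fun_prop
        exact (Complex.measurable_ofReal.comp this).aestronglyMeasurable
      · rw [Complex.norm_real, Real.norm_eq_abs, abs_div, abs_div, abs_of_nonneg (hden ε q),
          abs_pow, sq_abs]
        by_cases hq : q.1 = 0
        · simp [hq, hε.le]
        have hq' : 0 < |q.1| := abs_pos.2 hq
        rw [div_div, div_le_div_iff₀ (by positivity) hε, ← sq_abs q.1]
        nlinarith [sq_nonneg (|q.1| - ε), mul_pos hq' hε, mul_pos hq' (mul_pos hε hε)]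
  have h2 : Tendsto (fun ε : ℝ =>
      ∫ σ, poissonSymbol ε σ * fourierSlice k β σ * character ⟪x, dir β⟫_ℝ σ) (𝓝[>] 0)
      (𝓝 (filteredSlice k β ⟪x, dir β⟫_ℝ)) := by
    have hsm : AEStronglyMeasurable (fourierSlice k β) volume := hs.1
    refine tendsto_integral_filter_of_dominated_convergence (fun σ => ‖fourierSlice k β σ‖)
      (Eventually.of_forall fun ε => ?_) ?_ hs.norm (Eventually.of_forall fun σ => ?_)
    · exact ((measurable_poissonSymbol ε).aestronglyMeasurable.mul hsm).mul
        (continuous_character_right _).aestronglyMeasurable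
    · filter_upwards [hpos] with ε hε
      refine Eventually.of_forall fun σ => ?_
      rw [norm_mul, norm_mul, norm_character, mul_one, norm_poissonSymbol]
      refine mul_le_of_le_one_left (norm_nonneg _) ?_
      rw [Real.exp_le_one_iff, neg_nonpos]
      have := Real.pi_pos
      positivity
    · have hc : Continuous fun ε : ℝ =>
          poissonSymbol ε σ * fourierSlice k β σ * character ⟪x, dir β⟫_ℝ σ := by
        unfold poissonSymbol
        fun_prop
      have := (hc.tendsto 0).mono_left (nhdsWithin_le_nhds (s := Ioi 0))
      simpa [poissonSymbol] using this
  refine tendsto_nhds_unique ((h1.const_mul (-((1 / Real.pi : ℝ) : ℂ))).congr' ?_) h2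
  filter_upwards [hpos] with ε hε
  exact integral_mul_poisson_eq hk x β hε

end HilbertFourier

/-! ### Polar coordinates -/

section Polar

theorem lintegral_Ioc_eq_of_periodic {P : ℝ → ℝ≥0∞} {T : ℝ} (hT : 0 < T)
    (hP : Function.Periodic P T) (a b : ℝ) :
    ∫⁻ θ in Ioc a (a + T), P θ = ∫⁻ θ in Ioc b (b + T), P θ := by
  have : VAddInvariantMeasure (AddSubgroup.zmultiples T) ℝ volume :=
    ⟨fun c s _ => measure_preimage_add _ _ _⟩
  exact IsAddFundamentalDomain.setLIntegral_eq (G := AddSubgroup.zmultiples T)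
    (isAddFundamentalDomain_Ioc hT a) (isAddFundamentalDomain_Ioc hT b) P hP.map_vadd_zmultiples

/-- Polar coordinates on lines through the origin: every point other than the origin is met by
two of them. -/
theorem lintegral_enorm_mul_comp_smul_dir {G : Plane → ℝ≥0∞} (hG : Measurable G) :
    ∫⁻ z : ℝ × ℝ, ‖z.2‖ₑ * G (z.2 • dir z.1) ∂(circleMeasure.prod volume) =
      2 * ∫⁻ ξ, G ξ := by
  have hpi := Real.pi_pos
  set P : ℝ → ℝ≥0∞ := fun θ => ∫⁻ r in Ioi (0 : ℝ), ‖r‖ₑ * G (r • dir θ) with hP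
  have hper : Function.Periodic P (2 * Real.pi) := fun θ => by
    simp only [hP, dir_periodic θ]
  have hm : Measurable fun z : ℝ × ℝ => ‖z.2‖ₑ * G (z.2 • dir z.1) := by fun_prop
  have h1 : ∫⁻ ξ, G ξ = ∫⁻ θ in Ioc (-Real.pi) (-Real.pi + 2 * Real.pi), P θ := by
    have htm : MeasurableSet (Ioi (0 : ℝ) ×ˢ Ioo (-Real.pi) Real.pi) :=
      measurableSet_Ioi.prod measurableSet_Ioo
    have hm' : Measurable fun p : ℝ × ℝ => ‖p.1‖ₑ * G (p.1 • dir p.2) := by fun_prop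
    have hpol : ∀ p ∈ Ioi (0 : ℝ) ×ˢ Ioo (-Real.pi) Real.pi,
        ENNReal.ofReal p.1 • G (planeCoord 0 0 (polarCoord.symm p)) =
          ‖p.1‖ₑ * G (p.1 • dir p.2) := by
      rintro ⟨r, ψ⟩ ⟨hr, -⟩
      replace hr : 0 < r := hr
      rw [planeCoord_apply, polarCoord_symm_apply, zero_add, smul_eq_mul, ← ofReal_norm,
        Real.norm_of_nonneg hr.le]
      congr 2
      have := cos_smul_dir_add_sin_smul_dir 0 ψ
      rw [zero_add ψ] at this
      rw [← this, smul_add, smul_smul, smul_smul]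
    rw [← (measurePreserving_planeCoord 0 0).lintegral_comp hG, ← lintegral_comp_polarCoord_symm,
      polarCoord_target, setLIntegral_congr_fun htm hpol, Measure.volume_eq_prod,
      ← Measure.prod_restrict, lintegral_prod_symm' _ hm',
      show -Real.pi + 2 * Real.pi = Real.pi by ring, setLIntegral_congr Ioo_ae_eq_Ioc]
  have h2 : ∀ θ, ∫⁻ σ : ℝ, ‖σ‖ₑ * G (σ • dir θ) = P θ + P (θ + Real.pi) := by
    intro θ
    rw [← lintegral_add_compl _ (measurableSet_Ioi (a := (0 : ℝ)))]
    congr 1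
    rw [compl_Ioi, ← setLIntegral_congr Iio_ae_eq_Iic, ← lintegral_indicator measurableSet_Iio,
      ← lintegral_neg_eq_self]
    simp only [hP]
    rw [← lintegral_indicator measurableSet_Ioi]
    refine lintegral_congr fun r => ?_
    by_cases hr : 0 < r
    · rw [indicator_of_mem (by simpa using hr), indicator_of_mem (by exact hr), enorm_neg,
        dir_add_pi, neg_smul, smul_neg]
    · rw [indicator_of_notMem (by simpa using hr), indicator_of_notMem (by exact hr)]
  have hPm : Measurable P := by
    refine Measurable.lintegral_prod_right' (f := fun z : ℝ × ℝ => ‖z.2‖ₑ * G (z.2 • dir z.1)) hm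
  have h3 : ∫⁻ θ in Ioc 0 (2 * Real.pi), P θ = ∫⁻ ξ, G ξ := by
    rw [h1, lintegral_Ioc_eq_of_periodic (by positivity) hper (-Real.pi) 0, zero_add]
  have h4 : ∫⁻ θ in Ioc 0 (2 * Real.pi), P (θ + Real.pi) = ∫⁻ ξ, G ξ := by
    have hper' : Function.Periodic (fun θ => P (θ + Real.pi)) (2 * Real.pi) := fun θ => by
      change P (θ + 2 * Real.pi + Real.pi) = P (θ + Real.pi)
      rw [add_right_comm]
      exact hper _
    have := lintegral_Ioc_eq_of_periodic (by positivity) hper' 0 (-Real.pi - Real.pi)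
    rw [zero_add] at this
    rw [this, h1, ← lintegral_indicator measurableSet_Ioc,
      ← lintegral_indicator measurableSet_Ioc, ← lintegral_add_right_eq_self
        ((Ioc (-Real.pi) (-Real.pi + 2 * Real.pi)).indicator _) Real.pi]
    refine lintegral_congr fun θ => ?_
    simp only [indicator, mem_Ioc]
    congr 1
    exact propext ⟨fun h => ⟨by linarith [h.1], by linarith [h.2]⟩,
      fun h => ⟨by linarith [h.1], by linarith [h.2]⟩⟩
  rw [lintegral_prod _ hm.aemeasurable]
  simp only [h2]
  rw [lintegral_add_left hPm]
  change (∫⁻ θ in Ioc 0 (2 * Real.pi), P θ) + ∫⁻ θ in Ioc 0 (2 * Real.pi), P (θ + Real.pi) = _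
  rw [h3, h4, two_mul]

/-- The measure `|σ| dθ dσ` on the space of signed polar coordinates. -/
noncomputable def signedPolarMeasure : Measure (ℝ × ℝ) :=
  (circleMeasure.prod volume).withDensity fun z => ‖z.2‖ₑ

theorem measurable_smul_dir : Measurable fun z : ℝ × ℝ => z.2 • dir z.1 := by fun_prop

/-- Signed polar coordinates cover the plane twice. -/
theorem map_signedPolarMeasure :
    signedPolarMeasure.map (fun z : ℝ × ℝ => z.2 • dir z.1) = (2 : ℝ≥0∞) • volume := by
  refine Measure.ext fun S hS => ?_
  have h := lintegral_enorm_mul_comp_smul_dir (measurable_one.indicator hS)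
  rw [Measure.map_apply measurable_smul_dir hS, signedPolarMeasure,
    withDensity_apply _ (measurable_smul_dir hS), Measure.smul_apply, smul_eq_mul,
    ← lintegral_indicator_one hS, ← h, ← lintegral_indicator (measurable_smul_dir hS)]
  refine lintegral_congr fun z => ?_
  by_cases hz : z.2 • dir z.1 ∈ S <;> simp [hz]

theorem integrable_abs_mul_comp_smul_dir {H : Plane → ℂ} (hH : Integrable H) :
    Integrable (fun z : ℝ × ℝ => ((|z.2| : ℝ) : ℂ) * H (z.2 • dir z.1))
      (circleMeasure.prod volume) := by
  have h1 : Integrable H (signedPolarMeasure.map fun z : ℝ × ℝ => z.2 • dir z.1) := by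
    rw [map_signedPolarMeasure]
    exact hH.smul_measure (by norm_num)
  have h2 := h1.comp_measurable measurable_smul_dir
  have hn : Measurable fun z : ℝ × ℝ => ‖z.2‖₊ := by fun_prop
  rw [signedPolarMeasure] at h2
  have h3 := (integrable_withDensity_iff_integrable_smul (μ := circleMeasure.prod volume) hn).1 h2
  refine h3.congr (Eventually.of_forall fun z => ?_)
  simp [NNReal.smul_def]

theorem integral_abs_mul_comp_smul_dir {H : Plane → ℂ} (hH : Integrable H) :
    ∫ θ, (∫ σ : ℝ, ((|σ| : ℝ) : ℂ) * H (σ • dir θ)) ∂circleMeasure = 2 * ∫ ξ, H ξ := by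
  have h1 : AEStronglyMeasurable H
      (signedPolarMeasure.map fun z : ℝ × ℝ => z.2 • dir z.1) := by
    rw [map_signedPolarMeasure]
    exact hH.1.smul_measure _
  have h2 := integral_map measurable_smul_dir.aemeasurable h1
  have hn : Measurable fun z : ℝ × ℝ => ‖z.2‖₊ := by fun_prop
  rw [map_signedPolarMeasure, integral_smul_measure, signedPolarMeasure] at h2
  have h3 := integral_withDensity_eq_integral_smul (μ := circleMeasure.prod volume) hn
    fun z : ℝ × ℝ => H (z.2 • dir z.1)
  have h4 := integral_prod _ (integrable_abs_mul_comp_smul_dir hH)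
  rw [← h4]
  simp only [ENNReal.toReal_ofNat] at h2
  have h5 : (2 : ℂ) * ∫ ξ, H ξ = (2 : ℝ) • ∫ ξ, H ξ := by simp
  rw [h5, h2]
  refine Eq.trans ?_ h3.symm
  refine integral_congr_ae (Eventually.of_forall fun z => ?_)
  simp [NNReal.smul_def]

end Polar

/-! ### The Fourier slices of an admissible function -/

section Slices

/-- The class of functions to which the analysis applies: measurable, in `L¹ ∩ L²`, vanishing
outside the open unit disk, and of finite `H^{1/2}` energy. -/
structure IsAdmissible (k : Plane → ℂ) : Prop where
  measurable : Measurable k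
  integrable : Integrable k
  memLp : MemLp k 2 volume
  eq_zero : ∀ y, 1 ≤ ‖y‖ → k y = 0
  energy : ∫⁻ ξ, ‖ξ‖ₑ * ‖𝓕 k ξ‖ₑ ^ 2 < ⊤

/-- In polar coordinates the `H^{1/2}` energy of `k` is the total first order energy of its
slices. -/
theorem IsAdmissible.lintegral_slice_lt_top {k : Plane → ℂ} (hk : IsAdmissible k) :
    ∫⁻ z : ℝ × ℝ, ‖z.2‖ₑ ^ 2 * ‖fourierSlice k z.1 z.2‖ₑ ^ 2 ∂(circleMeasure.prod volume) < ⊤ := by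
  have hc := continuous_fourier hk.integrable
  have h := lintegral_enorm_mul_comp_smul_dir
    (G := fun ξ => ‖ξ‖ₑ * ‖𝓕 k ξ‖ₑ ^ 2) (by fun_prop)
  have h2 : ∀ z : ℝ × ℝ, ‖z.2‖ₑ * (‖z.2 • dir z.1‖ₑ * ‖𝓕 k (z.2 • dir z.1)‖ₑ ^ 2) =
      ‖z.2‖ₑ ^ 2 * ‖fourierSlice k z.1 z.2‖ₑ ^ 2 := by
    intro z
    have : ‖dir z.1‖ₑ = 1 := by rw [← ofReal_norm, norm_dir, ENNReal.ofReal_one]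
    rw [enorm_smul, this, mul_one, fourierSlice]
    ring
  simp only [h2] at h
  rw [h]
  exact ENNReal.mul_lt_top (by norm_num) hk.energy

theorem IsAdmissible.ae_slice {k : Plane → ℂ} (hk : IsAdmissible k) :
    ∀ᵐ β ∂circleMeasure, ∫⁻ σ, ‖σ‖ₑ ^ 2 * ‖fourierSlice k β σ‖ₑ ^ 2 < ⊤ := by
  have hc := continuous_fourierSlice hk.integrable
  have hm : Measurable fun z : ℝ × ℝ => ‖z.2‖ₑ ^ 2 * ‖fourierSlice k z.1 z.2‖ₑ ^ 2 := by
    have := hc.measurable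
    fun_prop
  have h := hk.lintegral_slice_lt_top
  rw [lintegral_prod _ hm.aemeasurable] at h
  exact ae_lt_top hm.lintegral_prod_right' h.ne

theorem continuous_fourierSlice_right {k : Plane → ℂ} (hk : Integrable k) (β : ℝ) :
    Continuous (fourierSlice k β) := by
  have := continuous_fourier hk
  unfold fourierSlice
  fun_prop

/-- A slice of finite first order energy is integrable, since it is also bounded. -/
theorem integrable_fourierSlice {k : Plane → ℂ} (hk : Integrable k) {β : ℝ}
    (h : ∫⁻ σ, ‖σ‖ₑ ^ 2 * ‖fourierSlice k β σ‖ₑ ^ 2 < ⊤) : Integrable (fourierSlice k β) := by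
  have hc := continuous_fourierSlice_right hk β
  set M := ∫ y, ‖k y‖ with hM
  have hM0 : 0 ≤ M := integral_nonneg fun y => norm_nonneg _
  have hb : ∀ σ, ‖fourierSlice k β σ‖ ≤ M := fun σ => norm_fourier_le k _
  have h1 : Integrable fun σ : ℝ => σ ^ 2 * ‖fourierSlice k β σ‖ ^ 2 := by
    have hc' : Continuous fun σ : ℝ => σ ^ 2 * ‖fourierSlice k β σ‖ ^ 2 := by fun_prop
    refine ⟨hc'.aestronglyMeasurable, ?_⟩
    refine lt_of_le_of_lt (le_of_eq (lintegral_congr fun σ => ?_)) h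
    rw [enorm_mul, enorm_pow, enorm_pow, enorm_norm]
  have h2 : Integrable fun σ : ℝ => (2 * M + 1) * (1 + σ ^ 2)⁻¹ :=
    integrable_inv_one_add_sq.const_mul _
  refine (h1.add h2).mono' hc.aestronglyMeasurable (Eventually.of_forall fun σ => ?_)
  simp only [Pi.add_apply]
  have hz := norm_nonneg (fourierSlice k β σ)
  have hbσ := hb σ
  generalize ‖fourierSlice k β σ‖ = z at hz hbσ ⊢
  have hd : 0 < 1 + σ ^ 2 := by positivity
  rcases le_total (σ ^ 2) 1 with hσ | hσ
  · have : M ≤ (2 * M + 1) * (1 + σ ^ 2)⁻¹ := by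
      rw [← div_eq_mul_inv, le_div_iff₀ hd]
      nlinarith
    nlinarith [mul_nonneg (sq_nonneg σ) (sq_nonneg z)]
  · -- since `1 + σ² ≤ 2 σ²` this is the arithmetic-geometric mean inequality `2 a - 2 a² ≤ 1` for
    -- `a = σ² z`
    have h3 : z ≤ σ ^ 2 * z ^ 2 + (1 + σ ^ 2)⁻¹ := by
      rw [← one_div, ← sub_le_iff_le_add', le_div_iff₀ hd]
      have hmul : (1 + σ ^ 2) ≤ 2 * σ ^ 2 := by linarith
      rcases le_total (z - σ ^ 2 * z ^ 2) 0 with hzz | hzz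
      · exact (mul_nonpos_of_nonpos_of_nonneg hzz hd.le).trans zero_le_one
      · refine (mul_le_mul_of_nonneg_left hmul hzz).trans ?_
        linarith [sq_nonneg (σ ^ 2 * z * 2 - 1)]
    have h4 : (1 + σ ^ 2)⁻¹ ≤ (2 * M + 1) * (1 + σ ^ 2)⁻¹ :=
      le_mul_of_one_le_left (by positivity) (by linarith)
    linarith

/-- Plancherel's identity for inverse Fourier integrals on the line. -/
theorem lintegral_enorm_integral_mul_character_sq {m : ℝ → ℂ} (hm : Integrable m)
    (hm2 : MemLp m 2 volume) :
    ∫⁻ s, ‖∫ σ, m σ * character s σ‖ₑ ^ 2 = ∫⁻ σ, ‖m σ‖ₑ ^ 2 := by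
  rw [← lintegral_enorm_fourier_sq hm hm2, ← lintegral_neg_eq_self]
  refine lintegral_congr fun s => ?_
  congr 2
  rw [Real.fourier_eq']
  refine integral_congr_ae (Eventually.of_forall fun σ => ?_)
  simp only [character, smul_eq_mul]
  rw [mul_comm]
  congr 3
  simp
  ring

end Slices

/-! ### Weak derivatives and band-limited approximation -/

section WeakDerivative

/-- The indicator of the frequencies of absolute value at most `N`. -/
noncomputable def cutoff (N : ℕ) (t : ℝ) : ℂ := {t : ℝ | |t| ≤ N}.indicator 1 t

@[fun_prop]
theorem measurable_cutoff (N : ℕ) : Measurable (cutoff N) :=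
  measurable_one.indicator (measurableSet_le (by fun_prop) (by fun_prop))

theorem norm_cutoff_le (N : ℕ) (t : ℝ) : ‖cutoff N t‖ ≤ 1 := by
  unfold cutoff
  by_cases h : |t| ≤ N <;> simp [indicator, h]

theorem cutoff_of_le {N : ℕ} {t : ℝ} (h : |t| ≤ N) : cutoff N t = 1 := by
  simp [cutoff, indicator, h]

theorem cutoff_of_lt {N : ℕ} {t : ℝ} (h : N < |t|) : cutoff N t = 0 := by
  simp [cutoff, indicator, h]

@[simp] theorem cutoff_abs (N : ℕ) (t : ℝ) : cutoff N |t| = cutoff N t := by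
  simp [cutoff, indicator]

theorem tendsto_cutoff (t : ℝ) : Tendsto (fun N => cutoff N t) atTop (𝓝 1) := by
  obtain ⟨n, hn⟩ := exists_nat_ge |t|
  refine tendsto_const_nhds.congr' ?_
  filter_upwards [eventually_ge_atTop n] with N hN
  rw [cutoff_of_le (hn.trans (by exact_mod_cast hN))]

theorem norm_cutoff_mul_le (N : ℕ) (t : ℝ) (c : ℂ) : ‖cutoff N t * c‖ ≤ ‖c‖ := by
  rw [norm_mul]
  exact mul_le_of_le_one_left (norm_nonneg _) (norm_cutoff_le N t)

theorem integrable_cutoff_mul {m : ℝ → ℂ} (hm : Continuous m) (N : ℕ) :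
    Integrable fun σ => cutoff N σ * m σ := by
  have h : (fun σ => cutoff N σ * m σ) = (Icc (-(N : ℝ)) N).indicator m := by
    ext σ
    simp only [cutoff, indicator, mem_ofPred_eq, abs_le, mem_Icc]
    split_ifs <;> simp
  rw [h, integrable_indicator_iff measurableSet_Icc]
  exact hm.continuousOn.integrableOn_Icc

theorem memLp_cutoff_mul {m : ℝ → ℂ} (hm : Continuous m) (N : ℕ) :
    MemLp (fun σ => cutoff N σ * m σ) 2 volume := by
  have h1 := integrable_cutoff_mul hm N
  rw [memLp_two_iff_integrable_sq_norm h1.1]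
  have h2 := (integrable_cutoff_mul (m := fun σ => ((‖m σ‖ ^ 2 : ℝ) : ℂ)) (by fun_prop) N).norm
  refine h2.congr (Eventually.of_forall fun σ => ?_)
  rcases le_or_gt |σ| N with h | h
  · simp [cutoff_of_le h]
  · simp [cutoff_of_lt h]

theorem norm_mul_character (c : ℂ) (s σ : ℝ) : ‖c * character s σ‖ = ‖c‖ := by
  rw [norm_mul, norm_character, mul_one]

theorem integrable_mul_character {m : ℝ → ℂ} (hm : Integrable m) (s : ℝ) :
    Integrable fun σ => m σ * character s σ :=
  hm.mul_bdd (c := 1) (continuous_character_right s).aestronglyMeasurable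
    (Eventually.of_forall fun σ => (norm_character s σ).le)

theorem continuous_integral_mul_character {m : ℝ → ℂ} (hm : Integrable m) :
    Continuous fun s => ∫ σ, m σ * character s σ := by
  refine continuous_of_dominated (bound := fun σ => ‖m σ‖) (fun s =>
    (integrable_mul_character hm s).1) (fun s => Eventually.of_forall fun σ =>
    (norm_mul_character _ _ _).le) hm.norm (Eventually.of_forall fun σ => ?_)
  unfold character
  fun_prop

theorem norm_integral_mul_character_le (m : ℝ → ℂ) (s : ℝ) :
    ‖∫ σ, m σ * character s σ‖ ≤ ∫ σ, ‖m σ‖ := by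
  refine (norm_integral_le_integral_norm _).trans (le_of_eq ?_)
  simp only [norm_mul_character]

/-- The Hilbert transform followed by differentiation is the ramp filter. -/
theorem hilbertSymbol_mul (σ : ℝ) :
    hilbertSymbol σ * (2 * Real.pi * σ * Complex.I) = ((2 * Real.pi * |σ| : ℝ) : ℂ) := by
  unfold hilbertSymbol
  split_ifs with h
  · rw [abs_of_pos h]
    push_cast
    linear_combination (-2 * (Real.pi : ℂ) * σ) * Complex.I_sq
  · rw [abs_of_nonpos (not_lt.1 h)]
    push_cast
    linear_combination (2 * (Real.pi : ℂ) * σ) * Complex.I_sq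

theorem hasDerivAt_character (s σ : ℝ) :
    HasDerivAt (fun s => character s σ) (2 * Real.pi * σ * Complex.I * character s σ) s := by
  unfold character
  have h1 : HasDerivAt (fun s : ℝ => (((2 * Real.pi * σ * s : ℝ) : ℂ) * Complex.I))
      (2 * Real.pi * σ * Complex.I) s := by
    have := ((hasDerivAt_id s).const_mul (2 * Real.pi * σ)).ofReal_comp.mul_const Complex.I
    simpa using this
  exact h1.cexp.congr_deriv (mul_comm _ _)

/-- The derivative of a band-limited Hilbert transform is the corresponding band-limited ramp
filter. -/
theorem hasDerivAt_integral_cutoff {u : ℝ → ℂ} (hu : Continuous u) (N : ℕ) (s : ℝ) :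
    HasDerivAt (fun s => ∫ σ, cutoff N σ * (hilbertSymbol σ * u σ) * character s σ)
      (∫ σ, cutoff N σ * (((2 * Real.pi * |σ| : ℝ) : ℂ) * u σ) * character s σ) s := by
  have hi : Integrable fun σ => cutoff N σ * (hilbertSymbol σ * u σ) := by
    have h := (integrable_cutoff_mul hu N).bdd_mul (c := 1)
      measurable_hilbertSymbol.aestronglyMeasurable
      (Eventually.of_forall fun σ => (norm_hilbertSymbol σ).le)
    refine h.congr (Eventually.of_forall fun σ => ?_)
    simp only
    ring
  have hi' : Integrable fun σ => cutoff N σ * (((2 * Real.pi * |σ| : ℝ) : ℂ) * u σ) :=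
    integrable_cutoff_mul (by fun_prop) N
  refine (hasDerivAt_integral_of_dominated_loc_of_deriv_le (s := univ) univ_mem
    (F' := fun s σ => cutoff N σ * (((2 * Real.pi * |σ| : ℝ) : ℂ) * u σ) * character s σ)
    (bound := fun σ => ‖cutoff N σ * (((2 * Real.pi * |σ| : ℝ) : ℂ) * u σ)‖)
    (Eventually.of_forall fun s => (integrable_mul_character hi s).1)
    (integrable_mul_character hi s) (integrable_mul_character hi' s).1
    (Eventually.of_forall fun σ s _ => (norm_mul_character _ _ _).le) hi'.norm
    (Eventually.of_forall fun σ s _ => ?_)).2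
  have h := (hasDerivAt_character s σ).const_mul (cutoff N σ * (hilbertSymbol σ * u σ))
  refine h.congr_deriv ?_
  rw [← hilbertSymbol_mul]
  ring

/-- If the band-limited ramp filters of `u` converge in `L²` along a subsequence, then the limit is
the weak derivative of the Hilbert transform. -/
theorem isWeakDeriv_of_tendsto {u : ℝ → ℂ} (hu : Continuous u) (hui : Integrable u) {g : ℝ → ℂ}
    (hg : AEStronglyMeasurable g volume) (hg2 : ∫⁻ s, ‖g s‖ₑ ^ 2 < ⊤) {ns : ℕ → ℕ}
    (hns : Tendsto ns atTop atTop)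
    (hlim : Tendsto (fun j => ∫⁻ s, ‖(∫ σ, cutoff (ns j) σ *
      (((2 * Real.pi * |σ| : ℝ) : ℂ) * u σ) * character s σ) - g s‖ₑ ^ 2) atTop (𝓝 0)) :
    IsWeakDeriv (fun s => ∫ σ, hilbertSymbol σ * u σ * character s σ) g := by
  have hi : Integrable fun σ => hilbertSymbol σ * u σ :=
    hui.bdd_mul (c := 1) measurable_hilbertSymbol.aestronglyMeasurable
      (Eventually.of_forall fun σ => (norm_hilbertSymbol σ).le)
  have hiN : ∀ N, Integrable fun σ => cutoff N σ * (hilbertSymbol σ * u σ) := fun N =>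
    hi.bdd_mul (c := 1) (measurable_cutoff N).aestronglyMeasurable
      (Eventually.of_forall fun σ => norm_cutoff_le N σ)
  have hiN' : ∀ N, Integrable fun σ => cutoff N σ * (((2 * Real.pi * |σ| : ℝ) : ℂ) * u σ) :=
    fun N => integrable_cutoff_mul (by fun_prop) N
  set W : ℝ → ℂ := fun s => ∫ σ, hilbertSymbol σ * u σ * character s σ with hW
  set WN : ℕ → ℝ → ℂ := fun N s => ∫ σ, cutoff N σ * (hilbertSymbol σ * u σ) * character s σ
    with hWN
  set gN : ℕ → ℝ → ℂ := fun N s =>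
    ∫ σ, cutoff N σ * (((2 * Real.pi * |σ| : ℝ) : ℂ) * u σ) * character s σ with hgN
  have hWc : Continuous W := continuous_integral_mul_character hi
  have hWNc : ∀ N, Continuous (WN N) := fun N => continuous_integral_mul_character (hiN N)
  have hgNc : ∀ N, Continuous (gN N) := fun N => continuous_integral_mul_character (hiN' N)
  have hgm : MemLp g 2 volume := memLp_two_of_lintegral_lt_top hg hg2
  refine ⟨hWc.locallyIntegrable, hgm.locallyIntegrable (by norm_num), fun φ hφ hφc => ?_⟩
  have hφ' : Continuous (deriv φ) := hφ.continuous_deriv (by norm_num)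
  have hφC : HasCompactSupport fun s => ((φ s : ℝ) : ℂ) := hφc.comp_left Complex.ofReal_zero
  have hφC' : HasCompactSupport fun s => ((deriv φ s : ℝ) : ℂ) :=
    hφc.deriv.comp_left Complex.ofReal_zero
  have hφcont : Continuous φ := hφ.continuous
  -- integration by parts at finite band width
  have hparts : ∀ N, ∫ s, ((deriv φ s : ℝ) : ℂ) * WN N s = -∫ s, ((φ s : ℝ) : ℂ) * gN N s := by
    intro N
    have h := integral_mul_deriv_eq_deriv_mul_of_integrable (u := fun s => ((φ s : ℝ) : ℂ))
      (u' := fun s => ((deriv φ s : ℝ) : ℂ)) (v := WN N) (v' := gN N)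
      (fun s _ => ((hφ.differentiable (by norm_num) s).hasDerivAt).ofReal_comp)
      (fun s _ => hasDerivAt_integral_cutoff hu N s)
      (Continuous.integrable_of_hasCompactSupport
        ((by fun_prop : Continuous fun s => ((φ s : ℝ) : ℂ)).mul (hgNc N)) hφC.mul_right)
      (Continuous.integrable_of_hasCompactSupport
        ((by fun_prop : Continuous fun s => ((deriv φ s : ℝ) : ℂ)).mul (hWNc N)) hφC'.mul_right)
      (Continuous.integrable_of_hasCompactSupport
        ((by fun_prop : Continuous fun s => ((φ s : ℝ) : ℂ)).mul (hWNc N)) hφC.mul_right)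
    rw [h, neg_neg]
  have hWpt : ∀ s, Tendsto (fun j => WN (ns j) s) atTop (𝓝 (W s)) := by
    intro s
    refine tendsto_integral_of_dominated_convergence (fun σ => ‖hilbertSymbol σ * u σ‖)
      (fun j => (integrable_mul_character (hiN (ns j)) s).1) hi.norm
      (fun j => Eventually.of_forall fun σ => ?_) (Eventually.of_forall fun σ => ?_)
    · rw [norm_mul_character]
      exact norm_cutoff_mul_le _ _ _
    · have h := ((tendsto_cutoff σ).comp hns).mul_const (hilbertSymbol σ * u σ)
      rw [one_mul] at h
      exact h.mul_const (character s σ)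
  have hleft : Tendsto (fun j => ∫ s, ((deriv φ s : ℝ) : ℂ) * WN (ns j) s) atTop
      (𝓝 (∫ s, ((deriv φ s : ℝ) : ℂ) * W s)) := by
    have hφ'i : Integrable fun s => ((deriv φ s : ℝ) : ℂ) :=
      Continuous.integrable_of_hasCompactSupport (by fun_prop) hφC'
    refine tendsto_integral_of_dominated_convergence
      (fun s => ‖((deriv φ s : ℝ) : ℂ)‖ * ∫ σ, ‖hilbertSymbol σ * u σ‖)
      (fun j => hφ'i.1.mul (hWNc _).aestronglyMeasurable) (hφ'i.norm.mul_const _)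
      (fun j => Eventually.of_forall fun s => ?_)
      (Eventually.of_forall fun s => (hWpt s).const_mul _)
    rw [norm_mul]
    gcongr
    refine (norm_integral_mul_character_le _ _).trans ?_
    exact integral_mono (hiN _).norm hi.norm fun σ => norm_cutoff_mul_le _ _ _
  have hright : Tendsto (fun j => ∫ s, ((φ s : ℝ) : ℂ) * gN (ns j) s) atTop
      (𝓝 (∫ s, ((φ s : ℝ) : ℂ) * g s)) := by
    set A := ∫⁻ s, ‖((φ s : ℝ) : ℂ)‖ₑ ^ 2 with hA
    have hφ2 : MemLp (fun s => ((φ s : ℝ) : ℂ)) 2 volume :=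
      Continuous.memLp_of_hasCompactSupport (by fun_prop) hφC
    refine tendsto_integral_of_L1 _ (hφ2.1.mul hg)
      (Eventually.of_forall fun j => Continuous.integrable_of_hasCompactSupport
        ((by fun_prop : Continuous fun s => ((φ s : ℝ) : ℂ)).mul (hgNc _)) hφC.mul_right) ?_
    -- the Cauchy-Schwarz inequality
    have hbd : ∀ j, ∫⁻ s, ‖((φ s : ℝ) : ℂ) * gN (ns j) s - ((φ s : ℝ) : ℂ) * g s‖ₑ ≤
        eLpNorm (fun s => ((φ s : ℝ) : ℂ)) 2 volume *
          (∫⁻ s, ‖gN (ns j) s - g s‖ₑ ^ 2) ^ (1 / 2 : ℝ) := by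
      intro j
      have h := ENNReal.lintegral_mul_le_Lp_mul_Lq volume Real.HolderConjugate.two_two
        hφ2.1.enorm ((hgNc (ns j)).aestronglyMeasurable.sub hg).enorm
      have he : eLpNorm (fun s => ((φ s : ℝ) : ℂ)) 2 volume =
          (∫⁻ s, ‖((φ s : ℝ) : ℂ)‖ₑ ^ (2 : ℝ)) ^ (1 / 2 : ℝ) := by
        rw [eLpNorm_eq_lintegral_rpow_enorm_toReal (by norm_num) (by norm_num)]
        norm_num
      rw [he]
      refine le_trans (le_of_eq (lintegral_congr fun s => ?_)) (h.trans (le_of_eq ?_))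
      · simp only [Pi.mul_apply, Pi.sub_apply]
        rw [← mul_sub, enorm_mul]
      · simp only [Pi.sub_apply, ENNReal.rpow_ofNat]
    refine tendsto_of_tendsto_of_tendsto_of_le_of_le tendsto_const_nhds ?_
      (fun _ => zero_le) hbd
    have h1 := (ENNReal.continuous_rpow_const (y := (1 / 2 : ℝ))).tendsto 0 |>.comp hlim
    rw [ENNReal.zero_rpow_of_pos (by norm_num)] at h1
    have h2 := ENNReal.Tendsto.const_mul (a := eLpNorm (fun s => ((φ s : ℝ) : ℂ)) 2 volume) h1
      (Or.inr hφ2.2.ne)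
    rwa [mul_zero] at h2
  refine tendsto_nhds_unique hleft ?_
  simp only [hparts]
  exact hright.neg

end WeakDerivative

/-! ### The ramp-filtered data -/

section RampFilter

/-- The Fourier transform of a slice, cut off at the frequency `N` and multiplied by the ramp
`2 π |σ|`. -/
noncomputable def rampSymbol (k : Plane → ℂ) (N : ℕ) (β σ : ℝ) : ℂ :=
  cutoff N σ * (((2 * Real.pi * |σ| : ℝ) : ℂ) * fourierSlice k β σ)

/-- The ramp filtered Radon transform, cut off at the frequency `N`. -/
noncomputable def ramp (k : Plane → ℂ) (N : ℕ) (β s : ℝ) : ℂ :=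
  ∫ σ, rampSymbol k N β σ * character s σ

/-- The energy of the ramp filtered Radon transform at frequencies above `N`. -/
noncomputable def tailEnergy (k : Plane → ℂ) (N : ℕ) : ℝ≥0∞ :=
  ∫⁻ z : ℝ × ℝ, {z : ℝ × ℝ | (N : ℝ) < |z.2|}.indicator
    (fun z => ‖((2 * Real.pi * |z.2| : ℝ) : ℂ) * fourierSlice k z.1 z.2‖ₑ ^ 2) z
    ∂(circleMeasure.prod volume)

theorem measurable_rampSymbol {k : Plane → ℂ} (hk : Integrable k) (N : ℕ) :
    Measurable fun z : ℝ × ℝ => rampSymbol k N z.1 z.2 := by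
  have := (continuous_fourierSlice hk).measurable
  unfold rampSymbol
  fun_prop

theorem stronglyMeasurable_ramp {k : Plane → ℂ} (hk : Integrable k) (N : ℕ) :
    StronglyMeasurable (Function.uncurry (ramp k N)) := by
  have h1 := measurable_rampSymbol hk N
  have h2 : Measurable fun q : ℝ × ℝ => character q.1 q.2 := continuous_character.measurable
  have h3 : Measurable fun r : (ℝ × ℝ) × ℝ => rampSymbol k N r.1.1 r.2 * character r.1.2 r.2 := by
    have h4 := h1.comp (by fun_prop : Measurable fun r : (ℝ × ℝ) × ℝ => (r.1.1, r.2))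
    have h5 := h2.comp (by fun_prop : Measurable fun r : (ℝ × ℝ) × ℝ => (r.1.2, r.2))
    exact h4.mul h5
  exact h3.stronglyMeasurable.integral_prod_right'

theorem IsAdmissible.lintegral_rampSlice_lt_top {k : Plane → ℂ} (hk : IsAdmissible k) :
    ∫⁻ z : ℝ × ℝ, ‖((2 * Real.pi * |z.2| : ℝ) : ℂ) * fourierSlice k z.1 z.2‖ₑ ^ 2
      ∂(circleMeasure.prod volume) < ⊤ := by
  have h : ∀ z : ℝ × ℝ, ‖((2 * Real.pi * |z.2| : ℝ) : ℂ) * fourierSlice k z.1 z.2‖ₑ ^ 2 =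
      ENNReal.ofReal (2 * Real.pi) ^ 2 * (‖z.2‖ₑ ^ 2 * ‖fourierSlice k z.1 z.2‖ₑ ^ 2) := by
    intro z
    have h1 : ‖((2 * Real.pi * |z.2| : ℝ) : ℂ)‖ₑ = ENNReal.ofReal (2 * Real.pi) * ‖z.2‖ₑ := by
      rw [← ofReal_norm, ← ofReal_norm, ← ENNReal.ofReal_mul (by positivity), Complex.norm_real,
        norm_mul, Real.norm_of_nonneg (by positivity), norm_abs_eq_norm]
    rw [enorm_mul, h1]
    ring
  simp only [h]
  rw [lintegral_const_mul' _ _ (by finiteness)]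
  exact ENNReal.mul_lt_top (by finiteness) hk.lintegral_slice_lt_top

theorem IsAdmissible.tendsto_tailEnergy {k : Plane → ℂ} (hk : IsAdmissible k) :
    Tendsto (tailEnergy k) atTop (𝓝 0) := by
  have hm := (continuous_fourierSlice hk.integrable).measurable
  have h0 : (0 : ℝ≥0∞) = ∫⁻ _ : ℝ × ℝ, 0 ∂(circleMeasure.prod volume) := by simp
  rw [h0]
  refine tendsto_lintegral_of_dominated_convergence
    (fun z => ‖((2 * Real.pi * |z.2| : ℝ) : ℂ) * fourierSlice k z.1 z.2‖ₑ ^ 2)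
    (fun N => ?_) (fun N => Eventually.of_forall fun z => indicator_le_self' (by simp) z)
    hk.lintegral_rampSlice_lt_top.ne (Eventually.of_forall fun z => ?_)
  · refine Measurable.indicator (by fun_prop) (measurableSet_lt (by fun_prop) (by fun_prop))
  · obtain ⟨n, hn⟩ := exists_nat_ge |z.2|
    refine tendsto_const_nhds.congr' ?_
    filter_upwards [eventually_ge_atTop n] with N hN
    rw [indicator_of_notMem]
    have : (n : ℝ) ≤ N := by exact_mod_cast hN
    simpa using hn.trans this

/-- The band-limited ramp filters form a Cauchy sequence in `L²` of the cylinder. -/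
theorem lintegral_enorm_ramp_sub_sq_le {k : Plane → ℂ} (hk : Integrable k) {n m N : ℕ}
    (hn : N ≤ n) (hm : N ≤ m) :
    ∫⁻ z, ‖Function.uncurry (ramp k n) z - Function.uncurry (ramp k m) z‖ₑ ^ 2
      ∂(circleMeasure.prod volume) ≤ tailEnergy k N := by
  have hmeas : Measurable fun z : ℝ × ℝ =>
      ‖Function.uncurry (ramp k n) z - Function.uncurry (ramp k m) z‖ₑ ^ 2 := by
    have h1 := (stronglyMeasurable_ramp hk n).measurable
    have h2 := (stronglyMeasurable_ramp hk m).measurable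
    fun_prop
  have hmeas2 : Measurable fun z : ℝ × ℝ => {z : ℝ × ℝ | (N : ℝ) < |z.2|}.indicator
      (fun z => ‖((2 * Real.pi * |z.2| : ℝ) : ℂ) * fourierSlice k z.1 z.2‖ₑ ^ 2) z := by
    have hm := (continuous_fourierSlice hk).measurable
    exact Measurable.indicator (by fun_prop) (measurableSet_lt (by fun_prop) (by fun_prop))
  rw [tailEnergy, lintegral_prod _ hmeas.aemeasurable, lintegral_prod _ hmeas2.aemeasurable]
  refine lintegral_mono fun β => ?_
  have hc : Continuous fun σ : ℝ => ((2 * Real.pi * |σ| : ℝ) : ℂ) * fourierSlice k β σ := by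
    have := continuous_fourierSlice_right hk β
    fun_prop
  have hi : ∀ n, Integrable (rampSymbol k n β) := integrable_cutoff_mul hc
  have hi2 : ∀ n, MemLp (rampSymbol k n β) 2 volume := memLp_cutoff_mul hc
  calc ∫⁻ s, ‖ramp k n β s - ramp k m β s‖ₑ ^ 2
      = ∫⁻ s, ‖∫ σ, (rampSymbol k n β - rampSymbol k m β) σ * character s σ‖ₑ ^ 2 := by
        refine lintegral_congr fun s => ?_
        rw [ramp, ramp, ← integral_sub (integrable_mul_character (hi n) s)
          (integrable_mul_character (hi m) s)]
        simp only [Pi.sub_apply, sub_mul]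
    _ = ∫⁻ σ, ‖(rampSymbol k n β - rampSymbol k m β) σ‖ₑ ^ 2 :=
        lintegral_enorm_integral_mul_character_sq ((hi n).sub (hi m)) ((hi2 n).sub (hi2 m))
    _ ≤ _ := by
        refine lintegral_mono fun σ => ?_
        have hn' : (N : ℝ) ≤ n := by exact_mod_cast hn
        have hm' : (N : ℝ) ≤ m := by exact_mod_cast hm
        simp only [Pi.sub_apply, rampSymbol, ← sub_mul]
        rcases le_or_gt |σ| N with h | h
        · rw [cutoff_of_le (h.trans hn'), cutoff_of_le (h.trans hm')]
          simp
        · rw [indicator_of_mem (by exact h), enorm_mul]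
          have hle : ‖cutoff n σ - cutoff m σ‖ₑ ≤ 1 := by
            simp only [cutoff, indicator]
            split_ifs <;> simp
          gcongr
          exact mul_le_of_le_one_left zero_le hle

theorem lintegral_enorm_ramp_sq_lt_top {k : Plane → ℂ} (hk : IsAdmissible k) (n : ℕ) :
    ∫⁻ z, ‖Function.uncurry (ramp k n) z‖ₑ ^ 2 ∂(circleMeasure.prod volume) < ⊤ := by
  have hmeas : Measurable fun z : ℝ × ℝ => ‖Function.uncurry (ramp k n) z‖ₑ ^ 2 := by
    have h1 := (stronglyMeasurable_ramp hk.integrable n).measurable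
    fun_prop
  have hmeas2 : Measurable fun z : ℝ × ℝ =>
      ‖((2 * Real.pi * |z.2| : ℝ) : ℂ) * fourierSlice k z.1 z.2‖ₑ ^ 2 := by
    have hm := (continuous_fourierSlice hk.integrable).measurable
    fun_prop
  refine lt_of_le_of_lt ?_ hk.lintegral_rampSlice_lt_top
  rw [lintegral_prod _ hmeas.aemeasurable, lintegral_prod _ hmeas2.aemeasurable]
  refine lintegral_mono fun β => ?_
  have hc : Continuous fun σ : ℝ => ((2 * Real.pi * |σ| : ℝ) : ℂ) * fourierSlice k β σ := by
    have := continuous_fourierSlice_right hk.integrable β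
    fun_prop
  have h := lintegral_enorm_integral_mul_character_sq (integrable_cutoff_mul hc n)
    (memLp_cutoff_mul hc n)
  refine le_trans (le_of_eq h) (lintegral_mono fun σ => ?_)
  gcongr ?_ ^ 2
  rw [enorm_le_iff_norm_le]
  exact norm_cutoff_mul_le _ _ _

/-- The band-limited ramp filtered Radon transforms converge in `L²` of the cylinder. -/
theorem IsAdmissible.exists_limit_ramp {k : Plane → ℂ} (hk : IsAdmissible k) :
    ∃ g : ℝ → ℝ → ℂ, StronglyMeasurable (Function.uncurry g) ∧
      ∫⁻ z, ‖Function.uncurry g z‖ₑ ^ 2 ∂(circleMeasure.prod volume) < ⊤ ∧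
      Tendsto (fun N => ∫⁻ z, ‖Function.uncurry (ramp k N) z - Function.uncurry g z‖ₑ ^ 2
        ∂(circleMeasure.prod volume)) atTop (𝓝 0) := by
  have hmem : ∀ N, MemLp (Function.uncurry (ramp k N)) 2 (circleMeasure.prod volume) := fun N =>
    memLp_two_of_lintegral_lt_top (stronglyMeasurable_ramp hk.integrable N).aestronglyMeasurable
      (lintegral_enorm_ramp_sq_lt_top hk N)
  have hcauchy : CauchySeq fun N => (hmem N).toLp := by
    rw [EMetric.cauchySeq_iff]
    intro ε hε
    have hε2 : 0 < ε ^ 2 := by positivity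
    obtain ⟨N, hN⟩ := ((hk.tendsto_tailEnergy.eventually_lt_const hε2)).exists
    refine ⟨N, fun m hm n hn => ?_⟩
    rw [Lp.edist_toLp_toLp]
    have h1 : eLpNorm (Function.uncurry (ramp k m) - Function.uncurry (ramp k n)) 2
        (circleMeasure.prod volume) ^ 2 < ε ^ 2 := by
      rw [eLpNorm_two_sq]
      exact (lintegral_enorm_ramp_sub_sq_le hk.integrable hm hn).trans_lt hN
    exact lt_of_not_ge fun h => h1.not_ge (pow_le_pow_left' h 2)
  obtain ⟨G, hG⟩ := cauchySeq_tendsto_of_complete hcauchy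
  refine ⟨fun β s => G (β, s), Lp.stronglyMeasurable G, ?_, ?_⟩
  · rw [← eLpNorm_two_sq]
    exact ENNReal.pow_lt_top (Lp.memLp G).2
  · have h1 := (Lp.tendsto_Lp_iff_tendsto_eLpNorm' _ _).1 hG
    have h2 := (ENNReal.continuous_pow 2).tendsto 0 |>.comp h1
    rw [zero_pow two_ne_zero] at h2
    refine h2.congr fun N => ?_
    simp only [Function.comp]
    rw [eLpNorm_two_sq]
    refine lintegral_congr_ae ?_
    filter_upwards [(hmem N).coeFn_toLp] with z hz
    rw [Pi.sub_apply, hz]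
    rfl

/-- A sequence of nonnegative functions with integrals tending to zero has a subsequence that tends
to zero almost everywhere. -/
theorem exists_subseq_ae_tendsto_zero {α : Type*} [MeasurableSpace α] {μ : Measure α}
    {e : ℕ → α → ℝ≥0∞} (he : ∀ n, Measurable (e n))
    (h : Tendsto (fun n => ∫⁻ x, e n x ∂μ) atTop (𝓝 0)) :
    ∃ ns : ℕ → ℕ, StrictMono ns ∧ ∀ᵐ x ∂μ, Tendsto (fun j => e (ns j) x) atTop (𝓝 0) := by
  obtain ⟨ns, hns, hle⟩ := extraction_forall_of_eventually
    (P := fun j n => ∫⁻ x, e n x ∂μ < (2⁻¹ : ℝ≥0∞) ^ j) fun j =>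
      h.eventually_lt_const (ENNReal.pow_pos (by norm_num) j)
  refine ⟨ns, hns, ?_⟩
  have hsum : ∫⁻ x, ∑' j, e (ns j) x ∂μ ≠ ⊤ := by
    rw [lintegral_tsum fun j => (he _).aemeasurable]
    refine ne_top_of_le_ne_top ?_ (ENNReal.tsum_le_tsum fun j => (hle j).le)
    rw [ENNReal.tsum_geometric]
    norm_num
  filter_upwards [ae_lt_top (Measurable.tsum fun j => he (ns j)) hsum] with x hx
  exact ENNReal.tendsto_atTop_zero_of_tsum_ne_top hx.ne

/-- For almost every direction the `L²` limit of the ramp filtered Radon transforms is the weak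
derivative of the Hilbert transform of the Radon transform. -/
theorem IsAdmissible.ae_isWeakDeriv {k : Plane → ℂ} (hk : IsAdmissible k) {g : ℝ → ℝ → ℂ}
    (hg : StronglyMeasurable (Function.uncurry g))
    (hg2 : ∫⁻ z, ‖Function.uncurry g z‖ₑ ^ 2 ∂(circleMeasure.prod volume) < ⊤)
    (hlim : Tendsto (fun N => ∫⁻ z, ‖Function.uncurry (ramp k N) z - Function.uncurry g z‖ₑ ^ 2
        ∂(circleMeasure.prod volume)) atTop (𝓝 0)) :
    ∀ᵐ β ∂circleMeasure, IsWeakDeriv (filteredSlice k β) (g β) := by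
  have hm1 : Measurable fun z : ℝ × ℝ => ‖Function.uncurry g z‖ₑ ^ 2 := by
    have := hg.measurable
    fun_prop
  have hm2 : ∀ N, Measurable fun z : ℝ × ℝ =>
      ‖Function.uncurry (ramp k N) z - Function.uncurry g z‖ₑ ^ 2 := fun N => by
    have h1 := (stronglyMeasurable_ramp hk.integrable N).measurable
    have h2 := hg.measurable
    fun_prop
  rw [lintegral_prod _ hm1.aemeasurable] at hg2
  simp only [lintegral_prod _ (hm2 _).aemeasurable] at hlim
  obtain ⟨ns, hns, hae⟩ := exists_subseq_ae_tendsto_zero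
    (fun N => (hm2 N).lintegral_prod_right') hlim
  filter_upwards [hae, ae_lt_top hm1.lintegral_prod_right' hg2.ne, hk.ae_slice] with β h1 h2 h3
  have hgβ : StronglyMeasurable (g β) := hg.comp_measurable (measurable_prodMk_left (x := β))
  exact isWeakDeriv_of_tendsto (continuous_fourierSlice_right hk.integrable β)
    (integrable_fourierSlice hk.integrable h3) hgβ.aestronglyMeasurable h2
    hns.tendsto_atTop h1

end RampFilter

/-! ### Truncated Fourier inversion -/

section InverseFourier

variable {E : Type*} [NormedAddCommGroup E] [InnerProductSpace ℝ E] [FiniteDimensional ℝ E]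
  [MeasurableSpace E] [BorelSpace E]

theorem continuous_fourierInv {k : E → ℂ} (hk : Integrable k) : Continuous (𝓕⁻ k) := by
  have h : 𝓕⁻ k = fun x => 𝓕 k (-x) := funext fun x => Real.fourierInv_eq_fourier_neg k x
  rw [h]
  exact (continuous_fourier hk).comp continuous_neg

/-- On `L¹ ∩ L²` the inverse Fourier transform of `L²` is given by the inverse Fourier integral. -/
theorem coeFn_fourierInv_toLp {k : E → ℂ} (hk : Integrable k) (hk2 : MemLp k 2 volume) :
    ((𝓕⁻ (hk2.toLp k) : Lp ℂ 2 (volume : Measure E)) : E → ℂ) =ᵐ[volume] 𝓕⁻ k := by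
  refine ae_eq_of_integral_schwartz_smul_eq ((Lp.memLp _).locallyIntegrable (by norm_num))
    (continuous_fourierInv hk).locallyIntegrable fun u => ?_
  have h1 := DFunLike.congr_fun (Lp.fourierInv_toTemperedDistribution_eq (hk2.toLp k)) u
  rw [TemperedDistribution.fourierInv_apply, Lp.toTemperedDistribution_apply,
    Lp.toTemperedDistribution_apply] at h1
  rw [← h1]
  have h2 : ∫ x, 𝓕 (u : E → ℂ) x • k (-x) = ∫ x, u x • 𝓕 (fun x => k (-x)) x :=
    VectorFourier.integral_fourierIntegral_smul_eq_flip (L := innerₗ E)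
      Real.continuous_fourierChar continuous_inner u.integrable hk.comp_neg |>.trans (by
        simp only [flip_innerₗ]; rfl)
  have h3 : ∫ x, (𝓕⁻ u) x • k x = ∫ x, 𝓕 (u : E → ℂ) x • k (-x) := by
    rw [← integral_neg_eq_self]
    refine integral_congr_ae (Eventually.of_forall fun x => ?_)
    simp only [SchwartzMap.fourierInv_coe, Real.fourierInv_eq_fourier_neg, neg_neg]
  have h4 : 𝓕⁻ k = 𝓕 (fun x => k (-x)) := Real.fourierInv_eq_fourier_comp_neg k
  rw [h4, ← h2, ← h3]
  refine integral_congr_ae ?_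
  filter_upwards [hk2.coeFn_toLp] with x hx
  rw [hx]

/-- The `L²` distance between the inverse Fourier integral of `m` and `k` is that between `m` and
the Fourier transform of `k`. -/
theorem lintegral_enorm_fourierInv_sub_sq {k m : E → ℂ} (hk : Integrable k)
    (hk2 : MemLp k 2 volume) (hm : Integrable m) (hm2 : MemLp m 2 volume) :
    ∫⁻ y, ‖𝓕⁻ m y - k y‖ₑ ^ 2 = ∫⁻ ξ, ‖m ξ - 𝓕 k ξ‖ₑ ^ 2 := by
  have h1 : ‖𝓕⁻ (hm2.toLp m) - hk2.toLp k‖ₑ = ‖hm2.toLp m - 𝓕 (hk2.toLp k)‖ₑ := by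
    rw [← ofReal_norm, ← ofReal_norm, ← Lp.norm_fourier_eq (𝓕⁻ (hm2.toLp m) - hk2.toLp k)]
    congr 2
    rw [sub_eq_add_neg, FourierTransform.fourier_add, FourierTransform.fourier_neg,
      FourierTransform.fourier_fourierInv_eq, ← sub_eq_add_neg]
  rw [Lp.enorm_def, Lp.enorm_def] at h1
  have h2 : eLpNorm (fun y => 𝓕⁻ m y - k y) 2 volume =
      eLpNorm (𝓕⁻ (hm2.toLp m) - hk2.toLp k : Lp ℂ 2 (volume : Measure E)) 2 volume := by
    refine eLpNorm_congr_ae ?_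
    filter_upwards [coeFn_fourierInv_toLp hm hm2, hk2.coeFn_toLp,
      Lp.coeFn_sub (𝓕⁻ (hm2.toLp m)) (hk2.toLp k)] with y h3 h4 h5
    rw [h5, Pi.sub_apply, h3, h4]
  have h3 : eLpNorm (fun y => m y - 𝓕 k y) 2 volume =
      eLpNorm (hm2.toLp m - 𝓕 (hk2.toLp k) : Lp ℂ 2 (volume : Measure E)) 2 volume := by
    refine eLpNorm_congr_ae ?_
    filter_upwards [coeFn_fourier_toLp hk hk2, hm2.coeFn_toLp,
      Lp.coeFn_sub (hm2.toLp m) (𝓕 (hk2.toLp k))] with y h3 h4 h5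
    rw [h5, Pi.sub_apply, h3, h4]
  rw [← eLpNorm_two_sq, ← eLpNorm_two_sq, h2, h1, h3]

end InverseFourier

/-! ### Backprojection -/

section Backprojection

/-- The Fourier transform of `k` cut off at the frequency `N`. -/
noncomputable def truncatedFourier (k : Plane → ℂ) (N : ℕ) (ξ : Plane) : ℂ :=
  cutoff N ‖ξ‖ * 𝓕 k ξ

theorem integrable_truncatedFourier {k : Plane → ℂ} (hk : Integrable k) (N : ℕ) :
    Integrable (truncatedFourier k N) := by
  have hc := continuous_fourier hk
  have h : truncatedFourier k N = (Metric.closedBall 0 (N : ℝ)).indicator (𝓕 k) := by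
    ext ξ
    simp only [truncatedFourier, cutoff, indicator, mem_ofPred_eq, abs_norm,
      mem_closedBall_zero_iff]
    split_ifs <;> simp
  rw [h, integrable_indicator_iff measurableSet_closedBall]
  exact hc.continuousOn.integrableOn_compact (isCompact_closedBall _ _)

theorem memLp_truncatedFourier {k : Plane → ℂ} (hk : Integrable k) (hk2 : MemLp k 2 volume)
    (N : ℕ) : MemLp (truncatedFourier k N) 2 volume :=
  (memLp_fourier hk hk2).mono (integrable_truncatedFourier hk N).1
    (Eventually.of_forall fun _ => norm_cutoff_mul_le _ _ _)

theorem tendsto_lintegral_truncatedFourier {k : Plane → ℂ} (hk : Integrable k)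
    (hk2 : MemLp k 2 volume) :
    Tendsto (fun N => ∫⁻ y, ‖𝓕⁻ (truncatedFourier k N) y - k y‖ₑ ^ 2) atTop (𝓝 0) := by
  simp only [lintegral_enorm_fourierInv_sub_sq hk hk2 (integrable_truncatedFourier hk _)
    (memLp_truncatedFourier hk hk2 _)]
  have h0 : (0 : ℝ≥0∞) = ∫⁻ _ : Plane, 0 := by simp
  rw [h0]
  have hc := continuous_fourier hk
  have hfin : ∫⁻ ξ, ‖𝓕 k ξ‖ₑ ^ 2 ≠ ⊤ := by
    rw [← eLpNorm_two_sq]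
    exact (ENNReal.pow_lt_top (memLp_fourier hk hk2).2).ne
  have hlt : ∀ N : ℕ, ∀ ξ : Plane, (N : ℝ) < ‖ξ‖ → truncatedFourier k N ξ = 0 := fun N ξ h => by
    rw [truncatedFourier, cutoff_of_lt (by rwa [abs_norm]), zero_mul]
  have hle : ∀ N : ℕ, ∀ ξ : Plane, ‖ξ‖ ≤ N → truncatedFourier k N ξ = 𝓕 k ξ := fun N ξ h => by
    rw [truncatedFourier, cutoff_of_le (by rwa [abs_norm]), one_mul]
  refine tendsto_lintegral_of_dominated_convergence (fun ξ => ‖𝓕 k ξ‖ₑ ^ 2) (fun N => ?_)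
    (fun N => Eventually.of_forall fun ξ => ?_) hfin (Eventually.of_forall fun ξ => ?_)
  · unfold truncatedFourier
    fun_prop
  · rcases le_or_gt ‖ξ‖ N with h | h
    · simp [hle N ξ h]
    · simp [hlt N ξ h]
  · obtain ⟨n, hn⟩ := exists_nat_ge ‖ξ‖
    refine tendsto_const_nhds.congr' ?_
    filter_upwards [eventually_ge_atTop n] with N hN
    have : (n : ℝ) ≤ N := by exact_mod_cast hN
    simp [hle N ξ (hn.trans this)]

/-- Polar coordinates in frequency space turn the backprojection of the ramp filtered Radon
transform into the Fourier inversion formula. -/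
theorem backprojection_ramp {k : Plane → ℂ} (hk : Integrable k) (N : ℕ) (y : Plane) :
    backprojection (ramp k N) y = ((4 * Real.pi : ℝ) : ℂ) * 𝓕⁻ (truncatedFourier k N) y := by
  set H : Plane → ℂ := fun ξ =>
    truncatedFourier k N ξ * Complex.exp (((2 * Real.pi * ⟪ξ, y⟫_ℝ : ℝ) : ℂ) * Complex.I) with hH
  have hHi : Integrable H := by
    have hc : Continuous fun ξ : Plane =>
        Complex.exp (((2 * Real.pi * ⟪ξ, y⟫_ℝ : ℝ) : ℂ) * Complex.I) := by fun_prop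
    exact (integrable_truncatedFourier hk N).mul_bdd (c := 1) hc.aestronglyMeasurable
      (Eventually.of_forall fun ξ => (Complex.norm_exp_ofReal_mul_I _).le)
  have h1 : ∀ θ, ramp k N θ ⟪y, dir θ⟫_ℝ =
      2 * Real.pi * ∫ σ : ℝ, ((|σ| : ℝ) : ℂ) * H (σ • dir θ) := by
    intro θ
    rw [ramp, ← integral_const_mul]
    refine integral_congr_ae (Eventually.of_forall fun σ => ?_)
    have hn : ‖σ • dir θ‖ = |σ| := by rw [norm_smul, norm_dir, mul_one, Real.norm_eq_abs]
    simp only [hH, truncatedFourier, rampSymbol, fourierSlice, character, hn, cutoff_abs,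
      real_inner_comm y, inner_smul_right]
    have hr : (2 * Real.pi * σ * ⟪y, dir θ⟫_ℝ) = 2 * Real.pi * (σ * ⟪y, dir θ⟫_ℝ) := by ring
    rw [hr]
    push_cast
    ring
  have h2 : ∫ ξ, H ξ = 𝓕⁻ (truncatedFourier k N) y := by
    rw [Real.fourierInv_eq']
    refine integral_congr_ae (Eventually.of_forall fun ξ => ?_)
    simp only [hH, smul_eq_mul]
    rw [mul_comm]
  rw [backprojection]
  simp only [h1]
  rw [integral_const_mul, integral_abs_mul_comp_smul_dir hHi, h2]
  push_cast
  ring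

/-- On a bounded set, backprojection is bounded from `L²` of the cylinder to `L¹`. -/
theorem sq_lintegral_lintegral_backprojection_le {u : ℝ × ℝ → ℂ} (hu : Measurable u) (R : ℝ) :
    (∫⁻ y in Metric.ball (0 : Plane) R, ∫⁻ θ, ‖u (θ, ⟪y, dir θ⟫_ℝ)‖ₑ ∂circleMeasure) ^ 2 ≤
      ENNReal.ofReal (2 * R) ^ 2 * ((∫⁻ z, ‖u z‖ₑ ^ 2 ∂(circleMeasure.prod volume)) *
        (circleMeasure univ * ENNReal.ofReal (2 * R))) := by
  have hm : Measurable fun q : Plane × ℝ => ‖u (q.2, ⟪q.1, dir q.2⟫_ℝ)‖ₑ := by fun_prop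
  have hvol : volume (Icc (-R) R) = ENNReal.ofReal (2 * R) := by
    rw [Real.volume_Icc]
    congr 1
    ring
  have hθ : ∀ θ, ∫⁻ y in Metric.ball (0 : Plane) R, ‖u (θ, ⟪y, dir θ⟫_ℝ)‖ₑ ≤
      ENNReal.ofReal (2 * R) * ∫⁻ s in Icc (-R) R, ‖u (θ, s)‖ₑ := by
    intro θ
    have hmθ : Measurable fun y : Plane => ‖u (θ, ⟪y, dir θ⟫_ℝ)‖ₑ := by fun_prop
    have hms : Measurable fun s : ℝ => ‖u (θ, s)‖ₑ := by fun_prop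
    rw [← lintegral_indicator measurableSet_ball,
      ← (measurePreserving_planeCoord 0 θ).lintegral_comp (hmθ.indicator measurableSet_ball)]
    calc ∫⁻ q, (Metric.ball (0 : Plane) R).indicator (fun y => ‖u (θ, ⟪y, dir θ⟫_ℝ)‖ₑ)
          (planeCoord 0 θ q)
        ≤ ∫⁻ q, (Icc (-R) R ×ˢ Icc (-R) R).indicator (fun q => ‖u (θ, q.1)‖ₑ) q := by
          refine lintegral_mono fun q => ?_
          have h1 := inner_planeCoord_sub 0 θ q
          have h2 := norm_planeCoord_sub_sq 0 θ q
          rw [sub_zero] at h1 h2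
          by_cases hq : planeCoord 0 θ q ∈ Metric.ball (0 : Plane) R
          · have hq' : ‖planeCoord 0 θ q‖ < R := mem_ball_zero_iff.1 hq
            have hR : 0 ≤ R := (norm_nonneg _).trans hq'.le
            have h3 : q.1 ^ 2 + q.2 ^ 2 ≤ R ^ 2 := by
              rw [← h2]
              gcongr
            have h4 : |q.1| ≤ R := abs_le_of_sq_le_sq (by nlinarith [sq_nonneg q.2]) hR
            have h5 : |q.2| ≤ R := abs_le_of_sq_le_sq (by nlinarith [sq_nonneg q.1]) hR
            have hmem : q ∈ Icc (-R) R ×ˢ Icc (-R) R := ⟨abs_le.1 h4, abs_le.1 h5⟩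
            rw [indicator_of_mem hq, indicator_of_mem hmem, h1]
          · rw [indicator_of_notMem hq]
            exact zero_le
      _ = ENNReal.ofReal (2 * R) * ∫⁻ s in Icc (-R) R, ‖u (θ, s)‖ₑ := by
          have hmq : Measurable fun q : ℝ × ℝ => ‖u (θ, q.1)‖ₑ := by fun_prop
          rw [lintegral_indicator (measurableSet_Icc.prod measurableSet_Icc),
            Measure.volume_eq_prod, ← Measure.prod_restrict, lintegral_prod _ hmq.aemeasurable]
          simp only [lintegral_const, Measure.restrict_apply_univ]
          rw [lintegral_mul_const _ hms, hvol, mul_comm]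
  have hstep : ∫⁻ y in Metric.ball (0 : Plane) R, ∫⁻ θ, ‖u (θ, ⟪y, dir θ⟫_ℝ)‖ₑ ∂circleMeasure ≤
      ENNReal.ofReal (2 * R) *
        ∫⁻ z, ‖u z‖ₑ ∂(circleMeasure.prod (volume.restrict (Icc (-R) R))) := by
    rw [lintegral_lintegral_swap hm.aemeasurable, lintegral_prod _ hu.enorm.aemeasurable,
      ← lintegral_const_mul' _ _ ENNReal.ofReal_ne_top]
    exact lintegral_mono hθ
  have hcs := sq_lintegral_enorm_le (μ := circleMeasure.prod (volume.restrict (Icc (-R) R)))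
    hu.aestronglyMeasurable
  have huniv : (circleMeasure.prod (volume.restrict (Icc (-R) R))) univ =
      circleMeasure univ * ENNReal.ofReal (2 * R) := by
    rw [← univ_prod_univ, Measure.prod_prod, Measure.restrict_apply_univ, hvol]
  have hle : circleMeasure.prod (volume.restrict (Icc (-R) R)) ≤ circleMeasure.prod volume := by
    have : circleMeasure.prod (volume.restrict (Icc (-R) R)) =
        (circleMeasure.prod volume).restrict (univ ×ˢ Icc (-R) R) := by
      rw [← Measure.prod_restrict, Measure.restrict_univ]
    rw [this]
    exact Measure.restrict_le_self
  calc _ ≤ (ENNReal.ofReal (2 * R) *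
        ∫⁻ z, ‖u z‖ₑ ∂(circleMeasure.prod (volume.restrict (Icc (-R) R)))) ^ 2 := by
        gcongr
    _ ≤ _ := by
        rw [mul_pow]
        gcongr
        rw [← huniv]
        refine hcs.trans ?_
        gcongr

theorem ae_integrable_backprojection {g : ℝ → ℝ → ℂ}
    (hg : StronglyMeasurable (Function.uncurry g))
    (hg2 : ∫⁻ z, ‖Function.uncurry g z‖ₑ ^ 2 ∂(circleMeasure.prod volume) < ⊤) :
    ∀ᵐ y : Plane, Integrable (fun θ => g θ ⟪y, dir θ⟫_ℝ) circleMeasure := by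
  have hgm := hg.measurable
  have hm : Measurable fun q : Plane × ℝ => ‖Function.uncurry g (q.2, ⟪q.1, dir q.2⟫_ℝ)‖ₑ := by
    fun_prop
  have hball : ∀ n : ℕ, ∀ᵐ y : Plane, y ∈ Metric.ball (0 : Plane) n →
      ∫⁻ θ, ‖Function.uncurry g (θ, ⟪y, dir θ⟫_ℝ)‖ₑ ∂circleMeasure < ⊤ := by
    intro n
    rw [← ae_restrict_iff' measurableSet_ball]
    refine ae_lt_top hm.lintegral_prod_right' ?_
    have h := sq_lintegral_lintegral_backprojection_le hgm n
    have h2 : (∫⁻ y in Metric.ball (0 : Plane) n,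
        ∫⁻ θ, ‖Function.uncurry g (θ, ⟪y, dir θ⟫_ℝ)‖ₑ ∂circleMeasure) ^ 2 < ⊤ :=
      h.trans_lt (by finiteness)
    exact ((ENNReal.pow_lt_top_iff).1 h2 |>.resolve_right two_ne_zero).ne
  filter_upwards [ae_all_iff.2 hball] with y hy
  obtain ⟨n, hn⟩ := exists_nat_gt ‖y‖
  have hmy : Measurable fun θ => Function.uncurry g (θ, ⟪y, dir θ⟫_ℝ) := by fun_prop
  exact ⟨hmy.aestronglyMeasurable, hy n (mem_ball_zero_iff.2 hn)⟩

/-- Filtered backprojection of the `L²` limit of the ramp filtered Radon transforms. -/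
theorem IsAdmissible.ae_eq_backprojection {k : Plane → ℂ} (hk : IsAdmissible k) {g : ℝ → ℝ → ℂ}
    (hg : StronglyMeasurable (Function.uncurry g))
    (hg2 : ∫⁻ z, ‖Function.uncurry g z‖ₑ ^ 2 ∂(circleMeasure.prod volume) < ⊤)
    (hlim : Tendsto (fun N => ∫⁻ z, ‖Function.uncurry (ramp k N) z - Function.uncurry g z‖ₑ ^ 2
        ∂(circleMeasure.prod volume)) atTop (𝓝 0)) :
    ∀ᵐ y : Plane, ((4 * Real.pi : ℝ) : ℂ) * k y = backprojection g y := by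
  have hgm := hg.measurable
  have hrm := fun N => (stronglyMeasurable_ramp hk.integrable N).measurable
  have hbm : Measurable (backprojection g) := by
    have h : Measurable fun q : Plane × ℝ => Function.uncurry g (q.2, ⟪q.1, dir q.2⟫_ℝ) := by
      fun_prop
    exact h.stronglyMeasurable.integral_prod_right'.measurable
  have hkm := hk.measurable
  have hball : ∀ n : ℕ, ∀ᵐ y : Plane, y ∈ Metric.ball (0 : Plane) n →
      ((4 * Real.pi : ℝ) : ℂ) * k y = backprojection g y := by
    intro n
    rw [← ae_restrict_iff' measurableSet_ball]
    set B := Metric.ball (0 : Plane) (n : ℝ) with hB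
    set c : ℂ := ((4 * Real.pi : ℝ) : ℂ) with hc
    set e1 : ℕ → ℝ≥0∞ := fun N => ∫⁻ y in B, ‖𝓕⁻ (truncatedFourier k N) y - k y‖ₑ with he1
    set e2 : ℕ → ℝ≥0∞ := fun N => ∫⁻ y in B, ∫⁻ θ,
      ‖ramp k N θ ⟪y, dir θ⟫_ℝ - g θ ⟪y, dir θ⟫_ℝ‖ₑ ∂circleMeasure with he2
    have hsq : ∀ e : ℕ → ℝ≥0∞, Tendsto (fun N => e N ^ 2) atTop (𝓝 0) →
        Tendsto e atTop (𝓝 0) := by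
      intro e he
      have h := (ENNReal.continuous_rpow_const (y := (1 / 2 : ℝ))).tendsto 0 |>.comp he
      rw [ENNReal.zero_rpow_of_pos (by norm_num)] at h
      refine h.congr fun N => ?_
      simp only [Function.comp]
      rw [← ENNReal.rpow_natCast, ← ENNReal.rpow_mul]
      norm_num
    have ht1 : Tendsto e1 atTop (𝓝 0) := by
      refine hsq e1 ?_
      have h := tendsto_lintegral_truncatedFourier hk.integrable hk.memLp
      have h2 := ENNReal.Tendsto.mul_const (b := volume B) h (Or.inr measure_ball_lt_top.ne)
      rw [zero_mul] at h2
      refine tendsto_of_tendsto_of_tendsto_of_le_of_le tendsto_const_nhds h2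
        (fun _ => zero_le) fun N => ?_
      have hmeas : AEStronglyMeasurable (fun y => 𝓕⁻ (truncatedFourier k N) y - k y)
          (volume.restrict B) := by
        have := (continuous_fourierInv (integrable_truncatedFourier hk.integrable N)).measurable
        exact (this.sub hkm).aestronglyMeasurable
      refine (sq_lintegral_enorm_le hmeas).trans ?_
      rw [Measure.restrict_apply_univ]
      gcongr
      exact Measure.restrict_le_self
    have ht2 : Tendsto e2 atTop (𝓝 0) := by
      refine hsq e2 ?_
      have h2 := ENNReal.Tendsto.const_mul (a := ENNReal.ofReal (2 * n) ^ 2)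
        (ENNReal.Tendsto.mul_const (b := circleMeasure univ * ENNReal.ofReal (2 * n)) hlim
          (Or.inr (by finiteness))) (Or.inr (by finiteness))
      rw [zero_mul, mul_zero] at h2
      refine tendsto_of_tendsto_of_tendsto_of_le_of_le tendsto_const_nhds h2
        (fun _ => zero_le) fun N => ?_
      exact sq_lintegral_lintegral_backprojection_le ((hrm N).sub hgm) n
    have hbound : ∀ N, ∫⁻ y in B, ‖c * k y - backprojection g y‖ₑ ≤ ‖c‖ₑ * e1 N + e2 N := by
      intro N
      have hmeas : Measurable fun y => ‖c‖ₑ * ‖𝓕⁻ (truncatedFourier k N) y - k y‖ₑ := by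
        have := (continuous_fourierInv (integrable_truncatedFourier hk.integrable N)).measurable
        fun_prop
      have hce : ‖c‖ₑ ≠ ⊤ := enorm_ne_top
      simp only [he1, he2]
      rw [← lintegral_const_mul' _ _ hce, ← lintegral_add_left hmeas]
      refine lintegral_mono_ae (ae_restrict_of_ae ?_)
      filter_upwards [ae_integrable_backprojection hg hg2,
        ae_integrable_backprojection (stronglyMeasurable_ramp hk.integrable N)
          (lintegral_enorm_ramp_sq_lt_top hk N)] with y hy1 hy2
      have h1 : c * k y - backprojection g y =
          -(c * (𝓕⁻ (truncatedFourier k N) y - k y)) +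
            (backprojection (ramp k N) y - backprojection g y) := by
        rw [backprojection_ramp hk.integrable]
        ring
      rw [h1]
      refine (enorm_add_le _ _).trans ?_
      rw [enorm_neg, enorm_mul]
      gcongr
      rw [backprojection, backprojection, ← integral_sub hy2 hy1]
      exact enorm_integral_le_lintegral_enorm _
    have hlim0 : Tendsto (fun N => ‖c‖ₑ * e1 N + e2 N) atTop (𝓝 0) := by
      have := (ENNReal.Tendsto.const_mul (a := ‖c‖ₑ) ht1 (Or.inr enorm_ne_top)).add ht2
      simpa using this
    have hzero : ∫⁻ y in B, ‖c * k y - backprojection g y‖ₑ = 0 :=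
      le_antisymm (ge_of_tendsto' hlim0 hbound) zero_le
    rw [lintegral_eq_zero_iff (by fun_prop)] at hzero
    filter_upwards [hzero] with y hy
    exact sub_eq_zero.1 (enorm_eq_zero.1 hy)
  filter_upwards [ae_all_iff.2 hball] with y hy
  obtain ⟨n, hn⟩ := exists_nat_gt ‖y‖
  exact hy n (mem_ball_zero_iff.2 hn)

/-- A property of almost every line holds, for almost every point, for almost every line through
that point. -/
theorem ae_ae_of_ae_prod_lines {P : ℝ × ℝ → Prop}
    (h : ∀ᵐ z ∂(circleMeasure.prod volume), P z) :
    ∀ᵐ y : Plane, ∀ᵐ θ ∂circleMeasure, P (θ, ⟪y, dir θ⟫_ℝ) := by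
  -- the null set is enlarged to a measurable one, so that Fubini's theorem applies
  set Z := toMeasurable (circleMeasure.prod volume) {z | ¬ P z} with hZ
  have hZm : MeasurableSet Z := measurableSet_toMeasurable _ _
  have hZ0 : ∀ᵐ z ∂(circleMeasure.prod volume), z ∉ Z := by
    rw [← measure_eq_zero_iff_ae_notMem, hZ, measure_toMeasurable]
    exact h
  have h1 : ∀ᵐ θ ∂circleMeasure, ∀ᵐ y : Plane, (θ, ⟪y, dir θ⟫_ℝ) ∉ Z := by
    filter_upwards [Measure.ae_ae_of_ae_prod hZ0] with θ hθ
    have hq : ∀ᵐ q : ℝ × ℝ, (θ, q.1) ∉ Z :=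
      Measure.quasiMeasurePreserving_fst.ae (p := fun s => (θ, s) ∉ Z) hθ
    have hmp := ((measurePreserving_planeCoord 0 θ).symm (planeCoord 0 θ)).quasiMeasurePreserving
    filter_upwards [hmp.ae hq] with y hy
    have h2 := inner_planeCoord_sub 0 θ ((planeCoord 0 θ).symm y)
    rw [MeasurableEquiv.apply_symm_apply, sub_zero] at h2
    rwa [h2]
  have hmeas : MeasurableSet {q : ℝ × Plane | (q.1, ⟪q.2, dir q.1⟫_ℝ) ∉ Z} := by
    have : Measurable fun q : ℝ × Plane => (q.1, ⟪q.2, dir q.1⟫_ℝ) := by fun_prop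
    exact this hZm.compl
  have h2 := (Measure.ae_ae_comm (μ := circleMeasure) (ν := (volume : Measure Plane))
    (p := fun θ y => (θ, ⟪y, dir θ⟫_ℝ) ∉ Z) hmeas).1 h1
  filter_upwards [h2] with y hy
  filter_upwards [hy] with θ hθ
  by_contra hP
  exact hθ (subset_toMeasurable _ _ hP)

theorem IsWeakDeriv.ae_eq {G g g' : ℝ → ℂ} (h : IsWeakDeriv G g) (h' : IsWeakDeriv G g') :
    g =ᵐ[volume] g' := by
  refine ae_eq_of_integral_contDiff_smul_eq h.2.1 h'.2.1 fun φ hφ hφc => ?_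
  have h1 := h.2.2 φ hφ hφc
  have h2 := h'.2.2 φ hφ hφc
  simp only [Complex.real_smul]
  rw [← neg_inj, ← h1, ← h2]

theorem IsWeakDeriv.congr {G G' g : ℝ → ℂ} (h : IsWeakDeriv G g) (hG : G =ᵐ[volume] G') :
    IsWeakDeriv G' g := by
  refine ⟨h.1.congr hG, h.2.1, fun φ hφ hφc => ?_⟩
  rw [← h.2.2 φ hφ hφc]
  refine integral_congr_ae ?_
  filter_upwards [hG] with s hs
  rw [hs]

/-- Two jointly measurable functions whose slices agree almost everywhere have the same
backprojection. -/
theorem ae_backprojection_eq {g g' : ℝ → ℝ → ℂ}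
    (hg : AEStronglyMeasurable (Function.uncurry g) (circleMeasure.prod volume))
    (hg' : AEStronglyMeasurable (Function.uncurry g') (circleMeasure.prod volume))
    (h : ∀ᵐ θ ∂circleMeasure, g θ =ᵐ[volume] g' θ) :
    ∀ᵐ y : Plane, ∀ᵐ θ ∂circleMeasure, g θ ⟪y, dir θ⟫_ℝ = g' θ ⟪y, dir θ⟫_ℝ := by
  have h1 : ∀ᵐ z ∂(circleMeasure.prod volume), Function.uncurry g z = Function.uncurry g' z := by
    have hm : ∀ᵐ θ ∂circleMeasure, ∀ᵐ s : ℝ, hg.mk _ (θ, s) = hg'.mk _ (θ, s) := by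
      filter_upwards [Measure.ae_ae_of_ae_prod hg.ae_eq_mk, Measure.ae_ae_of_ae_prod hg'.ae_eq_mk,
        h] with θ h1 h2 h3
      filter_upwards [h1, h2, h3] with s h4 h5 h6
      rw [← h4, ← h5]
      exact h6
    have hset : MeasurableSet {z | hg.mk _ z = hg'.mk _ z} :=
      hg.stronglyMeasurable_mk.measurableSet_eq_fun hg'.stronglyMeasurable_mk
    filter_upwards [hg.ae_eq_mk, hg'.ae_eq_mk, (Measure.ae_prod_iff_ae_ae hset).2 hm]
      with z h1 h2 h3
    rw [h1, h2, h3]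
  exact ae_ae_of_ae_prod_lines h1

end Backprojection

/-! ### The data on the detector line -/

section Data

/-- Every function in `H₀^{1/2}` of the disk has an admissible representative. -/
theorem MemH0Half.exists_isAdmissible {f : Plane → ℂ} (hf : MemH0Half f) :
    ∃ k, IsAdmissible k ∧ f =ᵐ[volume] k := by
  obtain ⟨hf2, hs, hsupp⟩ := hf
  set k : Plane → ℂ := (Metric.ball (0 : Plane) 1).indicator (hf2.1.mk f) with hk
  have hfk : f =ᵐ[volume] k := by
    filter_upwards [hf2.1.ae_eq_mk, hsupp] with y h1 h2
    rw [hk]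
    by_cases hy : y ∈ Metric.ball (0 : Plane) 1
    · rw [indicator_of_mem hy, h1]
    · rw [indicator_of_notMem hy, h2 (by simpa using hy)]
  have hk2 : MemLp k 2 volume := (memLp_congr_ae hfk).1 hf2
  have hzero : ∀ y, 1 ≤ ‖y‖ → k y = 0 := fun y hy => by
    rw [hk, indicator_of_notMem (by simpa using hy)]
  have hki : Integrable k := by
    have h1 : k = (Metric.ball (0 : Plane) 1).indicator k := by
      rw [hk, indicator_indicator, inter_self]
    rw [h1, integrable_indicator_iff measurableSet_ball]
    have : IsFiniteMeasure (volume.restrict (Metric.ball (0 : Plane) 1)) :=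
      ⟨by rw [Measure.restrict_apply_univ]; exact measure_ball_lt_top⟩
    exact (hk2.restrict _).integrable (by norm_num)
  refine ⟨k, ⟨hf2.1.stronglyMeasurable_mk.measurable.indicator measurableSet_ball, hki, hk2,
    hzero, ?_⟩, hfk⟩
  have h2 : hf2.toLp f = hk2.toLp k := (MemLp.toLp_eq_toLp_iff hf2 hk2).2 hfk
  rw [h2] at hs
  exact lintegral_enorm_mul_fourier_sq_lt_top hki hk2 hs

theorem fourierSlice_congr {f k : Plane → ℂ} (h : f =ᵐ[volume] k) :
    fourierSlice f = fourierSlice k := by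
  ext β σ
  exact Real.fourier_congr_ae h _

theorem ae_inner_dir_ne_zero {v : Plane} (hv : ‖v‖ = 1) :
    ∀ᵐ β ∂circleMeasure, ⟪v, dir β⟫_ℝ ≠ 0 := by
  obtain ⟨α, -, hα⟩ := exists_eq_norm_smul_dir v
  rw [hv, one_smul] at hα
  have hc : (range fun n : ℤ => α - (2 * n + 1) * Real.pi / 2).Countable := countable_range _
  have h := hc.ae_notMem (volume : Measure ℝ)
  refine ae_restrict_of_ae ?_
  filter_upwards [h] with β hβ h0
  rw [hα, inner_dir_dir, Real.cos_eq_zero_iff] at h0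
  obtain ⟨n, hn⟩ := h0
  exact hβ ⟨n, by simp only; linarith⟩

theorem ae_comp_sub_div {c d : ℝ} (hd : d ≠ 0) {P : ℝ → Prop} (h : ∀ᵐ t : ℝ, P t) :
    ∀ᵐ s : ℝ, P ((s - c) / d) := by
  have h1 : Measure.QuasiMeasurePreserving (fun s : ℝ => s * d⁻¹) volume volume := by
    refine ⟨by fun_prop, ?_⟩
    rw [Real.map_volume_mul_right (inv_ne_zero hd)]
    exact Measure.smul_absolutelyContinuous
  exact (measurePreserving_sub_right (volume : Measure ℝ) c).quasiMeasurePreserving.ae (h1.ae h)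

theorem inner_detector {p v : Plane} {β : ℝ} (hv : ⟪v, dir β⟫_ℝ ≠ 0) (s : ℝ) :
    ⟪p + detectorParam p v β s • v, dir β⟫_ℝ = s := by
  rw [inner_add_left, inner_smul_left, detectorParam]
  simp only [conj_trivial]
  field_simp
  ring

variable {p v : Plane} {f k : Plane → ℂ}

theorem one_lt_norm_of_line (hline : ∀ t : ℝ, p + t • v ∉ Metric.closedBall (0 : Plane) 1) (t : ℝ) :
    1 < ‖p + t • v‖ := by
  have := hline t
  rwa [mem_closedBall_zero_iff, not_le] at this

theorem ae_isTame_of_ae_eq (hk : IsAdmissible k) (hfk : f =ᵐ[volume] k) {x : Plane}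
    (hx : 1 < ‖x‖) : ∀ᵐ β ∂circleMeasure, IsTame f x β := by
  filter_upwards [ae_isTame hk.measurable hk.integrable hk.memLp hk.eq_zero hk.energy hx]
    with β hβ using hβ.congr hfk.symm

/-- For almost every axis, tameness holds at almost every detector, read in the linear variable. -/
theorem ae_ae_isTame_detector (hk : IsAdmissible k) (hfk : f =ᵐ[volume] k) (hv : ‖v‖ = 1)
    (hline : ∀ t : ℝ, p + t • v ∉ Metric.closedBall (0 : Plane) 1) :
    ∀ᵐ β ∂circleMeasure, ⟪v, dir β⟫_ℝ ≠ 0 ∧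
      ∀ᵐ s : ℝ, IsTame f (p + detectorParam p v β s • v) β := by
  have hmeas : MeasurableSet {z : ℝ × ℝ |
      ∫⁻ q, ‖oddQuotient (sheet k (p + z.1 • v) z.2) q‖ₑ < ⊤} := by
    have h1 : Measurable fun z : ℝ × ℝ => (p + z.1 • v, z.2) := by fun_prop
    have h2 := (measurable_lintegral_oddQuotient hk.measurable).comp h1
    simp only [Function.comp_def] at h2
    exact measurableSet_lt h2 measurable_const
  have h1 : ∀ᵐ t : ℝ, ∀ᵐ β ∂circleMeasure,
      ∫⁻ q, ‖oddQuotient (sheet k (p + t • v) β) q‖ₑ < ⊤ := by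
    refine Eventually.of_forall fun t => ?_
    filter_upwards [ae_isTame hk.measurable hk.integrable hk.memLp hk.eq_zero hk.energy
      (one_lt_norm_of_line hline t)] with β hβ
    exact (isTame_iff_lintegral_lt_top hk.measurable _ _).1 hβ
  have h2 := (Measure.ae_ae_comm (μ := (volume : Measure ℝ)) (ν := circleMeasure)
    (p := fun t β => ∫⁻ q, ‖oddQuotient (sheet k (p + t • v) β) q‖ₑ < ⊤) hmeas).1 h1
  filter_upwards [h2, ae_inner_dir_ne_zero hv] with β hβ hd
  refine ⟨hd, ?_⟩
  filter_upwards [ae_comp_sub_div (c := ⟪p, dir β⟫_ℝ) hd hβ] with s hs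
  exact ((isTame_iff_lintegral_lt_top hk.measurable _ _).2 hs).congr hfk.symm

/-- The principal values at a tame vertex exist, and the Hilbert transform of the Radon transform
agrees with the cone integral. -/
theorem cone_to_radon_of_isTame (hk : IsAdmissible k) (hfk : f =ᵐ[volume] k) {x : Plane}
    (hx : 1 < ‖x‖) {β : ℝ} (h : IsTame f x β) :
    PVConverges (hilbertIntegrand (radon f β) ⟪x, dir β⟫_ℝ) univ ⟪x, dir β⟫_ℝ ∧
      PVConverges (coneIntegrand (coneTransform f x β)) (Icc 0 Real.pi) (Real.pi / 2) ∧
      hilbert (radon f β) ⟪x, dir β⟫_ℝ = coneIntegral (coneTransform f x β) := by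
  have hf : Integrable f := hk.integrable.congr hfk.symm
  have hfd : ∀ᵐ y, ‖y - x‖ < ‖x‖ - 1 → f y = 0 := by
    filter_upwards [hfk] with y hy hyx
    rw [hy]
    refine hk.eq_zero y ?_
    have := norm_sub_norm_le x (x - y)
    rw [sub_sub_cancel, norm_sub_rev] at this
    linarith
  have h1 := hilbert_of_isTame hf h
  have h2 := cone_of_isTame hf (sub_pos.2 hx) hfd h
  exact ⟨h1.1, h2.1, by rw [h1.2, h2.2]⟩

/-- The data filtered on the detector line are the filtered slices, whose smoothness is known. -/
theorem ae_filteredData_ae_eq (hk : IsAdmissible k) (hfk : f =ᵐ[volume] k) (hv : ‖v‖ = 1)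
    (hline : ∀ t : ℝ, p + t • v ∉ Metric.closedBall (0 : Plane) 1) :
    ∀ᵐ β ∂circleMeasure,
      filteredData p v (coneData f p v) β =ᵐ[volume] filteredSlice k β := by
  have hf : Integrable f := hk.integrable.congr hfk.symm
  filter_upwards [ae_ae_isTame_detector hk hfk hv hline, hk.ae_slice] with β ⟨hd, h1⟩ h2
  have hs : Integrable (fourierSlice f β) := by
    rw [fourierSlice_congr hfk]
    exact integrable_fourierSlice hk.integrable h2
  filter_upwards [h1] with s h3
  have h4 := hilbert_eq_filteredSlice hf h3 hs
  rw [(cone_to_radon_of_isTame hk hfk (one_lt_norm_of_line hline _) h3).2.2,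
    inner_detector hd] at h4
  rw [filteredSlice, ← fourierSlice_congr hfk]
  exact h4

end Data

end ConeInversion

theorem mainTheorem2 (p v : Plane) (hv : ‖v‖ = 1)
    (hline : ∀ t : ℝ, p + t • v ∉ Metric.closedBall (0 : Plane) 1)
    (f : Plane → ℂ) (hf : MemH0Half f) :
    -- the cone-to-Radon relation at every detector
    (∀ t : ℝ, ∀ᵐ β ∂circleMeasure,
      PVConverges (hilbertIntegrand (radon f β) ⟪p + t • v, dir β⟫_ℝ) univ ⟪p + t • v, dir β⟫_ℝ ∧
      PVConverges (coneIntegrand (coneTransform f (p + t • v) β)) (Icc 0 Real.pi)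
        (Real.pi / 2) ∧
      hilbert (radon f β) ⟪p + t • v, dir β⟫_ℝ =
        coneIntegral (coneTransform f (p + t • v) β)) ∧
    -- the data on the detector line determine `H R f` almost everywhere
    (∀ᵐ β ∂circleMeasure, ∀ᵐ s : ℝ,
      PVConverges (hilbertIntegrand (radon f β) s) univ s ∧
      PVConverges (coneIntegrand (coneData f p v (detectorParam p v β s) β)) (Icc 0 Real.pi)
        (Real.pi / 2) ∧
      hilbert (radon f β) s = filteredData p v (coneData f p v) β s) ∧
    -- differentiating in the linear variable and backprojecting recovers `f`
    (∃ g : ℝ → ℝ → ℂ, IsLinearDeriv (filteredData p v (coneData f p v)) g) ∧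
    (∀ g : ℝ → ℝ → ℂ, IsLinearDeriv (filteredData p v (coneData f p v)) g →
      ∀ᵐ y : Plane, Integrable (fun θ => g θ ⟪y, dir θ⟫_ℝ) circleMeasure ∧
        f y = ((1 / (4 * Real.pi) : ℝ) : ℂ) * backprojection g y) := by
  obtain ⟨k, hk, hfk⟩ := hf.exists_isAdmissible
  obtain ⟨g₀, hg₀, hg₀2, hlim⟩ := hk.exists_limit_ramp
  have hweak₀ : ∀ᵐ β ∂circleMeasure,
      IsWeakDeriv (filteredData p v (coneData f p v) β) (g₀ β) := by
    filter_upwards [hk.ae_isWeakDeriv hg₀ hg₀2 hlim, ae_filteredData_ae_eq hk hfk hv hline]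
      with β h1 h2 using h1.congr h2.symm
  refine ⟨fun t => ?_, ?_, ⟨g₀, hg₀.aestronglyMeasurable, hweak₀⟩, fun g hg => ?_⟩
  · have hx := one_lt_norm_of_line hline t
    filter_upwards [ae_isTame_of_ae_eq hk hfk hx] with β hβ
    exact cone_to_radon_of_isTame hk hfk hx hβ
  · filter_upwards [ae_ae_isTame_detector hk hfk hv hline] with β ⟨hd, h1⟩
    filter_upwards [h1] with s hs
    have h2 := cone_to_radon_of_isTame hk hfk (one_lt_norm_of_line hline _) hs
    rw [inner_detector hd] at h2
    exact h2
  · -- any weak derivative agrees with `g₀` on almost every line, hence has the same backprojection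
    have hslice : ∀ᵐ θ ∂circleMeasure, g₀ θ =ᵐ[volume] g θ := by
      filter_upwards [hweak₀, hg.2] with θ h1 h2 using h1.ae_eq h2
    filter_upwards [ae_backprojection_eq hg₀.aestronglyMeasurable hg.1 hslice,
      ae_integrable_backprojection hg₀ hg₀2, hk.ae_eq_backprojection hg₀ hg₀2 hlim, hfk]
      with y h1 h2 h3 h4
    refine ⟨h2.congr h1, ?_⟩
    have h5 : backprojection g y = backprojection g₀ y :=
      integral_congr_ae (h1.mono fun θ h => h.symm)
    rw [h5, ← h3, h4, ← mul_assoc, ← Complex.ofReal_mul, one_div,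
      inv_mul_cancel₀ (by positivity), Complex.ofReal_one, one_mul]
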